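/- Consider the following MIMO system with $N_t$ transmit and $N_r$ receive antennas. The received vector is $\mathbf r=\mathbf H\mathbf F\mathbf s+\boldsymbol\xi$. The entries of $\mathbf s\in\mathbb C^{N_t}$ are independent and uniformly distributed on a constellation $\mathcal S\subset\mathbb C$. The rows of the $N_r\times N_t$ channel matrix $\mathbf H$ are independent zero-mean circularly-symmetric complex Gaussian vectors with $\mathbb E[\overline{H_{\ell m}}H_{\ell n}]=[\mathbf\Sigma]_{mn}$. The noise $\boldsymbol\xi$ is circularly-symmetric complex Gaussian with covariance $\eta^{-1}\mathbf I$, where $\eta>0$ is the system SNR. The triple $\mathbf H,\mathbf s,\boldsymbol\xi$ is independent. The zero-forcing detector forms $\mathbf r'=(\mathbf H\mathbf F)^+\mathbf r$ with $\mathbf A^+=(\mathbf A^H\mathbf A)^{-1}\mathbf A^H$ and decides $\hat s_k\in\arg\min_{s\in\mathcal S}|r'_k-s|^2$ for each $k$ (by any fixed decision rule, whatever it does with ties). The average symbol error probability is $\mathrm P_{N_t}(\mathbf F)=\frac1{N_t}\sum_{k=1}^{N_t}\Pr(\hat s_k\ne s_k)$, where the probability is over $\mathbf H$, $\mathbf s$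 and $\boldsymbol\xi$. Let $\sigma:\mathbb Z\to\mathbb C$ satisfy $\sigma(-k)=\overline{\sigma(k)}$ and $\sum_k|\sigma(k)|^2<\infty$. For each $N_t$ let $\mathbf\Sigma$ be the $N_t\times N_t$ Toeplitz matrix with $[\mathbf\Sigma]_{mn}=\sigma(m-n)$. Let $s_\Sigma(\omega)=\sum_{k\in\mathbb Z}\sigma(k)e^{-jk\omega}$, with convergence in $L^2(0,2\pi)$, and assume that the essential infimum of $s_\Sigma$ is positive. Put $\Lambda=\frac1{2\pi}\int_0^{2\pi}\frac{d\omega}{\sqrt{s_\Sigma(\omega)}}$. Let the precoder be $$\widetilde{\mathbf F}=\frac1{\sqrt{\operatorname{tr}(\mathbf\Lambda^{-1/2})}}\,\mathbf W\mathbf\Lambda^{-1/4}\mathbf V,$$ where $\mathbf\Sigma=\mathbf W\mathbf\Lambda\mathbf W^H$ is any eigenvalue decomposition of $\mathbf\Sigma$ with $\mathbf W$ unitary and $\mathbf\Lambda=\operatorname{diag}(\lambda_1\le\dots\le\lambda_{N_t})$, and $\mathbf V$ is the normalized $N_t\times N_t$ DFT matrix. Finally let $Q(x)=\frac1{\sqrt{2\pi}}\int_x^\infty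 e^{-t^2/2}\,dt$. Let $\beta>1$ be fixed and let $N_t\to\infty$ with $N_r=\beta N_t$ (through values of $N_t$ for which $\beta N_t$ is an integer). Then $\lim_{N_t\to\infty}\mathrm P_{N_t}(\widetilde{\mathbf F})$ exists for each of the following constellations, all normalized to unit average energy, and it equals: * for $M$-ary PAM, $M\ge2$: $\displaystyle\frac{2(M-1)}{M}\,Q\!\left(\sqrt{\frac{6\eta(\beta-1)}{(M^2-1)\Lambda^2}}\right)$; * for $M$-ary PSK, $M\ge2$: $\displaystyle\frac1\pi\int_0^{(M-1)\pi/M}\exp\!\left(-\frac{\eta(\beta-1)\sin^2(\pi/M)}{\Lambda^2\sin^2\theta}\right)d\theta$; * for square $M$-ary QAM, $M=L^2$ with $L\ge2$: $\displaystyle\frac{4(\sqrt M-1)}{\sqrt M}\,Q\!\left(\sqrt{\frac{3\eta(\beta-1)}{(M-1)\Lambda^2}}\right)-\frac{4(\sqrt M-1)^2}{M}\,Q^2\!\left(\sqrt{\frac{3\eta(\beta-1)}{(M-1)\Lambda^2}}\right)$. -/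

import Mathlib

open MeasureTheory ProbabilityTheory Filter Topology
open scoped Matrix ComplexConjugate NNReal

noncomputable section

namespace MassiveMIMO

/-! ### Toeplitz covariance matrices and their symbol -/

/-- The `N × N` Toeplitz matrix whose `(m, n)` entry is `σ (m - n)`. -/
def toeplitz (σ : ℤ → ℂ) (N : ℕ) : Matrix (Fin N) (Fin N) ℂ :=
  Matrix.of fun m n => σ ((m : ℤ) - (n : ℤ))

instance fact_two_pi_pos : Fact (0 < 2 * Real.pi) := ⟨Real.two_pi_pos⟩

/-- The symbol `∑ₖ σ(k) e^{-jkω}` of a square-summable sequence: the sum of the series in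
`L²` of the circle of length `2π` (where `fourier k` is the function `ω ↦ e^{jkω}`). -/
def symbolL2 (σ : ℤ → ℂ) :
    Lp ℂ 2 (AddCircle.haarAddCircle : Measure (AddCircle (2 * Real.pi))) :=
  ∑' k : ℤ, σ k • fourierLp 2 (-k)

/-- The symbol as a real function of the angular frequency. For a Hermitian sequence
(`σ (-k) = conj (σ k)`) the symbol is real almost everywhere. -/
def symbol (σ : ℤ → ℂ) (ω : ℝ) : ℝ :=
  (symbolL2 σ (ω : AddCircle (2 * Real.pi))).re

/-- The essential infimum of the symbol over one period. -/
def symbolEssInf (σ : ℤ → ℂ) : ℝ :=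
  essInf (symbol σ) (volume.restrict (Set.Ioc 0 (2 * Real.pi)))

/-- `Λ = (1 / 2π) ∫₀^{2π} dω / √(s(ω))`. -/
def Lam (σ : ℤ → ℂ) : ℝ :=
  1 / (2 * Real.pi) * ∫ ω in (0 : ℝ)..(2 * Real.pi), 1 / √(symbol σ ω)

/-! ### The precoder -/

/-- The normalized `N × N` discrete Fourier transform matrix. -/
def dftMatrix (N : ℕ) : Matrix (Fin N) (Fin N) ℂ :=
  Matrix.of fun m n =>
    ((1 / √(N : ℝ) : ℝ) : ℂ) *
      Complex.exp (-(2 * Real.pi * Complex.I * (m : ℕ) * (n : ℕ) / (N : ℂ)))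

/-- `F = tr(Λ^{-1/2})^{-1/2} W Λ^{-1/4} V`, where `S = W Λ Wᴴ` is an eigenvalue decomposition with
`W` unitary and `Λ = diag(λ₁ ≤ ⋯ ≤ λ_N)`, and `V` is the normalized DFT matrix. -/
def IsOptimalPrecoder {N : ℕ} (S F : Matrix (Fin N) (Fin N) ℂ) : Prop :=
  ∃ W ∈ Matrix.unitaryGroup (Fin N) ℂ, ∃ ev : Fin N → ℝ,
    Monotone ev ∧
    S = W * Matrix.diagonal (fun k => ((ev k : ℝ) : ℂ)) * Wᴴ ∧
    F = ((1 / √(∑ k, ev k ^ (-(1 / 2) : ℝ)) : ℝ) : ℂ) •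
      (W * Matrix.diagonal (fun k => ((ev k ^ (-(1 / 4) : ℝ) : ℝ) : ℂ)) * dftMatrix N)

/-! ### Channel, noise and symbols -/

/-- The circularly-symmetric complex Gaussian law with mean `0` and variance `E|z|² = v`. -/
def complexGaussian (v : ℝ≥0) : Measure ℂ :=
  ((gaussianReal 0 (v / 2)).prod (gaussianReal 0 (v / 2))).map fun p => ⟨p.1, p.2⟩

open scoped MatrixOrder in
/-- The law of the channel matrix `H` (`Nr × Nt`): the rows of `H` are independent
circularly-symmetric complex Gaussian vectors with mean `0` and
`E[conj(H_{ℓ,m}) H_{ℓ,n}] = S_{m,n}`, that is `H = G S^{1/2}`, where `G` has independent entries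
of mean `0` and variance `1`. -/
def channelLaw (Nr Nt : ℕ) (S : Matrix (Fin Nt) (Fin Nt) ℂ) : Measure (Fin Nr → Fin Nt → ℂ) :=
  (Measure.pi fun _ : Fin Nr => Measure.pi fun _ : Fin Nt => complexGaussian 1).map
    fun G => Matrix.of G * CFC.sqrt S

/-- The law of the noise vector: independent circularly-symmetric complex Gaussian entries of
variance `1 / η`, where `η` is the system SNR (the total transmit power is one). -/
def noiseLaw (Nr : ℕ) (η : ℝ) : Measure (Fin Nr → ℂ) :=
  Measure.pi fun _ : Fin Nr => complexGaussian (1 / η).toNNReal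

/-- The law of the symbol vector: independent entries, uniform on the constellation. -/
def symbolsLaw (Nt : ℕ) (C : Finset ℂ) : Measure (Fin Nt → ℂ) :=
  Measure.pi fun _ : Fin Nt => uniformOn (C : Set ℂ)

/-- The joint law of the independent triple (channel, symbols, noise). -/
def systemLaw (Nr Nt : ℕ) (S : Matrix (Fin Nt) (Fin Nt) ℂ) (η : ℝ) (C : Finset ℂ) :
    Measure ((Fin Nr → Fin Nt → ℂ) × (Fin Nt → ℂ) × (Fin Nr → ℂ)) :=
  (channelLaw Nr Nt S).prod ((symbolsLaw Nt C).prod (noiseLaw Nr η))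

/-! ### Zero-forcing detection and the symbol error probability -/

/-- The pseudo-inverse `(Aᴴ A)⁻¹ Aᴴ` of a matrix of full column rank. -/
def pinv {Nr Nt : ℕ} (A : Matrix (Fin Nr) (Fin Nt) ℂ) : Matrix (Fin Nt) (Fin Nr) ℂ :=
  (Aᴴ * A)⁻¹ * Aᴴ

/-- The zero-forcing equalized vector `r' = (H F)⁺ r`, where `r = H F s + ξ`. -/
def zfOutput {Nr Nt : ℕ} (F : Matrix (Fin Nt) (Fin Nt) ℂ)
    (H : Matrix (Fin Nr) (Fin Nt) ℂ) (s : Fin Nt → ℂ) (ξ : Fin Nr → ℂ) : Fin Nt → ℂ :=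
  pinv (H * F) *ᵥ ((H * F) *ᵥ s + ξ)

/-- `δ` is a hard decision `δ z ∈ argmin_{s ∈ C} |z - s|²` (ties may be broken in any way). -/
def IsHardDecision (C : Finset ℂ) (δ : ℂ → ℂ) : Prop :=
  ∀ z, δ z ∈ C ∧ ∀ s ∈ C, ‖z - δ z‖ ^ 2 ≤ ‖z - s‖ ^ 2

/-- The average symbol error probability of zero-forcing detection with precoder `F`: the mean
over `k` of the probabilities that the decision on the `k`-th symbol is wrong, where the channel,
the symbols and the noise are all random. -/
def averageSEP (Nr Nt : ℕ) (S : Matrix (Fin Nt) (Fin Nt) ℂ) (η : ℝ) (C : Finset ℂ) (δ : ℂ → ℂ)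
    (F : Matrix (Fin Nt) (Fin Nt) ℂ) : ℝ :=
  (1 / (Nt : ℝ)) * ∑ k : Fin Nt,
    (systemLaw Nr Nt S η C).real
      {x | δ (zfOutput F (Matrix.of x.1) x.2.1 x.2.2 k) ≠ x.2.1 k}

/-! ### Constellations of mean zero and unit average energy -/

/-- The `M`-ary PAM constellation: `√(3 / (M² - 1)) · {-(M-1), -(M-3), …, M-1}`. -/
def pam (M : ℕ) : Finset ℂ :=
  Finset.univ.image fun m : Fin M =>
    ((√(3 / ((M : ℝ) ^ 2 - 1)) * (2 * (m : ℕ) + 1 - M) : ℝ) : ℂ)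

/-- The `M`-ary PSK constellation: the `M`-th roots of unity. -/
def psk (M : ℕ) : Finset ℂ :=
  Finset.univ.image fun m : Fin M => Complex.exp (2 * Real.pi * Complex.I * (m : ℕ) / (M : ℂ))

/-- The square `L²`-ary QAM constellation: with `M = L²`, the points `√(3 / (2 (M - 1))) (a + j b)`
with `a, b ∈ {-(L-1), -(L-3), …, L-1}`. -/
def squareQAM (L : ℕ) : Finset ℂ :=
  Finset.univ.image fun p : Fin L × Fin L =>
    ((√(3 / (2 * ((L : ℝ) ^ 2 - 1))) : ℝ) : ℂ) *
      (((2 * (p.1 : ℕ) + 1 - L : ℝ) : ℂ) + ((2 * (p.2 : ℕ) + 1 - L : ℝ) : ℂ) * Complex.I)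

/-- The Gaussian tail function `Q(x) = (2π)^{-1/2} ∫ₓ^∞ e^{-t²/2} dt`. -/
def Q (x : ℝ) : ℝ :=
  1 / √(2 * Real.pi) * ∫ t in Set.Ioi x, Real.exp (-t ^ 2 / 2)

end MassiveMIMO

end

/-!
Conditionally on the channel `H`, the zero-forcing output is `r' = s + (H F)⁺ ξ`, and the `k`-th
component of the noise `(H F)⁺ ξ` is complex Gaussian of variance
`η⁻¹ [((H F)ᴴ (H F))⁻¹]ₖₖ`. So the conditional error probability of the `k`-th symbol is the error
probability `errProb C v` of minimum distance decisions in scalar complex Gaussian noise of that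
variance `v` (`systemLaw_error_eq`); ties have probability zero, so the decision rule does not
matter.

Write `H = G S^{1/2}` with `G` standard Gaussian. By unitary invariance,
`[((H F)ᴴ (H F))⁻¹]ₖₖ` has the law of `[(Fᴴ S F)⁻¹]ₖₖ / ∑ ‖zᵢ‖²`, a sum over `Nr - Nt + 1`
independent standard complex Gaussians: the diagonal entry of an inverse Gram matrix is the inverse
squared distance of one column to the span of the other `Nt - 1` columns
(`inv_gram_apply_zero`, `map_inv_gram_quadratic`). For the precoder at hand the DFT factor spreads
the noise evenly, and all diagonal entries of `(Fᴴ S F)⁻¹` equal `tr(Λ^{-1/2})² / Nt`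
(`inv_precoder_gram`).

By Szegő's limit theorem, `tr(Λ^{-1/2}) / Nt` converges to `Lam σ`
(`tendsto_trace_inv_sqrt_toeplitz`). Only square summability of `σ` is available, so this is proved
by convexity. Each eigenvalue is the average of the symbol against the squared modulus of a
trigonometric polynomial, and these squared moduli add up to `Nt`: Jensen's inequality for
`x ↦ x^{-1/2}` gives the upper bound, and the tangent lines at the values of the symbol, together
with Cesàro summation of Parseval's series, give the lower bound.

By Chebyshev's inequality `∑ ‖zᵢ‖²` concentrates at its mean `Nr - Nt + 1 ∼ (β - 1) Nt`, so the
noise variance concentrates at `Λ² / ((β - 1) η)`, and the average error probability converges by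
continuity of `errProb` (`tendsto_averageSEP`). The three formulas are the values of `errProb` at
this variance. For PAM and QAM the decision regions are products of intervals (`errProb_pam`,
`errProb_squareQAM`); for PSK the decision region is a wedge, and integration in polar coordinates
gives Craig's formula (`errProb_psk`).
-/

noncomputable section

namespace MassiveMIMO

/-! ### Complex Gaussian vectors -/

lemma measurable_complex_mk : Measurable fun p : ℝ × ℝ => (⟨p.1, p.2⟩ : ℂ) :=
  Complex.measurableEquivRealProd.symm.measurable

instance isProbabilityMeasure_complexGaussian (v : ℝ≥0) :
    IsProbabilityMeasure (complexGaussian v) :=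
  Measure.isProbabilityMeasure_map measurable_complex_mk.aemeasurable

lemma charFunDual_gaussianReal (v : ℝ≥0) (L : StrongDual ℝ ℝ) :
    charFunDual (gaussianReal 0 v) L = Complex.exp (-(v * L 1 ^ 2 / 2 : ℝ)) := by
  rw [charFunDual_eq_charFun_map_one, gaussianReal_map_continuousLinearMap, charFun_gaussianReal]
  congr 1
  simp [max_eq_left (sq_nonneg (L 1))]
  ring

lemma charFunDual_complexGaussian (v : ℝ≥0) (L : StrongDual ℝ ℂ) :
    charFunDual (complexGaussian v) L =
      Complex.exp (-(v / 4 * (L 1 ^ 2 + L Complex.I ^ 2) : ℝ)) := by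
  have : complexGaussian v = ((gaussianReal 0 (v / 2)).prod (gaussianReal 0 (v / 2))).map
      (Complex.equivRealProdCLM.symm : ℝ × ℝ →L[ℝ] ℂ) := by
    unfold complexGaussian
    congr 1
  rw [this, charFunDual_map, charFunDual_prod, charFunDual_gaussianReal, charFunDual_gaussianReal,
    ← Complex.exp_add]
  have h1 : Complex.equivRealProdCLM.symm ((1 : ℝ), (0 : ℝ)) = 1 := by simp [Complex.ext_iff]
  have h2 : Complex.equivRealProdCLM.symm ((0 : ℝ), (1 : ℝ)) = Complex.I := by
    simp [Complex.ext_iff]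
  congr 1
  simp [h1, h2]
  ring

/-- A real-linear functional on `ℂᵐ` is the real part of a pairing. -/
lemma exists_strongDual_eq_re {m : ℕ} (L : StrongDual ℝ (Fin m → ℂ)) :
    ∃ t : Fin m → ℂ, ∀ w, L w = (∑ i, t i * w i).re := by
  refine ⟨fun i => L (Pi.single i 1) - Complex.I * L (Pi.single i Complex.I), fun w => ?_⟩
  have h : w = ∑ i, ((w i).re • (Pi.single i (1 : ℂ) : Fin m → ℂ) +
      (w i).im • (Pi.single i Complex.I : Fin m → ℂ)) := by
    ext j
    simp [Finset.sum_apply, Pi.single_apply, Finset.sum_add_distrib, Complex.re_add_im]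
  conv_lhs => rw [h]
  rw [map_sum, Complex.re_sum]
  refine Finset.sum_congr rfl fun i _ => ?_
  simp
  ring

/-- A matrix with orthogonal rows of squared length `c` maps a vector of independent complex
Gaussians of variance `v` to a vector of independent complex Gaussians of variance `c v`. -/
lemma pi_complexGaussian_map_mulVec {m n : ℕ} (B : Matrix (Fin m) (Fin n) ℂ) (c v : ℝ≥0)
    (hB : B * Bᴴ = ((c : ℝ) : ℂ) • (1 : Matrix (Fin m) (Fin m) ℂ)) :
    (Measure.pi fun _ : Fin n => complexGaussian v).map (fun w => B *ᵥ w) =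
      Measure.pi fun _ : Fin m => complexGaussian (c * v) := by
  let BL : (Fin n → ℂ) →L[ℝ] (Fin m → ℂ) := (Matrix.mulVecLin B).toContinuousLinearMap.restrictScalars ℝ
  have hBL : (fun w => B *ᵥ w) = BL := by ext w; rfl
  rw [hBL]
  have : IsProbabilityMeasure ((Measure.pi fun _ : Fin n => complexGaussian v).map BL) :=
    Measure.isProbabilityMeasure_map BL.measurable.aemeasurable
  apply Measure.ext_of_charFunDual
  ext L
  obtain ⟨t, ht⟩ := exists_strongDual_eq_re L
  rw [charFunDual_map, charFunDual_pi, charFunDual_pi]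
  simp_rw [charFunDual_complexGaussian, ← Complex.exp_sum]
  congr 1
  have h1 : ∀ j, (((L.comp BL).comp (ContinuousLinearMap.single ℝ (fun _ => ℂ) j)) 1) ^ 2 +
      (((L.comp BL).comp (ContinuousLinearMap.single ℝ (fun _ => ℂ) j)) Complex.I) ^ 2 =
      Complex.normSq ((t ᵥ* B) j) := fun j => by
    have hs : ∀ z, ((L.comp BL).comp (ContinuousLinearMap.single ℝ (fun _ => ℂ) j)) z =
        ((t ᵥ* B) j * z).re := fun z => by
      change L (B *ᵥ Pi.single j z) = _
      rw [ht]
      simp [Matrix.vecMul, dotProduct, Finset.sum_mul, mul_assoc]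
    rw [hs, hs, Complex.normSq_apply]
    simp
    ring
  have h2 : ∀ j, ((L.comp (ContinuousLinearMap.single ℝ (fun _ => ℂ) j)) 1) ^ 2 +
      ((L.comp (ContinuousLinearMap.single ℝ (fun _ => ℂ) j)) Complex.I) ^ 2 =
      Complex.normSq (t j) := fun j => by
    have hs : ∀ z, (L.comp (ContinuousLinearMap.single ℝ (fun _ => ℂ) j)) z =
        (t j * z).re := fun z => by
      change L (Pi.single j z) = _
      rw [ht]
      simp [Pi.single_apply]
    rw [hs, hs, Complex.normSq_apply]
    simp
    ring
  have h3 : ∑ j, Complex.normSq ((t ᵥ* B) j) = c * ∑ j, Complex.normSq (t j) := by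
    have e : ∀ {k : ℕ} (u : Fin k → ℂ), ((∑ j, Complex.normSq (u j) : ℝ) : ℂ) = u ⬝ᵥ star u :=
      fun u => by simp [dotProduct, Complex.mul_conj]
    rw [← Complex.ofReal_inj, Complex.ofReal_mul, e, e, Matrix.star_vecMul,
      Matrix.dotProduct_mulVec, Matrix.vecMul_vecMul, hB, Matrix.vecMul_smul,
      Matrix.vecMul_one, smul_dotProduct, smul_eq_mul]
  simp_rw [h1, h2, ← Complex.ofReal_neg, ← Complex.ofReal_sum, Finset.sum_neg_distrib,
    ← Finset.mul_sum, h3]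
  push_cast
  ring

/-- Transposing an array of independent, identically distributed entries preserves its law. -/
lemma pi_pi_map_swap {m n : ℕ} (μ : Measure ℂ) [IsProbabilityMeasure μ] :
    (Measure.pi fun _ : Fin m => Measure.pi fun _ : Fin n => μ).map (fun G j i => G i j) =
      Measure.pi fun _ : Fin n => Measure.pi fun _ : Fin m => μ := by
  let T : (Fin m → Fin n → ℂ) →L[ℝ] (Fin n → Fin m → ℂ) :=
    ContinuousLinearMap.pi fun j => ContinuousLinearMap.pi fun i =>
      (ContinuousLinearMap.proj (R := ℝ) (φ := fun _ : Fin n => ℂ) j).comp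
        (ContinuousLinearMap.proj (R := ℝ) (φ := fun _ : Fin m => Fin n → ℂ) i)
  have hT : (fun (G : Fin m → Fin n → ℂ) j i => G i j) = T := by ext w; rfl
  rw [hT]
  have : IsProbabilityMeasure
      ((Measure.pi fun _ : Fin m => Measure.pi fun _ : Fin n => μ).map T) :=
    Measure.isProbabilityMeasure_map T.measurable.aemeasurable
  apply Measure.ext_of_charFunDual
  ext L
  rw [charFunDual_map]
  simp_rw [charFunDual_pi]
  rw [Finset.prod_comm]
  refine Finset.prod_congr rfl fun j _ => Finset.prod_congr rfl fun i _ => ?_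
  congr 1
  ext z
  simp only [ContinuousLinearMap.comp_apply]
  congr 1
  ext j' i'
  by_cases hj : j' = j <;> by_cases hi : i' = i <;> simp [T, hj, hi]

lemma complexGaussian_absolutelyContinuous {v : ℝ≥0} (hv : v ≠ 0) :
    complexGaussian v ≪ volume := by
  have h := (gaussianReal_absolutelyContinuous 0 (v := v / 2) (by positivity)).prod
    (gaussianReal_absolutelyContinuous 0 (v := v / 2) (by positivity))
  have h2 := h.map measurable_complex_mk
  refine h2.trans ?_
  rw [← Measure.volume_eq_prod]
  exact Complex.volume_preserving_equiv_real_prod.symm.map_eq.absolutelyContinuous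

/-! ### The diagonal of the inverse Gram matrix of a complex Gaussian matrix -/

/-- The law of a vector of `n` independent standard complex Gaussians. -/
abbrev stdComplexGaussian (n : ℕ) : Measure (Fin n → ℂ) :=
  Measure.pi fun _ : Fin n => complexGaussian 1

lemma stdComplexGaussian_map_mulVec {m n : ℕ} (B : Matrix (Fin m) (Fin n) ℂ) (hB : B * Bᴴ = 1) :
    (stdComplexGaussian n).map (fun w => B *ᵥ w) = stdComplexGaussian m := by
  have := pi_complexGaussian_map_mulVec B 1 1 (by simpa using hB)
  simpa using this

/-- Coordinates with respect to an orthonormal basis of the orthogonal complement of the span of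
linearly independent vectors. -/
lemma exists_orthonormal_coordinates {m n : ℕ} (g : Fin m → Fin n → ℂ)
    (hg : LinearIndependent ℂ g) :
    ∃ D : Matrix (Fin (n - m)) (Fin n) ℂ, D * Dᴴ = 1 ∧ (∀ j, D *ᵥ g j = 0) ∧
      ∀ y, (∀ j, star (g j) ⬝ᵥ y = 0) → Dᴴ *ᵥ (D *ᵥ y) = y := by
  let g' : Fin m → EuclideanSpace ℂ (Fin n) := fun j => WithLp.toLp 2 (g j)
  have hg' : LinearIndependent ℂ g' :=
    hg.map' (WithLp.linearEquiv 2 ℂ (Fin n → ℂ)).symm.toLinearMap (LinearEquiv.ker _)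
  let K := Submodule.span ℂ (Set.range g')
  have hK : Module.finrank ℂ K = m := by
    simpa using finrank_span_eq_card hg'
  have hKo : Module.finrank ℂ Kᗮ = n - m := by
    have := K.finrank_add_finrank_orthogonal
    rw [hK, finrank_euclideanSpace_fin] at this
    omega
  let b := (stdOrthonormalBasis ℂ Kᗮ).reindex (finCongr hKo)
  let D : Matrix (Fin (n - m)) (Fin n) ℂ := Matrix.of fun i => star (WithLp.ofLp (b i : EuclideanSpace ℂ (Fin n)))
  have hD : ∀ (y : Fin n → ℂ) i, (D *ᵥ y) i = inner ℂ (b i : EuclideanSpace ℂ (Fin n)) (WithLp.toLp 2 y) :=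
    fun y i => by
      simp [D, Matrix.mulVec, dotProduct, PiLp.inner_apply, mul_comm]
  refine ⟨D, ?_, fun j => ?_, fun y hy => ?_⟩
  · ext i j
    have : (D * Dᴴ) i j = (D *ᵥ (WithLp.ofLp (b j : EuclideanSpace ℂ (Fin n)))) i := by
      simp [D, Matrix.mul_apply, Matrix.mulVec, dotProduct]
    rw [this, hD]
    have := (orthonormal_iff_ite.1 b.orthonormal) i j
    rw [Submodule.coe_inner] at this
    rw [Matrix.one_apply]
    exact this
  · ext i
    rw [hD]
    exact (Submodule.mem_orthogonal' _ _).1 (b i).2 _ (Submodule.subset_span ⟨j, rfl⟩)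
  · have hyK : (WithLp.toLp 2 y : EuclideanSpace ℂ (Fin n)) ∈ Kᗮ := by
      rw [Submodule.mem_orthogonal]
      intro u hu
      induction hu using Submodule.span_induction with
      | mem x hx =>
        obtain ⟨j, rfl⟩ := hx
        rw [← hy j]
        simp [g', PiLp.inner_apply, dotProduct, mul_comm]
      | zero => simp
      | add x z _ _ hx hz => rw [inner_add_left, hx, hz, add_zero]
      | smul c x _ hx => rw [inner_smul_left, hx, mul_zero]
    have h := b.sum_repr ⟨_, hyK⟩
    have h2 := congrArg (fun z : Kᗮ => WithLp.ofLp (z : EuclideanSpace ℂ (Fin n))) h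
    simp only at h2
    conv_rhs => rw [← h2]
    ext l
    simp [Matrix.mulVec, dotProduct, OrthonormalBasis.repr_apply_apply, Finset.sum_apply]
    refine Finset.sum_congr rfl fun i _ => ?_
    rw [mul_comm]
    congr 1
    · rw [← hD]; rfl
    · simp [D]

lemma linearIndependent_iff_mulVec {m n : ℕ} (g : Fin m → Fin n → ℂ) :
    LinearIndependent ℂ g ↔ ∀ x, (Matrix.of g)ᵀ *ᵥ x = 0 → x = 0 := by
  rw [Fintype.linearIndependent_iff]
  have : ∀ x : Fin m → ℂ, (Matrix.of g)ᵀ *ᵥ x = ∑ i, x i • g i := fun x => by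
    ext l
    simp [Matrix.mulVec, dotProduct, Finset.sum_apply, mul_comm]
  simp_rw [this]
  exact ⟨fun h x hx => funext (h x hx), fun h x hx i => congrFun (h x hx) i⟩

open scoped ComplexOrder in
lemma linearIndependent_iff_det_gram {m n : ℕ} (g : Fin m → Fin n → ℂ) :
    LinearIndependent ℂ g ↔ ((Matrix.of g)ᵀᴴ * (Matrix.of g)ᵀ).det ≠ 0 := by
  rw [linearIndependent_iff_mulVec, ne_eq, ← Matrix.exists_mulVec_eq_zero_iff]
  simp only [Matrix.conjTranspose_mul_self_mulVec_eq_zero]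
  push Not
  exact ⟨fun h v hv h0 => hv (h v h0), fun h x hx => by_contra fun h0 => h x h0 hx⟩

open scoped ComplexOrder in
/-- The first diagonal entry of the inverse Gram matrix is the inverse squared distance of the
first vector to the span of the others. (If the Gram matrix is singular, both sides are `0`.) -/
lemma inv_gram_apply_zero {m n d : ℕ} (g0 : Fin n → ℂ) (g : Fin m → Fin n → ℂ)
    (hg : LinearIndependent ℂ g) (D : Matrix (Fin d) (Fin n) ℂ)
    (hDg : ∀ j, D *ᵥ g j = 0)
    (hDy : ∀ y, (∀ j, star (g j) ⬝ᵥ y = 0) → Dᴴ *ᵥ (D *ᵥ y) = y) :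
    ((Matrix.of (Fin.cons g0 g : Fin (m + 1) → Fin n → ℂ))ᵀᴴ *
        (Matrix.of (Fin.cons g0 g : Fin (m + 1) → Fin n → ℂ))ᵀ)⁻¹ 0 0 =
      (((∑ i, ‖(D *ᵥ g0) i‖ ^ 2)⁻¹ : ℝ) : ℂ) := by
  set A : Matrix (Fin n) (Fin (m + 1)) ℂ := (Matrix.of (Fin.cons g0 g))ᵀ with hA
  have hAx : ∀ x : Fin (m + 1) → ℂ, A *ᵥ x = x 0 • g0 + ∑ j : Fin m, x j.succ • g j := fun x => by
    ext l
    simp [A, Matrix.mulVec, dotProduct, Finset.sum_apply, mul_comm, Fin.sum_univ_succ]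
  have hDA : ∀ x : Fin (m + 1) → ℂ, D *ᵥ (A *ᵥ x) = x 0 • (D *ᵥ g0) := fun x => by
    rw [hAx, Matrix.mulVec_add, Matrix.mulVec_smul, Matrix.mulVec_sum]
    simp [Matrix.mulVec_smul, hDg]
  have hnorm : star (D *ᵥ g0) ⬝ᵥ (D *ᵥ g0) = ((∑ i, ‖(D *ᵥ g0) i‖ ^ 2 : ℝ) : ℂ) := by
    simp [dotProduct, Complex.conj_mul']
  by_cases hdet : (Aᴴ * A).det = 0
  · have hinv : (Aᴴ * A)⁻¹ = 0 := by
      rw [Matrix.nonsing_inv_apply_not_isUnit]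
      simpa using hdet
    obtain ⟨x, hx, hx0⟩ := Matrix.exists_mulVec_eq_zero_iff.2 hdet
    rw [Matrix.conjTranspose_mul_self_mulVec_eq_zero] at hx0
    have h1 := hDA x
    rw [hx0, Matrix.mulVec_zero] at h1
    have hne : x 0 ≠ 0 := fun h0 => hx <| by
      rw [hAx, h0, zero_smul, zero_add] at hx0
      have := Fintype.linearIndependent_iff.1 hg _ hx0
      ext j
      refine Fin.cases h0 (fun i => this i) j
    have h2 : D *ᵥ g0 = 0 := (smul_eq_zero.1 h1.symm).resolve_left hne
    simp [hinv, h2]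
  · set x := (Aᴴ * A)⁻¹ *ᵥ Pi.single 0 1 with hx
    have hx0 : (Aᴴ * A)⁻¹ 0 0 = x 0 := by simp [hx]
    have hAA : Aᴴ *ᵥ (A *ᵥ x) = Pi.single 0 1 := by
      rw [hx, Matrix.mulVec_mulVec, Matrix.mulVec_mulVec, Matrix.mul_nonsing_inv _
        (by simpa using hdet), Matrix.one_mulVec]
    have hy0 : star g0 ⬝ᵥ (A *ᵥ x) = 1 := by
      have := congrFun hAA 0
      simpa [A, Matrix.mulVec, dotProduct] using this
    have hyj : ∀ j, star (g j) ⬝ᵥ (A *ᵥ x) = 0 := fun j => by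
      have := congrFun hAA j.succ
      simpa [A, Matrix.mulVec, dotProduct] using this
    have h1 := hDy _ hyj
    rw [hDA, Matrix.mulVec_smul] at h1
    rw [← h1, dotProduct_smul, Matrix.dotProduct_mulVec, ← Matrix.star_mulVec, hnorm,
      smul_eq_mul] at hy0
    rw [hx0, Complex.ofReal_inv]
    exact eq_inv_of_mul_eq_one_left hy0

lemma noAtoms_complexGaussian {v : ℝ≥0} (hv : v ≠ 0) (z : ℂ) : complexGaussian v {z} = 0 :=
  complexGaussian_absolutelyContinuous hv (measure_singleton z)

lemma stdComplexGaussian_singleton {n : ℕ} (hn : 0 < n) (z : Fin n → ℂ) :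
    stdComplexGaussian n {z} = 0 := by
  rw [Measure.pi_singleton]
  exact Finset.prod_eq_zero (Finset.mem_univ ⟨0, hn⟩) (noAtoms_complexGaussian one_ne_zero _)

/-- The law of `m` independent standard complex Gaussian vectors of length `n`. -/
abbrev gaussianColumns (m n : ℕ) : Measure (Fin m → Fin n → ℂ) :=
  Measure.pi fun _ : Fin m => stdComplexGaussian n

lemma gaussianColumns_succ (m n : ℕ) :
    gaussianColumns (m + 1) n = ((stdComplexGaussian n).prod (gaussianColumns m n)).map
      fun p => Fin.cons p.1 p.2 := by
  have h := (measurePreserving_piFinSuccAbove (fun _ : Fin (m + 1) => stdComplexGaussian n) 0).symm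
  rw [gaussianColumns, ← h.map_eq]
  congr 1
  ext p : 1
  simp [MeasurableEquiv.piFinSuccAbove, Fin.consEquiv]

lemma measurable_finCons {m n : ℕ} : Measurable
    fun p : (Fin n → ℂ) × (Fin m → Fin n → ℂ) => (Fin.cons p.1 p.2 : Fin (m + 1) → Fin n → ℂ) :=
  measurable_pi_iff.2 fun i => Fin.cases measurable_fst
    (fun j => (measurable_pi_apply j).comp measurable_snd) i

/-- At most `n` independent Gaussian vectors of length `n` are almost surely linearly
independent. -/
lemma ae_linearIndependent_gaussianColumns {m n : ℕ} (hmn : m ≤ n) :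
    ∀ᵐ g ∂gaussianColumns m n, LinearIndependent ℂ g := by
  induction m with
  | zero => exact .of_forall fun g => linearIndependent_empty_type
  | succ m ih =>
    have hms : MeasurableSet {g : Fin (m + 1) → Fin n → ℂ | LinearIndependent ℂ g} :=
      isOpen_setOfPred_linearIndependent.measurableSet
    have hms' : MeasurableSet {p : (Fin n → ℂ) × (Fin m → Fin n → ℂ) |
        LinearIndependent ℂ (Fin.cons p.1 p.2 : Fin (m + 1) → Fin n → ℂ)} := measurable_finCons hms
    rw [gaussianColumns_succ, ae_map_iff measurable_finCons.aemeasurable hms]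
    rw [← Measure.prod_swap, ae_map_iff measurable_swap.aemeasurable hms',
      Measure.ae_prod_iff_ae_ae
        (p := fun x : (Fin m → Fin n → ℂ) × (Fin n → ℂ) =>
          LinearIndependent ℂ (Fin.cons x.swap.1 x.swap.2 : Fin (m + 1) → Fin n → ℂ))
        (measurable_swap hms')]
    filter_upwards [ih (by omega)] with g hg
    obtain ⟨D, hDD, hDg, -⟩ := exists_orthonormal_coordinates g hg
    have h0 : ∀ᵐ w ∂stdComplexGaussian n, D *ᵥ w ≠ 0 := by
      have hm : Measurable fun w : Fin n → ℂ => D *ᵥ w :=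
        (Matrix.mulVecLin D).continuous_of_finiteDimensional.measurable
      have : ∀ᵐ z ∂(stdComplexGaussian n).map (fun w => D *ᵥ w), z ≠ 0 := by
        rw [stdComplexGaussian_map_mulVec D hDD]
        exact measure_eq_zero_iff_ae_notMem.1 (stdComplexGaussian_singleton (by omega) 0)
      exact ae_of_ae_map hm.aemeasurable this
    filter_upwards [h0] with w hw
    simp only [Prod.fst_swap, Prod.snd_swap]
    refine linearIndependent_finCons.2 ⟨hg, fun hmem => hw ?_⟩
    have : Submodule.span ℂ (Set.range g) ≤ LinearMap.ker (Matrix.mulVecLin D) := by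
      rw [Submodule.span_le]
      rintro _ ⟨j, rfl⟩
      exact hDg j
    exact this hmem

/-- `(AᴴA)⁻¹` depends measurably on `A`, where `A = f x` depends measurably on `x`. -/
lemma measurable_inv_gram {X : Type*} [MeasurableSpace X] {m n : ℕ}
    {f : X → Matrix (Fin n) (Fin m) ℂ} (hf : ∀ i j, Measurable fun x => f x i j) (i j : Fin m) :
    Measurable fun x => ((f x)ᴴ * f x)⁻¹ i j := by
  let G : (Fin n → Fin m → ℂ) → Matrix (Fin m) (Fin m) ℂ :=
    fun A => (Matrix.of A)ᴴ * Matrix.of A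
  have hG : Continuous G := by
    have : Continuous fun A : Fin n → Fin m → ℂ => Matrix.of A := continuous_id
    exact this.matrix_conjTranspose.matrix_mul this
  have h : Measurable fun A : Fin n → Fin m → ℂ => (G A)⁻¹ i j := by
    simp_rw [Matrix.inv_def, Ring.inverse_eq_inv', Matrix.smul_apply, smul_eq_mul]
    exact hG.matrix_det.measurable.inv.mul
      ((hG.matrix_adjugate.matrix_elem i j).measurable)
  exact h.comp (f := fun x i j => f x i j)
    (measurable_pi_iff.2 fun i => measurable_pi_iff.2 fun j => hf i j)

lemma measurable_inv_sum_sq (d : ℕ) :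
    Measurable fun z : Fin d → ℂ => (∑ i, ‖z i‖ ^ 2)⁻¹ := by fun_prop

/-- For `m + 1 ≤ n` independent standard complex Gaussian vectors of length `n`, the first diagonal
entry of the inverse Gram matrix is distributed as the inverse of a sum of `n - m` squared moduli
of independent standard complex Gaussians. -/
lemma gaussianColumns_map_inv_gram {m n : ℕ} (hmn : m + 1 ≤ n) :
    (gaussianColumns (m + 1) n).map
        (fun G => (((Matrix.of G)ᵀᴴ * (Matrix.of G)ᵀ)⁻¹ 0 0).re) =
      (stdComplexGaussian (n - m)).map fun z => (∑ i, ‖z i‖ ^ 2)⁻¹ := by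
  have hmeas : Measurable fun G : Fin (m + 1) → Fin n → ℂ =>
      (((Matrix.of G)ᵀᴴ * (Matrix.of G)ᵀ)⁻¹ 0 0).re :=
    Complex.measurable_re.comp (measurable_inv_gram (fun i j => by
      simp only [Matrix.transpose_apply, Matrix.of_apply]; fun_prop) 0 0)
  ext B hB
  rw [Measure.map_apply hmeas hB, gaussianColumns_succ,
    Measure.map_apply measurable_finCons (hmeas hB),
    Measure.prod_apply_symm (measurable_finCons (hmeas hB))]
  have h : ∀ᵐ g ∂gaussianColumns m n, stdComplexGaussian n ((fun w => (w, g)) ⁻¹'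
      ((fun p => Fin.cons p.1 p.2) ⁻¹' ((fun G : Fin (m + 1) → Fin n → ℂ =>
      (((Matrix.of G)ᵀᴴ * (Matrix.of G)ᵀ)⁻¹ 0 0).re) ⁻¹' B))) =
      (stdComplexGaussian (n - m)).map (fun z => (∑ i, ‖z i‖ ^ 2)⁻¹) B := by
    filter_upwards [ae_linearIndependent_gaussianColumns (by omega : m ≤ n)] with g hg
    obtain ⟨D, hDD, hDg, hDy⟩ := exists_orthonormal_coordinates g hg
    have hm : Measurable fun w : Fin n → ℂ => D *ᵥ w :=
      (Matrix.mulVecLin D).continuous_of_finiteDimensional.measurable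
    rw [← stdComplexGaussian_map_mulVec D hDD, Measure.map_map (measurable_inv_sum_sq _) hm,
      Measure.map_apply ((measurable_inv_sum_sq _).comp hm) hB]
    congr 1
    ext w
    simp only [Set.mem_preimage, Function.comp_apply]
    rw [inv_gram_apply_zero w g hg D hDg hDy, Complex.ofReal_re]
  rw [lintegral_congr_ae h]
  simp

lemma exists_unitary_mulVec_single {m : ℕ} (u : Fin (m + 1) → ℂ) (hu : star u ⬝ᵥ u = 1) :
    ∃ U : Matrix (Fin (m + 1)) (Fin (m + 1)) ℂ, Uᴴ * U = 1 ∧ U *ᵥ Pi.single 0 1 = u := by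
  have hv : Orthonormal ℂ (({0} : Set (Fin (m + 1))).domRestrict
      fun _ => (WithLp.toLp 2 u : EuclideanSpace ℂ (Fin (m + 1)))) := by
    rw [orthonormal_iff_ite]
    intro i j
    rw [if_pos (Subsingleton.elim i j)]
    rw [← hu]
    simp only [Set.domRestrict, PiLp.inner_apply]
    simp [dotProduct, mul_comm, Complex.mul_conj']
  obtain ⟨b, hb⟩ := hv.exists_orthonormalBasis_extension_of_card_eq (by simp)
  refine ⟨Matrix.of fun i j => b j i, ?_, ?_⟩
  · ext i j
    have := (orthonormal_iff_ite.1 b.orthonormal) i j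
    rw [Matrix.one_apply, ← this]
    simp [Matrix.mul_apply, PiLp.inner_apply, mul_comm]
  · ext i
    simp [hb 0 rfl]

/-- The law of the quadratic form of `(GᴴG)⁻¹` at a nonzero vector `a`, for a matrix `G` with
independent standard complex Gaussian entries. -/
lemma map_inv_gram_quadratic {Nr m : ℕ} (hmn : m + 1 ≤ Nr) (a : Fin (m + 1) → ℂ) {c : ℝ} (hc : 0 < c)
    (ha : star a ⬝ᵥ a = (c : ℂ)) :
    (Measure.pi fun _ : Fin Nr => Measure.pi fun _ : Fin (m + 1) => complexGaussian 1).map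
        (fun G => (star a ⬝ᵥ (((Matrix.of G)ᴴ * Matrix.of G)⁻¹ *ᵥ a)).re) =
      (stdComplexGaussian (Nr - m)).map fun z => c * (∑ i, ‖z i‖ ^ 2)⁻¹ := by
  set u : Fin (m + 1) → ℂ := ((√c : ℝ) : ℂ)⁻¹ • a with hu
  have hc' : ((√c : ℝ) : ℂ) ≠ 0 := by simpa using (Real.sqrt_pos.2 hc).ne'
  have hcc : ((√c : ℝ) : ℂ) * ((√c : ℝ) : ℂ) = c := by
    rw [← Complex.ofReal_mul, Real.mul_self_sqrt hc.le]
  have hau : a = ((√c : ℝ) : ℂ) • u := by rw [hu, smul_smul, mul_inv_cancel₀ hc', one_smul]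
  have huu : star u ⬝ᵥ u = 1 := by
    rw [hu, star_smul, smul_dotProduct, dotProduct_smul, ha, ← hcc]
    simp
    field_simp
  obtain ⟨U, hUU, hU0⟩ := exists_unitary_mulVec_single u huu
  have hUU' : U * Uᴴ = 1 := mul_eq_one_comm.1 hUU
  have hUinv : U⁻¹ = Uᴴ := Matrix.inv_eq_left_inv hUU
  have hUinv' : Uᴴ⁻¹ = U := Matrix.inv_eq_left_inv hUU'
  set Γ := Measure.pi fun _ : Fin Nr => Measure.pi fun _ : Fin (m + 1) => complexGaussian 1 with hΓ
  -- Right multiplication by `U` preserves the law of `G` and turns `u` into a basis vector.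
  have hinvar : Γ.map (fun G i => Uᵀ *ᵥ G i) = Γ := by
    have hm : Measurable fun w : Fin (m + 1) → ℂ => Uᵀ *ᵥ w :=
      (Matrix.mulVecLin Uᵀ).continuous_of_finiteDimensional.measurable
    have h1 := stdComplexGaussian_map_mulVec Uᵀ (by
      change Uᵀ * Uᴴᵀ = 1
      rw [← Matrix.transpose_mul, hUU, Matrix.transpose_one])
    have := Measure.pi_map_pi (μ := fun _ : Fin Nr => stdComplexGaussian (m + 1))
      (f := fun _ w => Uᵀ *ᵥ w) (fun _ => hm.aemeasurable)
    rw [hΓ, this]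
    simp_rw [h1]
  have hmU : Measurable fun (G : Fin Nr → Fin (m + 1) → ℂ) i => Uᵀ *ᵥ G i :=
    measurable_pi_iff.2 fun i =>
      (Matrix.mulVecLin Uᵀ).continuous_of_finiteDimensional.measurable.comp (measurable_pi_apply i)
  have hm0 : Measurable fun G : Fin Nr → Fin (m + 1) → ℂ =>
      (((Matrix.of G)ᴴ * Matrix.of G)⁻¹ 0 0).re :=
    Complex.measurable_re.comp (measurable_inv_gram (fun i j => by
      simp only [Matrix.of_apply]; fun_prop) 0 0)
  have hquad : (fun G : Fin Nr → Fin (m + 1) → ℂ =>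
      (star a ⬝ᵥ (((Matrix.of G)ᴴ * Matrix.of G)⁻¹ *ᵥ a)).re) =
      fun G => c * (fun G : Fin Nr → Fin (m + 1) → ℂ =>
        (((Matrix.of G)ᴴ * Matrix.of G)⁻¹ 0 0).re) (fun i => Uᵀ *ᵥ G i) := by
    ext G
    have hof : (Matrix.of fun i => Uᵀ *ᵥ G i) = Matrix.of G * U := by
      ext i j
      simp [Matrix.mulVec, Matrix.mul_apply, dotProduct, mul_comm]
    simp only [hof]
    rw [Matrix.conjTranspose_mul, Matrix.mul_assoc, ← Matrix.mul_assoc _ _ U, Matrix.mul_inv_rev,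
      Matrix.mul_inv_rev, hUinv, hUinv', hau, star_smul, Matrix.mulVec_smul, smul_dotProduct,
      dotProduct_smul, smul_smul, ← hU0]
    have : ∀ P : Matrix (Fin (m + 1)) (Fin (m + 1)) ℂ,
        star (U *ᵥ Pi.single 0 1) ⬝ᵥ (P *ᵥ U *ᵥ Pi.single 0 1) = (Uᴴ * P * U) 0 0 := fun P => by
      rw [Matrix.star_mulVec, ← Matrix.dotProduct_mulVec, Matrix.mulVec_mulVec,
        Matrix.mulVec_mulVec]
      simp
    rw [this, ← starRingEnd_apply, Complex.conj_ofReal, hcc, smul_eq_mul, Complex.re_ofReal_mul]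
  have hswap : Γ = (gaussianColumns (m + 1) Nr).map fun G j i => G i j :=
    (pi_pi_map_swap _).symm
  have hmswap : Measurable fun (G : Fin (m + 1) → Fin Nr → ℂ) j i => G i j := by fun_prop
  have hfirst : Γ.map (fun G => (((Matrix.of G)ᴴ * Matrix.of G)⁻¹ 0 0).re) =
      (stdComplexGaussian (Nr - m)).map fun z => (∑ i, ‖z i‖ ^ 2)⁻¹ := by
    rw [← gaussianColumns_map_inv_gram hmn, hswap, Measure.map_map hm0 hmswap]
    rfl
  have hmc : Measurable fun x : ℝ => c * x := measurable_const_mul c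
  rw [hquad, show (fun G : Fin Nr → Fin (m + 1) → ℂ => c * (fun G : Fin Nr → Fin (m + 1) → ℂ =>
        (((Matrix.of G)ᴴ * Matrix.of G)⁻¹ 0 0).re) (fun i => Uᵀ *ᵥ G i)) =
      (fun x => c * x) ∘ (fun G : Fin Nr → Fin (m + 1) → ℂ =>
        (((Matrix.of G)ᴴ * Matrix.of G)⁻¹ 0 0).re) ∘ (fun G i => Uᵀ *ᵥ G i) from rfl,
    ← Measure.map_map hmc (hm0.comp hmU), ← Measure.map_map hm0 hmU, hinvar, hfirst,
    Measure.map_map hmc (measurable_inv_sum_sq _)]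
  rfl

/-! ### The limit of the normalized trace of the inverse square root of a Toeplitz matrix -/

/-- Cesàro summation of a convergent series over `ℤ`, arranged along the diagonals of an `N × N`
array. -/
lemma tendsto_toeplitz_sum {c : ℤ → ℝ} {S : ℝ} (hc : HasSum c S) :
    Tendsto (fun N : ℕ => (N : ℝ)⁻¹ * ∑ i : Fin N, ∑ j : Fin N, c ((i : ℤ) - (j : ℤ))) atTop
      (𝓝 S) := by
  let D : ℕ → ℝ := fun N => (∑ l ∈ Finset.range (N + 1), (c l + c (-l))) - c 0
  have hD : Tendsto D atTop (𝓝 S) := by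
    have h := (hc.nat_add_neg.tendsto_sum_nat.comp (tendsto_add_atTop_nat 1)).sub_const (c 0)
    simpa [D] using h
  -- Adding the `N`-th row and column to the `N × N` array adds `D N` to the sum of its entries.
  refine hD.cesaro.congr fun N => ?_
  congr 1
  simp_rw [fun i : ℤ => Fin.sum_univ_eq_sum_range (fun j : ℕ => c (i - (j : ℤ))) N]
  rw [Fin.sum_univ_eq_sum_range (fun i => ∑ j ∈ Finset.range N, c ((i : ℤ) - (j : ℤ))) N]
  induction N with
  | zero => simp
  | succ N ih =>
    rw [Finset.sum_range_succ, ih, Finset.sum_range_succ (n := N)]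
    simp_rw [Finset.sum_range_succ (n := N)]
    rw [Finset.sum_add_distrib, add_assoc]
    congr 1
    have h1 : ∑ i ∈ Finset.range N, c ((i : ℤ) - N) = ∑ l ∈ Finset.range N, c (-((l + 1 : ℕ) : ℤ)) := by
      rw [← Finset.sum_range_reflect]
      refine Finset.sum_congr rfl fun i hi => ?_
      have := Finset.mem_range.1 hi
      congr 1
      omega
    have h2 : ∑ i ∈ Finset.range N, c ((N : ℤ) - i) = ∑ l ∈ Finset.range N, c ((l + 1 : ℕ) : ℤ) := by
      rw [← Finset.sum_range_reflect]
      refine Finset.sum_congr rfl fun i hi => ?_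
      have := Finset.mem_range.1 hi
      congr 1
      omega
    rw [h1, h2]
    simp only [D]
    rw [Finset.sum_range_succ', Finset.sum_add_distrib]
    simp
    ring

/-- The unit circle `ℝ / 2πℤ`, the domain of the symbol. -/
abbrev Circ : Type := AddCircle (2 * Real.pi)

/-- The normalized Haar measure of the circle. -/
abbrev haarCirc : Measure Circ := AddCircle.haarAddCircle

lemma hasSum_symbolL2 {σ : ℤ → ℂ} (h_sq : Summable fun k : ℤ => ‖σ k‖ ^ 2) :
    HasSum (fun k : ℤ => σ k • fourierLp (T := 2 * Real.pi) 2 (-k))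
    (symbolL2 σ) := by
  have ho : Orthonormal ℂ fun k : ℤ => fourierLp (T := 2 * Real.pi) 2 (-k) :=
    orthonormal_fourier.comp _ neg_injective
  have := (ho.orthogonalFamily.summable_iff_norm_sq_summable σ).2 h_sq
  simpa [symbolL2] using this.hasSum

lemma integral_symbolL2_mul_fourier {σ : ℤ → ℂ} (h_sq : Summable fun k : ℤ => ‖σ k‖ ^ 2)
    (k : ℤ) :
    ∫ x, symbolL2 σ x * fourier k x ∂haarCirc = σ k := by
  have ho : Orthonormal ℂ fun k : ℤ => fourierLp (T := 2 * Real.pi) 2 (-k) :=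
    orthonormal_fourier.comp _ neg_injective
  have h1 := (hasSum_symbolL2 h_sq).mapL (innerSL ℂ (fourierLp (T := 2 * Real.pi) 2 (-k)))
  have h2 : ∀ l, (innerSL ℂ (fourierLp (T := 2 * Real.pi) 2 (-k))) (σ l • fourierLp 2 (-l)) =
      if l = k then σ k else 0 := fun l => by
    rw [innerSL_apply_apply, inner_smul_right, (orthonormal_iff_ite.1 ho) k l]
    by_cases h : l = k
    · simp [h]
    · simp [h, Ne.symm h]
  simp_rw [h2] at h1
  rw [← h1.unique (hasSum_ite_eq k (σ k)), innerSL_apply_apply, L2.inner_def]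
  refine integral_congr_ae ?_
  filter_upwards [coeFn_fourierLp (T := 2 * Real.pi) 2 (-k)] with x hx
  rw [hx]
  simp

/-- Parseval's identity, for the symbol against a square-integrable real function. -/
lemma hasSum_integral_mul_symbolL2 {σ : ℤ → ℂ} (h_sq : Summable fun k : ℤ => ‖σ k‖ ^ 2)
    {g : Circ → ℝ} (hg : MemLp (fun x => (g x : ℂ)) 2 haarCirc) :
    HasSum (fun k : ℤ => σ k * ∫ x, (g x : ℂ) * fourier (-k) x ∂haarCirc)
      (∫ x, (g x : ℂ) * symbolL2 σ x ∂haarCirc) := by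
  have h1 := (hasSum_symbolL2 h_sq).mapL (innerSL ℂ (hg.toLp _))
  have h2 : ∀ u : Lp ℂ 2 haarCirc, innerSL ℂ (hg.toLp _) u =
      ∫ x, (g x : ℂ) * u x ∂haarCirc := fun u => by
    rw [innerSL_apply_apply, L2.inner_def]
    refine integral_congr_ae ?_
    filter_upwards [hg.coeFn_toLp] with x hx
    rw [hx]
    simp [mul_comm]
  simp_rw [map_smul, h2, smul_eq_mul] at h1
  convert! h1 using 2 with k
  congr 1
  refine integral_congr_ae ?_
  filter_upwards [coeFn_fourierLp (T := 2 * Real.pi) 2 (-k)] with x hx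
  rw [hx]

/-- The symbol as a real function on the circle. -/
def circSymbol (σ : ℤ → ℂ) (x : Circ) : ℝ := (symbolL2 σ x).re

lemma measurable_circSymbol (σ : ℤ → ℂ) : Measurable (circSymbol σ) :=
  Complex.measurable_re.comp (Lp.stronglyMeasurable _).measurable

lemma integrable_symbolL2 (σ : ℤ → ℂ) : Integrable (symbolL2 σ) haarCirc :=
  (Lp.memLp (symbolL2 σ)).integrable (by norm_num)

lemma integrable_circSymbol (σ : ℤ → ℂ) : Integrable (circSymbol σ) haarCirc :=
  (integrable_symbolL2 σ).re

/-- A positive essential infimum yields a positive lower bound almost everywhere. The real-valued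
`essInf` is the supremum of the set of almost sure lower bounds, with the value `0` if this set is
empty or unbounded, so positivity makes the set nonempty. -/
lemma exists_pos_le_circSymbol {σ : ℤ → ℂ} (h_inf : 0 < symbolEssInf σ) :
    ∃ m > 0, ∀ᵐ x ∂haarCirc, m ≤ circSymbol σ x := by
  unfold symbolEssInf essInf at h_inf
  rw [Filter.liminf_eq] at h_inf
  have hne : {a | ∀ᶠ ω in ae (volume.restrict (Set.Ioc 0 (2 * Real.pi))), a ≤ symbol σ ω}.Nonempty := by
    by_contra h
    rw [Set.not_nonempty_iff_eq_empty.1 h, Real.sSup_empty] at h_inf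
    exact h_inf.false
  obtain ⟨m, hm, hm0⟩ := exists_lt_of_lt_csSup hne h_inf
  refine ⟨m, hm0, ?_⟩
  have hp := AddCircle.measurePreserving_mk (2 * Real.pi) 0
  rw [zero_add] at hp
  have h1 : ∀ᵐ x ∂(volume : Measure Circ), m ≤ circSymbol σ x := by
    rw [← hp.map_eq, ae_map_iff hp.measurable.aemeasurable
      (measurableSet_le measurable_const (measurable_circSymbol σ))]
    exact hm
  rw [AddCircle.volume_eq_smul_haarAddCircle] at h1
  exact (Measure.ae_ennreal_smul_measure_iff (by simp [Real.pi_pos])).1 h1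

lemma Lam_eq_integral (σ : ℤ → ℂ) : Lam σ = ∫ x, (√(circSymbol σ x))⁻¹ ∂haarCirc := by
  rw [AddCircle.integral_haarAddCircle,
    ← AddCircle.intervalIntegral_preimage (2 * Real.pi) 0, zero_add, Lam]
  simp [symbol, circSymbol]

/-- The tangent line of the convex function `x ↦ x^{-1/2}` lies below its graph. -/
lemma inv_sqrt_tangent {x y : ℝ} (hx : 0 < x) (hy : 0 < y) :
    (√x)⁻¹ - 1 / 2 * (√x)⁻¹ ^ 3 * (y - x) ≤ (√y)⁻¹ := by
  obtain ⟨a, ha, rfl⟩ : ∃ a > 0, x = a ^ 2 := ⟨√x, Real.sqrt_pos.2 hx, (Real.sq_sqrt hx.le).symm⟩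
  obtain ⟨b, hb, rfl⟩ : ∃ b > 0, y = b ^ 2 := ⟨√y, Real.sqrt_pos.2 hy, (Real.sq_sqrt hy.le).symm⟩
  rw [Real.sqrt_sq ha.le, Real.sqrt_sq hb.le, ← sub_nonneg]
  have : b⁻¹ - (a⁻¹ - 1 / 2 * a⁻¹ ^ 3 * (b ^ 2 - a ^ 2)) =
      (a - b) ^ 2 * (2 * a + b) / (2 * a ^ 3 * b) := by
    field_simp
    ring
  rw [this]
  positivity

/-- The trigonometric polynomial whose coefficients are the `k`-th column of `W`. -/
def columnPoly {N : ℕ} (W : Matrix (Fin N) (Fin N) ℂ) (k : Fin N) (x : Circ) : ℂ :=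
  ∑ n : Fin N, W n k * fourier (-(n : ℤ)) x

lemma continuous_columnPoly {N : ℕ} (W : Matrix (Fin N) (Fin N) ℂ) (k : Fin N) :
    Continuous (columnPoly W k) :=
  continuous_finsetSum _ fun _ _ => continuous_const.mul (map_continuous _)

lemma ofReal_norm_columnPoly_sq {N : ℕ} (W : Matrix (Fin N) (Fin N) ℂ) (k : Fin N) (x : Circ) :
    ((‖columnPoly W k x‖ ^ 2 : ℝ) : ℂ) =
      ∑ i : Fin N, ∑ j : Fin N, W i k * conj (W j k) * fourier ((j : ℤ) - i) x := by
  rw [Complex.ofReal_pow, ← Complex.mul_conj', columnPoly, map_sum, Finset.sum_mul_sum]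
  refine Finset.sum_congr rfl fun i _ => Finset.sum_congr rfl fun j _ => ?_
  rw [map_mul, ← fourier_neg, neg_neg, sub_eq_add_neg, fourier_add]
  ring

lemma integrable_mul_fourier {u : Circ → ℂ} (hu : Integrable u haarCirc) (k : ℤ) :
    Integrable (fun x => u x * fourier k x) haarCirc :=
  hu.mul_bdd (c := 1) (map_continuous (fourier k)).aestronglyMeasurable
    (.of_forall fun x => by rw [fourier_apply]; exact (Circle.norm_coe _).le)

lemma integral_mul_norm_columnPoly_sq {N : ℕ} (W : Matrix (Fin N) (Fin N) ℂ) (k : Fin N)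
    {u : Circ → ℂ} (hu : Integrable u haarCirc) :
    ∫ x, u x * ((‖columnPoly W k x‖ ^ 2 : ℝ) : ℂ) ∂haarCirc =
      ∑ i : Fin N, ∑ j : Fin N, W i k * conj (W j k) *
        ∫ x, u x * fourier ((j : ℤ) - i) x ∂haarCirc := by
  simp_rw [ofReal_norm_columnPoly_sq, Finset.mul_sum]
  have e : ∀ (i j : Fin N) (x : Circ), u x * (W i k * conj (W j k) * fourier ((j : ℤ) - i) x) =
      W i k * conj (W j k) * (u x * fourier ((j : ℤ) - i) x) := fun i j x => by ring
  simp_rw [e]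
  rw [integral_finsetSum _ fun i _ => integrable_finsetSum _ fun j _ =>
    (integrable_mul_fourier hu _).const_mul _]
  refine Finset.sum_congr rfl fun i _ => ?_
  rw [integral_finsetSum _ fun j _ => (integrable_mul_fourier hu _).const_mul _]
  exact Finset.sum_congr rfl fun j _ => integral_const_mul _ _

lemma integral_fourier_haarCirc (k : ℤ) :
    ∫ x, (fourier k x : ℂ) ∂haarCirc = if k = 0 then 1 else 0 := by
  have h := (orthonormal_iff_ite.1 (orthonormal_fourier (T := 2 * Real.pi))) 0 k
  rw [ContinuousMap.inner_toLp] at h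
  simpa [eq_comm] using h

lemma integral_norm_columnPoly_sq {N : ℕ} {W : Matrix (Fin N) (Fin N) ℂ} (hW : Wᴴ * W = 1)
    (k : Fin N) : ∫ x, ‖columnPoly W k x‖ ^ 2 ∂haarCirc = 1 := by
  have h := integral_mul_norm_columnPoly_sq W k (u := fun _ => 1) (integrable_const _)
  simp_rw [one_mul, integral_fourier_haarCirc, integral_complex_ofReal] at h
  rw [← Complex.ofReal_inj, h, Complex.ofReal_one]
  have h2 := congrFun (congrFun hW k) k
  rw [Matrix.mul_apply, Matrix.one_apply_eq] at h2
  refine Eq.trans (Finset.sum_congr rfl fun i _ => ?_) h2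
  rw [Finset.sum_eq_single i]
  · simp [mul_comm]
  · intro j _ hj
    rw [if_neg, mul_zero]
    intro h0
    exact hj (Fin.ext (by omega))
  · simp

lemma sum_mul_norm_columnPoly_sq {N : ℕ} (W : Matrix (Fin N) (Fin N) ℂ) (ev : Fin N → ℝ)
    (x : Circ) : ((∑ k, ev k * ‖columnPoly W k x‖ ^ 2 : ℝ) : ℂ) =
      ∑ i : Fin N, ∑ j : Fin N,
        (W * Matrix.diagonal (fun k => ((ev k : ℝ) : ℂ)) * Wᴴ) i j * fourier ((j : ℤ) - i) x := by
  rw [Complex.ofReal_sum]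
  simp_rw [Complex.ofReal_mul, ofReal_norm_columnPoly_sq, Finset.mul_sum]
  rw [Finset.sum_comm]
  refine Finset.sum_congr rfl fun i _ => ?_
  rw [Finset.sum_comm]
  refine Finset.sum_congr rfl fun j _ => ?_
  rw [Matrix.mul_apply, Finset.sum_mul]
  refine Finset.sum_congr rfl fun k _ => ?_
  rw [Matrix.mul_diagonal]
  simp
  ring

lemma sum_norm_columnPoly_sq {N : ℕ} {W : Matrix (Fin N) (Fin N) ℂ} (hW : W * Wᴴ = 1)
    (x : Circ) : ∑ k, ‖columnPoly W k x‖ ^ 2 = N := by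
  have h := sum_mul_norm_columnPoly_sq W (fun _ => 1) x
  simp only [Complex.ofReal_one, Matrix.diagonal_one, Matrix.mul_one, hW, one_mul,
    Matrix.one_apply, ite_mul, zero_mul, Finset.sum_ite_eq, Finset.mem_univ, if_true, sub_self,
    fourier_zero] at h
  rw [← Complex.ofReal_inj, h]
  simp

/-- The eigenvalues of the Toeplitz matrix are averages of the symbol. -/
lemma integral_circSymbol_mul_norm_columnPoly_sq {σ : ℤ → ℂ}
    (h_sq : Summable fun k : ℤ => ‖σ k‖ ^ 2) {N : ℕ} {W : Matrix (Fin N) (Fin N) ℂ}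
    {ev : Fin N → ℝ} (hW : Wᴴ * W = 1)
    (hS : toeplitz σ N = W * Matrix.diagonal (fun k => ((ev k : ℝ) : ℂ)) * Wᴴ) (k : Fin N) :
    ∫ x, circSymbol σ x * ‖columnPoly W k x‖ ^ 2 ∂haarCirc = ev k := by
  have h := integral_mul_norm_columnPoly_sq W k (integrable_symbolL2 σ)
  simp_rw [integral_symbolL2_mul_fourier h_sq] at h
  have h2 : Wᴴ * toeplitz σ N * W = Matrix.diagonal (fun k => ((ev k : ℝ) : ℂ)) := by
    rw [hS, Matrix.mul_assoc, Matrix.mul_assoc, hW, Matrix.mul_one, ← Matrix.mul_assoc, hW,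
      Matrix.one_mul]
  have h3 := congrFun (congrFun h2 k) k
  rw [Matrix.diagonal_apply_eq, Matrix.mul_apply] at h3
  have h4 : ∫ x, symbolL2 σ x * ((‖columnPoly W k x‖ ^ 2 : ℝ) : ℂ) ∂haarCirc = ev k := by
    rw [h, ← h3]
    refine Finset.sum_congr rfl fun i _ => ?_
    rw [Matrix.mul_apply, Finset.sum_mul]
    refine Finset.sum_congr rfl fun j _ => ?_
    simp [toeplitz]
    ring
  have hint : Integrable (fun x => symbolL2 σ x * ((‖columnPoly W k x‖ ^ 2 : ℝ) : ℂ)) haarCirc := by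
    simp_rw [ofReal_norm_columnPoly_sq, Finset.mul_sum]
    refine integrable_finsetSum _ fun i _ => integrable_finsetSum _ fun j _ => ?_
    have := (integrable_mul_fourier (integrable_symbolL2 σ) ((j : ℤ) - i)).const_mul
      (W i k * conj (W j k))
    refine this.congr (.of_forall fun x => ?_)
    simp only
    ring
  have h5 := congrArg Complex.re h4
  rw [Complex.ofReal_re, ← RCLike.re_eq_complex_re, ← integral_re hint] at h5
  rw [← h5]
  refine integral_congr_ae (.of_forall fun x => ?_)
  simp only [RCLike.re_eq_complex_re, Complex.re_mul_ofReal]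
  rfl

lemma integrable_mul_norm_columnPoly_sq {N : ℕ} (W : Matrix (Fin N) (Fin N) ℂ) (k : Fin N)
    {u : Circ → ℝ} (hu : Integrable u haarCirc) :
    Integrable (fun x => u x * ‖columnPoly W k x‖ ^ 2) haarCirc := by
  obtain ⟨C, hC⟩ := isCompact_univ.exists_bound_of_continuousOn
    ((continuous_columnPoly W k).norm.pow 2).continuousOn
  exact hu.mul_bdd (c := C) ((continuous_columnPoly W k).norm.pow 2).aestronglyMeasurable
    (.of_forall fun x => hC x trivial)

section Trace

variable {σ : ℤ → ℂ} {m : ℝ}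

lemma le_eigenvalue_of_le_circSymbol (h_sq : Summable fun k : ℤ => ‖σ k‖ ^ 2)
    (hm : ∀ᵐ x ∂haarCirc, m ≤ circSymbol σ x) {N : ℕ} {W : Matrix (Fin N) (Fin N) ℂ}
    {ev : Fin N → ℝ} (hW : Wᴴ * W = 1)
    (hS : toeplitz σ N = W * Matrix.diagonal (fun k => ((ev k : ℝ) : ℂ)) * Wᴴ) (k : Fin N) :
    m ≤ ev k := by
  rw [← integral_circSymbol_mul_norm_columnPoly_sq h_sq hW hS k, ← mul_one m,
    ← integral_norm_columnPoly_sq hW k, ← integral_const_mul]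
  refine integral_mono_ae (integrable_mul_norm_columnPoly_sq W k (integrable_const m))
    (integrable_mul_norm_columnPoly_sq W k (integrable_circSymbol σ)) ?_
  filter_upwards [hm] with x hx
  exact mul_le_mul_of_nonneg_right hx (by positivity)

lemma memLp_top_inv_sqrt_circSymbol_pow (hm0 : 0 < m)
    (hm : ∀ᵐ x ∂haarCirc, m ≤ circSymbol σ x) (r : ℕ) :
    MemLp (fun x => (√(circSymbol σ x))⁻¹ ^ r) ⊤ haarCirc := by
  refine memLp_top_of_bound
    ((measurable_circSymbol σ).sqrt.inv.pow_const r).aestronglyMeasurable ((√m)⁻¹ ^ r) ?_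
  filter_upwards [hm] with x hx
  rw [Real.norm_of_nonneg (by positivity)]
  have := Real.sqrt_pos.2 hm0
  gcongr

/-- Upper bound for the normalized trace: Jensen's inequality for the averages of the symbol
against the squared moduli of the eigenpolynomials, which add up to `N`. -/
lemma trace_inv_sqrt_le (h_sq : Summable fun k : ℤ => ‖σ k‖ ^ 2) (hm0 : 0 < m)
    (hm : ∀ᵐ x ∂haarCirc, m ≤ circSymbol σ x) {N : ℕ} {W : Matrix (Fin N) (Fin N) ℂ}
    {ev : Fin N → ℝ} (hW : Wᴴ * W = 1)
    (hS : toeplitz σ N = W * Matrix.diagonal (fun k => ((ev k : ℝ) : ℂ)) * Wᴴ) :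
    ∑ k, (√(ev k))⁻¹ ≤ N * Lam σ := by
  have hint : Integrable (fun x => (√(circSymbol σ x))⁻¹) haarCirc := by
    simpa using (memLp_top_inv_sqrt_circSymbol_pow hm0 hm 1).integrable le_top
  have h1 : ∀ k, (√(ev k))⁻¹ ≤
      ∫ x, (√(circSymbol σ x))⁻¹ * ‖columnPoly W k x‖ ^ 2 ∂haarCirc := fun k => by
    have hk := hm0.trans_le (le_eigenvalue_of_le_circSymbol h_sq hm hW hS k)
    set a := (√(ev k))⁻¹
    -- The linear term of the tangent at `ev k` integrates to `0`: `ev k` is the mean of the symbol.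
    have e : ∫ x, ((a - 1 / 2 * a ^ 3 * (circSymbol σ x - ev k)) * ‖columnPoly W k x‖ ^ 2)
        ∂haarCirc = a := by
      have e1 : ∀ x, (a - 1 / 2 * a ^ 3 * (circSymbol σ x - ev k)) * ‖columnPoly W k x‖ ^ 2 =
          (a + 1 / 2 * a ^ 3 * ev k) * ‖columnPoly W k x‖ ^ 2 -
          1 / 2 * a ^ 3 * (circSymbol σ x * ‖columnPoly W k x‖ ^ 2) := fun x => by ring
      simp_rw [e1]
      rw [integral_sub (integrable_mul_norm_columnPoly_sq W k (integrable_const _))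
        ((integrable_mul_norm_columnPoly_sq W k (integrable_circSymbol σ)).const_mul _),
        integral_const_mul, integral_const_mul, integral_norm_columnPoly_sq hW,
        integral_circSymbol_mul_norm_columnPoly_sq h_sq hW hS]
      ring
    rw [← e]
    refine integral_mono_ae (integrable_mul_norm_columnPoly_sq W k
      ((integrable_const _).sub (((integrable_circSymbol σ).sub (integrable_const _)).const_mul _)))
      (integrable_mul_norm_columnPoly_sq W k hint) ?_
    filter_upwards [hm] with x hx
    exact mul_le_mul_of_nonneg_right (inv_sqrt_tangent hk (hm0.trans_le hx)) (by positivity)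
  refine (Finset.sum_le_sum fun k _ => h1 k).trans ?_
  rw [← integral_finsetSum _ fun k _ => integrable_mul_norm_columnPoly_sq W k hint]
  simp_rw [← Finset.mul_sum, sum_norm_columnPoly_sq (mul_eq_one_comm.1 hW)]
  rw [integral_mul_const, ← Lam_eq_integral, mul_comm]

/-- Lower bound for the normalized trace: the tangent line at the value of the symbol, integrated
against the squared moduli of the eigenpolynomials. The error term is a Toeplitz sum. -/
lemma le_trace_inv_sqrt (h_sq : Summable fun k : ℤ => ‖σ k‖ ^ 2) (hm0 : 0 < m)
    (hm : ∀ᵐ x ∂haarCirc, m ≤ circSymbol σ x) {N : ℕ} {W : Matrix (Fin N) (Fin N) ℂ}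
    {ev : Fin N → ℝ} (hW : Wᴴ * W = 1)
    (hS : toeplitz σ N = W * Matrix.diagonal (fun k => ((ev k : ℝ) : ℂ)) * Wᴴ) :
    N * (Lam σ + 1 / 2 * ∫ x, (√(circSymbol σ x))⁻¹ ^ 3 * circSymbol σ x ∂haarCirc) -
      1 / 2 * ∑ i : Fin N, ∑ j : Fin N, (σ ((i : ℤ) - j) *
        ∫ x, (((√(circSymbol σ x))⁻¹ ^ 3 : ℝ) : ℂ) * fourier (-((i : ℤ) - j)) x ∂haarCirc).re ≤
      ∑ k, (√(ev k))⁻¹ := by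
  set g : Circ → ℝ := fun x => (√(circSymbol σ x))⁻¹ ^ 3 with hg
  have hgm := memLp_top_inv_sqrt_circSymbol_pow hm0 hm 3
  have hgi : Integrable g haarCirc := hgm.integrable le_top
  have hgC : Integrable (fun x => (g x : ℂ)) haarCirc := hgi.ofReal
  have hgf : Integrable (fun x => g x * circSymbol σ x) haarCirc :=
    (integrable_circSymbol σ).bdd_mul (c := (√m)⁻¹ ^ 3) hgi.aestronglyMeasurable (by
      filter_upwards [hm] with x hx
      simp only [hg]
      rw [Real.norm_of_nonneg (by positivity)]
      have := Real.sqrt_pos.2 hm0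
      gcongr)
  have hint : Integrable (fun x => (√(circSymbol σ x))⁻¹) haarCirc := by
    simpa using (memLp_top_inv_sqrt_circSymbol_pow hm0 hm 1).integrable le_top
  -- `∑ k, ev k * ‖columnPoly W k x‖ ^ 2` is a trigonometric polynomial whose coefficients are the
  -- entries of the Toeplitz matrix.
  have h0 : ∫ x, g x * ∑ k, ev k * ‖columnPoly W k x‖ ^ 2 ∂haarCirc =
      ∑ i : Fin N, ∑ j : Fin N, (σ ((i : ℤ) - j) *
        ∫ x, (g x : ℂ) * fourier (-((i : ℤ) - j)) x ∂haarCirc).re := by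
    rw [← Complex.ofReal_re (∫ x, g x * ∑ k, ev k * ‖columnPoly W k x‖ ^ 2 ∂haarCirc),
      ← integral_complex_ofReal]
    simp_rw [Complex.ofReal_mul, sum_mul_norm_columnPoly_sq, ← hS, Finset.mul_sum, ← Complex.re_sum]
    have e : ∀ (i j : Fin N) (x : Circ), (g x : ℂ) * (toeplitz σ N i j * fourier ((j : ℤ) - i) x) =
        σ ((i : ℤ) - j) * ((g x : ℂ) * fourier (-((i : ℤ) - j)) x) := fun i j x => by
      rw [neg_sub]
      simp [toeplitz]
      ring
    simp_rw [e]
    rw [integral_finsetSum _ fun i _ => integrable_finsetSum _ fun j _ =>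
      (integrable_mul_fourier hgC _).const_mul _]
    congr 1
    refine Finset.sum_congr rfl fun i _ => ?_
    rw [integral_finsetSum _ fun j _ => (integrable_mul_fourier hgC _).const_mul _]
    exact Finset.sum_congr rfl fun j _ => integral_const_mul _ _
  have hgev : Integrable (fun x => g x * ∑ k, ev k * ‖columnPoly W k x‖ ^ 2) haarCirc := by
    simp_rw [Finset.mul_sum]
    refine integrable_finsetSum _ fun k _ => ?_
    refine ((integrable_mul_norm_columnPoly_sq W k hgi).const_mul (ev k)).congr
      (.of_forall fun x => ?_)
    simp only
    ring
  have h1 : ∫ x, ∑ k, (√(ev k))⁻¹ * ‖columnPoly W k x‖ ^ 2 ∂haarCirc = ∑ k, (√(ev k))⁻¹ := by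
    rw [integral_finsetSum _ fun k _ => integrable_mul_norm_columnPoly_sq W k (integrable_const _)]
    simp_rw [integral_const_mul, integral_norm_columnPoly_sq hW, mul_one]
  have hadd : Integrable (fun x => (√(circSymbol σ x))⁻¹ + 1 / 2 * (g x * circSymbol σ x))
      haarCirc := hint.add (hgf.const_mul _)
  rw [← h0, ← h1, Lam_eq_integral, ← integral_const_mul (1 / 2),
    ← integral_add hint (hgf.const_mul _), ← integral_const_mul (N : ℝ), ← integral_const_mul,
    ← integral_sub (hadd.const_mul _) (hgev.const_mul _)]
  refine integral_mono_ae ((hadd.const_mul _).sub (hgev.const_mul _))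
    (integrable_finsetSum _ fun k _ =>
      integrable_mul_norm_columnPoly_sq W k (integrable_const _)) ?_
  filter_upwards [hm] with x hx
  have hx0 := hm0.trans_le hx
  have h2 : ∑ k, ((√(circSymbol σ x))⁻¹ - 1 / 2 * g x * (ev k - circSymbol σ x)) *
      ‖columnPoly W k x‖ ^ 2 ≤ ∑ k, (√(ev k))⁻¹ * ‖columnPoly W k x‖ ^ 2 :=
    Finset.sum_le_sum fun k _ => mul_le_mul_of_nonneg_right (inv_sqrt_tangent hx0
      (hm0.trans_le (le_eigenvalue_of_le_circSymbol h_sq hm hW hS k))) (by positivity)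
  refine le_trans (le_of_eq ?_) h2
  have h3 : ∀ k, ((√(circSymbol σ x))⁻¹ - 1 / 2 * g x * (ev k - circSymbol σ x)) *
      ‖columnPoly W k x‖ ^ 2 = ((√(circSymbol σ x))⁻¹ + 1 / 2 * (g x * circSymbol σ x)) *
      ‖columnPoly W k x‖ ^ 2 - 1 / 2 * g x * (ev k * ‖columnPoly W k x‖ ^ 2) := fun k => by ring
  simp_rw [h3]
  rw [Finset.sum_sub_distrib, ← Finset.mul_sum, ← Finset.mul_sum,
    sum_norm_columnPoly_sq (mul_eq_one_comm.1 hW)]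
  ring

/-- Szegő's limit theorem for `x ↦ x^{-1/2}`. -/
theorem tendsto_trace_inv_sqrt_toeplitz (h_sq : Summable fun k : ℤ => ‖σ k‖ ^ 2)
    (h_inf : 0 < symbolEssInf σ) {Nt : ℕ → ℕ} (hNt : Tendsto Nt atTop atTop)
    {W : ∀ n, Matrix (Fin (Nt n)) (Fin (Nt n)) ℂ} {ev : ∀ n, Fin (Nt n) → ℝ}
    (hW : ∀ n, (W n)ᴴ * W n = 1)
    (hS : ∀ n, toeplitz σ (Nt n) =
      W n * Matrix.diagonal (fun k => ((ev n k : ℝ) : ℂ)) * (W n)ᴴ) :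
    Tendsto (fun n => (Nt n : ℝ)⁻¹ * ∑ k, (√(ev n k))⁻¹) atTop (𝓝 (Lam σ)) := by
  obtain ⟨m, hm0, hm⟩ := exists_pos_le_circSymbol h_inf
  set J := ∫ x, (√(circSymbol σ x))⁻¹ ^ 3 * circSymbol σ x ∂haarCirc with hJ
  have hgm := memLp_top_inv_sqrt_circSymbol_pow hm0 hm 3
  have hg2 : MemLp (fun x => (((√(circSymbol σ x))⁻¹ ^ 3 : ℝ) : ℂ)) 2 haarCirc :=
    (hgm.mono_exponent le_top).ofReal
  have hc := Complex.hasSum_re (hasSum_integral_mul_symbolL2 h_sq hg2)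
  have hJ' : (∫ x, (((√(circSymbol σ x))⁻¹ ^ 3 : ℝ) : ℂ) * symbolL2 σ x ∂haarCirc).re = J := by
    have hi : Integrable (fun x => (((√(circSymbol σ x))⁻¹ ^ 3 : ℝ) : ℂ) * symbolL2 σ x)
        haarCirc := hg2.integrable_mul (Lp.memLp _)
    rw [← RCLike.re_eq_complex_re, ← integral_re hi, hJ]
    refine integral_congr_ae (.of_forall fun x => ?_)
    simp only [RCLike.re_eq_complex_re, Complex.re_ofReal_mul]
    rfl
  rw [hJ'] at hc
  have hT := (tendsto_toeplitz_sum hc).comp hNt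
  have hlow := ((hT.const_mul (1 / 2)).const_sub (Lam σ + 1 / 2 * J))
  rw [add_sub_cancel_right] at hlow
  refine tendsto_of_tendsto_of_tendsto_of_le_of_le' hlow tendsto_const_nhds ?_ ?_
  · filter_upwards [hNt.eventually_gt_atTop 0] with n hn
    have hn' : (0 : ℝ) < Nt n := by exact_mod_cast hn
    have := mul_le_mul_of_nonneg_left (le_trace_inv_sqrt h_sq hm0 hm (hW n) (hS n))
      (inv_nonneg.2 hn'.le)
    refine le_trans (le_of_eq ?_) this
    rw [mul_sub, inv_mul_cancel_left₀ hn'.ne']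
    simp only [Function.comp_apply]
    ring
  · filter_upwards [hNt.eventually_gt_atTop 0] with n hn
    have hn' : (0 : ℝ) < Nt n := by exact_mod_cast hn
    rw [inv_mul_le_iff₀ hn']
    exact trace_inv_sqrt_le h_sq hm0 hm (hW n) (hS n)

lemma Lam_pos (h_inf : 0 < symbolEssInf σ) : 0 < Lam σ := by
  obtain ⟨m, hm0, hm⟩ := exists_pos_le_circSymbol h_inf
  rw [Lam_eq_integral]
  have hint : Integrable (fun x => (√(circSymbol σ x))⁻¹) haarCirc := by
    simpa using (memLp_top_inv_sqrt_circSymbol_pow hm0 hm 1).integrable le_top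
  have hpos : ∀ᵐ x ∂haarCirc, 0 < (√(circSymbol σ x))⁻¹ := by
    filter_upwards [hm] with x hx
    exact inv_pos.2 (Real.sqrt_pos.2 (hm0.trans_le hx))
  refine lt_of_le_of_ne (integral_nonneg fun x => by positivity) fun h0 => ?_
  have h1 := (integral_eq_zero_iff_of_nonneg (fun x => by positivity) hint).1 h0.symm
  have : ∀ᵐ x ∂haarCirc, False := by
    filter_upwards [h1, hpos] with x h1 h2
    simp only [Pi.zero_apply] at h1
    exact h2.ne' h1
  exact this.exists.elim fun _ h => h

end Trace

/-! ### Minimum distance decisions in complex Gaussian noise -/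

lemma complexGaussian_map_linear {v v' : ℝ≥0} (T : ℂ →L[ℝ] ℂ)
    (hT : ∀ L : StrongDual ℝ ℂ,
      v * (L (T 1) ^ 2 + L (T Complex.I) ^ 2) = v' * (L 1 ^ 2 + L Complex.I ^ 2)) :
    (complexGaussian v).map T = complexGaussian v' := by
  have : IsProbabilityMeasure ((complexGaussian v).map T) :=
    Measure.isProbabilityMeasure_map T.measurable.aemeasurable
  apply Measure.ext_of_charFunDual
  ext L
  rw [charFunDual_map, charFunDual_complexGaussian, charFunDual_complexGaussian]
  have := hT L
  simp only [ContinuousLinearMap.comp_apply]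
  congr 3
  linarith

lemma strongDual_complex_apply (L : StrongDual ℝ ℂ) (z : ℂ) :
    L z = z.re * L 1 + z.im * L Complex.I := by
  conv_lhs => rw [← Complex.re_add_im z, ← mul_one ((z.re : ℝ) : ℂ)]
  rw [map_add, ← Complex.real_smul, ← Complex.real_smul, map_smul, map_smul]
  simp

lemma complexGaussian_map_mul (c : ℂ) (v : ℝ≥0) :
    (complexGaussian v).map (fun w => c * w) = complexGaussian (‖c‖₊ ^ 2 * v) := by
  refine complexGaussian_map_linear (ContinuousLinearMap.mul ℝ ℂ c) fun L => ?_
  rw [strongDual_complex_apply L, strongDual_complex_apply L (ContinuousLinearMap.mul ℝ ℂ c _)]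
  have : ((‖c‖₊ ^ 2 * v : ℝ≥0) : ℝ) = (c.re * c.re + c.im * c.im) * v := by
    push_cast
    rw [← Complex.normSq_apply, ← Complex.sq_norm]
  rw [this]
  simp
  ring

lemma complexGaussian_map_conj (v : ℝ≥0) :
    (complexGaussian v).map (fun w => conj w) = complexGaussian v := by
  refine complexGaussian_map_linear (Complex.conjCLE : ℂ →L[ℝ] ℂ) fun L => ?_
  simp

/-- The real and the imaginary part are independent. -/
lemma complexGaussian_rect (v : ℝ≥0) {A B : Set ℝ} (hA : MeasurableSet A) (hB : MeasurableSet B) :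
    (complexGaussian v).real {w | w.re ∈ A ∧ w.im ∈ B} =
      (gaussianReal 0 (v / 2)).real A * (gaussianReal 0 (v / 2)).real B := by
  have hm : MeasurableSet {w : ℂ | w.re ∈ A ∧ w.im ∈ B} :=
    (Complex.measurable_re hA).inter (Complex.measurable_im hB)
  rw [complexGaussian, map_measureReal_apply measurable_complex_mk hm]
  exact measureReal_prod_prod A B

lemma complexGaussian_re_eq {v : ℝ≥0} (hv : v ≠ 0) (a : ℝ) :
    complexGaussian v {w | w.re = a} = 0 := by
  have h := complexGaussian_rect v (measurableSet_singleton a) MeasurableSet.univ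
  have := nullSingletonClass_gaussianReal (μ := 0) (v := v / 2) (by positivity)
  refine (measureReal_eq_zero_iff (measure_ne_top _ _)).1 ?_
  simpa [measureReal_def] using h

/-- Ties between two distinct points have probability zero. -/
lemma complexGaussian_tie {v : ℝ≥0} (hv : v ≠ 0) {s t : ℂ} (hst : s ≠ t) :
    complexGaussian v {w | ‖s + w - t‖ = ‖w‖} = 0 := by
  have hc : conj (s - t) ≠ 0 := (map_ne_zero _).2 (sub_ne_zero.2 hst)
  have h := complexGaussian_re_eq (v := ‖conj (s - t)‖₊ ^ 2 * v)
    (mul_ne_zero (pow_ne_zero 2 (by simpa using hc)) hv) (-(‖s - t‖ ^ 2 / 2))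
  rw [← complexGaussian_map_mul, Measure.map_apply (measurable_const_mul _)
    (measurableSet_eq_fun Complex.measurable_re measurable_const)] at h
  refine measure_mono_null (fun w hw => ?_) h
  have h1 : ‖s + w - t‖ ^ 2 = ‖w‖ ^ 2 := by rw [(hw : ‖s + w - t‖ = ‖w‖)]
  rw [Complex.sq_norm, Complex.sq_norm, Complex.normSq_apply, Complex.normSq_apply] at h1
  simp only [Set.mem_preimage, Set.mem_ofPred_eq, Complex.sq_norm, Complex.normSq_apply]
  simp at h1 ⊢
  linarith

/-- The noise values for which the point `s` of the constellation is received at least as close to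
another point. Up to ties, this is the set of the noise values causing an erroneous decision. -/
def errorSet (C : Finset ℂ) (s : ℂ) : Set ℂ := {w | ∃ t ∈ C, t ≠ s ∧ ‖s + w - t‖ ≤ ‖w‖}

lemma measurableSet_errorSet (C : Finset ℂ) (s : ℂ) : MeasurableSet (errorSet C s) := by
  have : errorSet C s = ⋃ t ∈ C, {w | t ≠ s ∧ ‖s + w - t‖ ≤ ‖w‖} := by
    ext w
    simp only [errorSet, Set.mem_iUnion, exists_prop]
    rfl
  rw [this]
  refine C.measurableSet_biUnion fun t _ => ?_
  exact (MeasurableSet.const _).inter (measurableSet_le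
    (f := fun w : ℂ => ‖s + w - t‖) (g := fun w : ℂ => ‖w‖) (by fun_prop) (by fun_prop))

/-- The symbol error probability of minimum distance decisions in complex Gaussian noise of
variance `v`, averaged over the constellation. -/
def errProb (C : Finset ℂ) (v : ℝ≥0) : ℝ :=
  (C.card : ℝ)⁻¹ * ∑ s ∈ C, (complexGaussian v).real (errorSet C s)

lemma errProb_nonneg (C : Finset ℂ) (v : ℝ≥0) : 0 ≤ errProb C v :=
  mul_nonneg (by positivity) (Finset.sum_nonneg fun _ _ => measureReal_nonneg)

lemma errProb_le_one (C : Finset ℂ) (v : ℝ≥0) : errProb C v ≤ 1 := by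
  rcases C.eq_empty_or_nonempty with rfl | hC
  · simp [errProb]
  · have hC' : (0 : ℝ) < C.card := by exact_mod_cast hC.card_pos
    rw [errProb, inv_mul_le_iff₀ hC']
    simpa using Finset.sum_le_sum fun s (_ : s ∈ C) =>
      (measureReal_le_one : (complexGaussian v).real (errorSet C s) ≤ 1)

lemma complexGaussian_apply_eq_scaled (v : ℝ≥0) {A : Set ℂ} (hA : MeasurableSet A) :
    complexGaussian v A = complexGaussian 1 ((fun z => ((NNReal.sqrt v : ℝ) : ℂ) * z) ⁻¹' A) := by
  rw [← Measure.map_apply (measurable_const_mul _) hA, complexGaussian_map_mul]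
  congr
  ext
  simp

/-- Scaling the noise to variance `1`, the indicator of an error converges away from the null set
of ties, so that dominated convergence applies. -/
lemma continuousAt_complexGaussian_errorSet (C : Finset ℂ) (s : ℂ) {v₀ : ℝ≥0} (hv₀ : v₀ ≠ 0) :
    ContinuousAt (fun v => (complexGaussian v).real (errorSet C s)) v₀ := by
  simp_rw [measureReal_def, fun v => complexGaussian_apply_eq_scaled v (measurableSet_errorSet C s)]
  refine (ENNReal.continuousAt_toReal (measure_ne_top _ _)).tendsto.comp ?_
  refine tendsto_measure_of_ae_tendsto_indicator_of_isFiniteMeasure _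
    ((measurable_const_mul _) (measurableSet_errorSet C s))
    (fun v => (measurable_const_mul _) (measurableSet_errorSet C s)) ?_
  have htie : ∀ᵐ z ∂complexGaussian 1, ∀ t ∈ C, t ≠ s →
      ‖s + ((NNReal.sqrt v₀ : ℝ) : ℂ) * z - t‖ ≠ ‖((NNReal.sqrt v₀ : ℝ) : ℂ) * z‖ := by
    rw [Filter.eventually_all_finset]
    intro t _
    by_cases hts : t = s
    · exact .of_forall fun z h => absurd hts h
    have h := complexGaussian_tie hv₀ (Ne.symm hts)
    rw [complexGaussian_apply_eq_scaled v₀ (measurableSet_eq_fun (by fun_prop) (by fun_prop))] at h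
    filter_upwards [measure_eq_zero_iff_ae_notMem.1 h] with z hz _
    exact hz
  filter_upwards [htie] with z hz
  have h1 : ∀ᶠ v in 𝓝 v₀, ∀ t ∈ C, t ≠ s →
      (‖s + ((NNReal.sqrt v : ℝ) : ℂ) * z - t‖ ≤ ‖((NNReal.sqrt v : ℝ) : ℂ) * z‖ ↔
        ‖s + ((NNReal.sqrt v₀ : ℝ) : ℂ) * z - t‖ ≤ ‖((NNReal.sqrt v₀ : ℝ) : ℂ) * z‖) := by
    rw [Filter.eventually_all_finset]
    intro t ht
    by_cases hts : t = s
    · exact .of_forall fun z h => absurd hts h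
    have hsq : Continuous fun v : ℝ≥0 => ((NNReal.sqrt v : ℝ) : ℂ) :=
      Complex.continuous_ofReal.comp (NNReal.continuous_coe.comp NNReal.continuous_sqrt)
    have hl : Continuous fun v : ℝ≥0 => ‖s + ((NNReal.sqrt v : ℝ) : ℂ) * z - t‖ := by fun_prop
    have hr : Continuous fun v : ℝ≥0 => ‖((NNReal.sqrt v : ℝ) : ℂ) * z‖ := by fun_prop
    rcases lt_or_gt_of_ne (hz t ht hts) with h | h
    · filter_upwards [hl.continuousAt.eventually_lt hr.continuousAt h] with v hv _
      exact iff_of_true hv.le h.le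
    · filter_upwards [hr.continuousAt.eventually_lt hl.continuousAt h] with v hv _
      exact iff_of_false hv.not_ge h.not_ge
  filter_upwards [h1] with v hv
  simp only [errorSet, Set.mem_preimage, Set.mem_ofPred_eq]
  exact exists_congr fun t => and_congr_right fun ht => and_congr_right fun hts => hv t ht hts

lemma continuousAt_errProb (C : Finset ℂ) {v₀ : ℝ≥0} (hv₀ : v₀ ≠ 0) :
    ContinuousAt (errProb C) v₀ :=
  (tendsto_finsetSum _ fun s _ => continuousAt_complexGaussian_errorSet C s hv₀).const_mul _

/-! ### Pulse amplitude modulation and square quadrature amplitude modulation -/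

lemma gaussianReal_Ici {u : ℝ≥0} (hu : u ≠ 0) (c : ℝ) :
    (gaussianReal 0 u).real (Set.Ici c) = Q (c / √u) := by
  have hu' : 0 < √(u : ℝ) := Real.sqrt_pos.2 (by positivity)
  have h1 : gaussianReal 0 u = (gaussianReal 0 1).map (√(u : ℝ) * ·) := by
    rw [gaussianReal_map_const_mul]
    congr 1
    · simp
    · ext
      simp
  have h2 : (fun x => √(u : ℝ) * x) ⁻¹' Set.Ici c = Set.Ici (c / √u) := by
    ext x
    simp [div_le_iff₀' hu']
  rw [h1, map_measureReal_apply (measurable_const_mul _) measurableSet_Ici, h2, measureReal_def,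
    gaussianReal_apply_eq_integral 0 one_ne_zero, ENNReal.toReal_ofReal
      (integral_nonneg fun x => gaussianPDFReal_nonneg _ _ _), integral_Ici_eq_integral_Ioi, Q,
    ← integral_const_mul]
  simp [gaussianPDFReal]

lemma gaussianReal_Iic_neg {u : ℝ≥0} (hu : u ≠ 0) (c : ℝ) :
    (gaussianReal 0 u).real (Set.Iic (-c)) = Q (c / √u) := by
  rw [← gaussianReal_Ici hu c]
  conv_lhs => rw [← neg_zero, ← gaussianReal_map_neg,
    map_measureReal_apply measurable_neg measurableSet_Iic]
  congr 1
  ext x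
  simp

/-- The real noise values for which the `a`-th point of an equidistant grid of `L` points with
spacing `2 c` is received closest to itself. -/
def gridCell (L : ℕ) (c : ℝ) (a : Fin L) : Set ℝ :=
  {x | ∀ b : Fin L, b ≠ a → |x| < |x + 2 * c * ((a : ℝ) - (b : ℝ))|}

lemma abs_lt_abs_add_iff {x y : ℝ} : |x| < |x + y| ↔ 0 < y * (2 * x + y) := by
  rw [← sq_lt_sq, ← sub_pos]
  ring_nf

lemma compl_gridCell {L : ℕ} {c : ℝ} (hc : 0 < c) (a : Fin L) :
    (gridCell L c a)ᶜ = (if (a : ℕ) + 1 < L then Set.Ici c else ∅) ∪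
      (if 0 < (a : ℕ) then Set.Iic (-c) else ∅) := by
  ext x
  simp only [gridCell, Set.mem_compl_iff, Set.mem_ofPred_eq, abs_lt_abs_add_iff, not_forall, not_lt,
    Set.mem_union]
  constructor
  · rintro ⟨b, hb, h⟩
    rcases lt_or_gt_of_ne hb with hlt | hgt
    · right
      have hlt' : (b : ℕ) < a := hlt
      rw [if_pos (by omega)]
      have h1 : (1 : ℝ) ≤ (a : ℝ) - b := by
        have : ((b : ℕ) : ℝ) + 1 ≤ (a : ℕ) := by exact_mod_cast hlt'
        linarith
      simp only [Set.mem_Iic]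
      by_contra! hx
      have : 0 < 2 * c * ((a : ℝ) - b) * (2 * x + 2 * c * ((a : ℝ) - b)) := by
        apply mul_pos (by positivity)
        nlinarith
      linarith
    · left
      have hgt' : (a : ℕ) < b := hgt
      have := b.2
      rw [if_pos (by omega)]
      have h1 : (1 : ℝ) ≤ (b : ℝ) - a := by
        have : ((a : ℕ) : ℝ) + 1 ≤ (b : ℕ) := by exact_mod_cast hgt'
        linarith
      simp only [Set.mem_Ici]
      by_contra! hx
      have : 0 < 2 * c * ((b : ℝ) - a) * (2 * c * ((b : ℝ) - a) - 2 * x) := by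
        apply mul_pos (by positivity)
        nlinarith
      linarith
  · rintro (h | h)
    · split_ifs at h with ha
      · refine ⟨⟨a + 1, ha⟩, fun h0 => ?_, ?_⟩
        · have := congrArg Fin.val h0
          simp at this
        · simp only [Set.mem_Ici] at h
          push_cast
          nlinarith
      · exact h.elim
    · split_ifs at h with ha
      · have := a.2
        refine ⟨⟨a - 1, by omega⟩, fun h0 => ?_, ?_⟩
        · have := congrArg Fin.val h0
          simp at this
          omega
        · simp only [Set.mem_Iic] at h
          push_cast [Nat.cast_sub (show 1 ≤ (a : ℕ) by omega)]
          nlinarith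
      · exact h.elim

lemma measurableSet_gridCell {L : ℕ} {c : ℝ} (hc : 0 < c) (a : Fin L) :
    MeasurableSet (gridCell L c a) := by
  rw [← MeasurableSet.compl_iff, compl_gridCell hc]
  refine MeasurableSet.union ?_ ?_ <;> split_ifs
  exacts [measurableSet_Ici, MeasurableSet.empty, measurableSet_Iic, MeasurableSet.empty]

lemma sum_gaussianReal_gridCell {L : ℕ} (hL : 1 ≤ L) {c : ℝ} (hc : 0 < c) {u : ℝ≥0} (hu : u ≠ 0) :
    ∑ a : Fin L, (gaussianReal 0 u).real (gridCell L c a) = L - 2 * (L - 1) * Q (c / √u) := by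
  have h1 : ∀ a : Fin L, (gaussianReal 0 u).real (gridCell L c a) =
      1 - ((if (a : ℕ) + 1 < L then Q (c / √u) else 0) + (if 0 < (a : ℕ) then Q (c / √u) else 0)) :=
    fun a => by
      have hcompl := probReal_compl_eq_one_sub (μ := gaussianReal 0 u)
        (measurableSet_gridCell hc a).compl
      rw [compl_compl] at hcompl
      rw [hcompl, compl_gridCell hc, measureReal_union]
      · congr 2
        · split_ifs
          · exact gaussianReal_Ici hu c
          · simp
        · split_ifs
          · exact gaussianReal_Iic_neg hu c
          · simp
      · rw [Set.disjoint_left]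
        intro x hx hx'
        split_ifs at hx hx'
        · simp only [Set.mem_Ici, Set.mem_Iic] at hx hx'
          linarith
        all_goals simp_all
      · split_ifs
        exacts [measurableSet_Iic, MeasurableSet.empty]
  obtain ⟨l, rfl⟩ : ∃ l, L = l + 1 := ⟨L - 1, by omega⟩
  simp_rw [h1]
  rw [Finset.sum_sub_distrib, Finset.sum_add_distrib,
    Fin.sum_univ_castSucc (n := l) (f := fun a => if (a : ℕ) + 1 < l + 1 then Q (c / √u) else 0),
    Fin.sum_univ_succ (n := l) (f := fun a => if 0 < (a : ℕ) then Q (c / √u) else 0)]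
  rw [Finset.sum_congr rfl fun (x : Fin l) _ =>
    if_pos (show ((x.castSucc : Fin (l + 1)) : ℕ) + 1 < l + 1 by simp)]
  simp
  ring

lemma norm_lt_norm_iff_sq {w z : ℂ} :
    ‖w‖ < ‖z‖ ↔ w.re ^ 2 + w.im ^ 2 < z.re ^ 2 + z.im ^ 2 := by
  rw [← abs_norm w, ← abs_norm z, ← sq_lt_sq, Complex.sq_norm, Complex.sq_norm,
    Complex.normSq_apply, Complex.normSq_apply]
  simp only [sq]

lemma errProb_pam {M : ℕ} (hM : 2 ≤ M) {v : ℝ≥0} (hv : v ≠ 0) :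
    errProb (pam M) v = 2 * ((M : ℝ) - 1) / M * Q (√(6 / (((M : ℝ) ^ 2 - 1) * v))) := by
  have hM' : (2 : ℝ) ≤ M := by exact_mod_cast hM
  have hM1 : 0 < (M : ℝ) ^ 2 - 1 := by nlinarith
  set c := √(3 / ((M : ℝ) ^ 2 - 1)) with hc
  have hc0 : 0 < c := Real.sqrt_pos.2 (by positivity)
  have hinj : Function.Injective fun m : Fin M => ((c * (2 * (m : ℕ) + 1 - M) : ℝ) : ℂ) := by
    intro a b hab
    simp only [Complex.ofReal_inj, mul_eq_mul_left_iff, hc0.ne', or_false] at hab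
    have : ((a : ℕ) : ℝ) = (b : ℕ) := by linarith
    exact Fin.ext (by exact_mod_cast this)
  have herr : ∀ a : Fin M, errorSet (pam M) ((c * (2 * (a : ℕ) + 1 - M) : ℝ) : ℂ) =
      {w | w.re ∈ gridCell M c a ∧ w.im ∈ Set.univ}ᶜ := fun a => by
    ext w
    simp only [errorSet, pam, ← hc, Finset.mem_image, Finset.mem_univ, true_and, Set.mem_ofPred_eq,
      Set.mem_compl_iff, Set.mem_univ, and_true, gridCell, not_forall, not_lt, exists_exists_eq_and]
    refine exists_congr fun b => ?_
    rw [hinj.ne_iff, exists_prop]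
    refine and_congr_right fun _ => ?_
    rw [← not_lt, ← not_lt, not_iff_not, norm_lt_norm_iff_sq, ← sq_lt_sq]
    have h1 : (((c * (2 * (a : ℕ) + 1 - M) : ℝ) : ℂ) + w -
        ((c * (2 * (b : ℕ) + 1 - M) : ℝ) : ℂ)).re = w.re + 2 * c * ((a : ℝ) - b) := by
      rw [Complex.sub_re, Complex.add_re, Complex.ofReal_re, Complex.ofReal_re]
      ring
    have h2 : (((c * (2 * (a : ℕ) + 1 - M) : ℝ) : ℂ) + w -
        ((c * (2 * (b : ℕ) + 1 - M) : ℝ) : ℂ)).im = w.im := by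
      rw [Complex.sub_im, Complex.add_im, Complex.ofReal_im, Complex.ofReal_im]
      ring
    rw [h1, h2, add_lt_add_iff_right]
  have h6 : c / √((v / 2 : ℝ≥0) : ℝ) = √(6 / (((M : ℝ) ^ 2 - 1) * v)) := by
    rw [hc, ← Real.sqrt_div (by positivity)]
    congr 1
    push_cast
    field_simp
    norm_num
  have hcard : (pam M).card = M := by
    rw [pam, Finset.card_image_of_injective _ hinj, Finset.card_univ, Fintype.card_fin]
  rw [errProb, hcard]
  conv_lhs => enter [2]; rw [pam, Finset.sum_image fun a _ b _ h => hinj h]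
  have hsum : ∀ a : Fin M, (complexGaussian v).real
      (errorSet (pam M) ((c * (2 * (a : ℕ) + 1 - M) : ℝ) : ℂ)) =
      1 - (gaussianReal 0 (v / 2)).real (gridCell M c a) := fun a => by
    have hm : MeasurableSet {w : ℂ | w.re ∈ gridCell M c a ∧ w.im ∈ Set.univ} :=
      (Complex.measurable_re (measurableSet_gridCell hc0 a)).inter
        (Complex.measurable_im MeasurableSet.univ)
    rw [herr, probReal_compl_eq_one_sub hm, complexGaussian_rect v (measurableSet_gridCell hc0 a)
      MeasurableSet.univ]
    simp
  have := Finset.sum_congr rfl fun (a : Fin M) (_ : a ∈ Finset.univ) => hsum a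
  erw [this]
  rw [Finset.sum_sub_distrib, sum_gaussianReal_gridCell (by omega) hc0 (by positivity), h6]
  simp
  field_simp

lemma errProb_squareQAM {L : ℕ} (hL : 2 ≤ L) {v : ℝ≥0} (hv : v ≠ 0) :
    errProb (squareQAM L) v = 4 * ((L : ℝ) - 1) / L * Q (√(3 / (((L : ℝ) ^ 2 - 1) * v))) -
      4 * ((L : ℝ) - 1) ^ 2 / (L : ℝ) ^ 2 * Q (√(3 / (((L : ℝ) ^ 2 - 1) * v))) ^ 2 := by
  have hL' : (2 : ℝ) ≤ L := by exact_mod_cast hL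
  have hL1 : 0 < (L : ℝ) ^ 2 - 1 := by nlinarith
  set c := √(3 / (2 * ((L : ℝ) ^ 2 - 1))) with hc
  have hc0 : 0 < c := Real.sqrt_pos.2 (by positivity)
  let pt : Fin L × Fin L → ℂ := fun p => ((c : ℝ) : ℂ) *
      (((2 * (p.1 : ℕ) + 1 - L : ℝ) : ℂ) + ((2 * (p.2 : ℕ) + 1 - L : ℝ) : ℂ) * Complex.I)
  have hre : ∀ p, (pt p).re = c * (2 * (p.1 : ℕ) + 1 - L) := fun p => by
    simp only [pt, Complex.re_ofReal_mul, Complex.add_re, Complex.ofReal_re, Complex.mul_I_re,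
      Complex.ofReal_im, neg_zero, add_zero]
  have him : ∀ p, (pt p).im = c * (2 * (p.2 : ℕ) + 1 - L) := fun p => by
    simp only [pt, Complex.im_ofReal_mul, Complex.add_im, Complex.ofReal_im, Complex.mul_I_im,
      Complex.ofReal_re, zero_add]
  have hqam : squareQAM L = Finset.univ.image pt := rfl
  have hinj : Function.Injective pt := by
    intro a b hab
    have h1 := congrArg Complex.re hab
    have h2 := congrArg Complex.im hab
    simp only [hre, him, mul_eq_mul_left_iff, hc0.ne', or_false] at h1 h2
    have e1 : ((a.1 : ℕ) : ℝ) = (b.1 : ℕ) := by linarith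
    have e2 : ((a.2 : ℕ) : ℝ) = (b.2 : ℕ) := by linarith
    exact Prod.ext (Fin.ext (by exact_mod_cast e1)) (Fin.ext (by exact_mod_cast e2))
  have herr : ∀ a : Fin L × Fin L, errorSet (squareQAM L) (pt a) =
      {w | w.re ∈ gridCell L c a.1 ∧ w.im ∈ gridCell L c a.2}ᶜ := fun a => by
    have h1 : ∀ (w : ℂ) b, (pt a + w - pt b).re = w.re + 2 * c * ((a.1 : ℝ) - (b.1 : ℝ)) :=
      fun w b => by
        rw [Complex.sub_re, Complex.add_re, hre, hre]
        ring
    have h2 : ∀ (w : ℂ) b, (pt a + w - pt b).im = w.im + 2 * c * ((a.2 : ℝ) - (b.2 : ℝ)) :=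
      fun w b => by
        rw [Complex.sub_im, Complex.add_im, him, him]
        ring
    ext w
    rw [← not_iff_not, Set.notMem_compl_iff]
    simp only [errorSet, hqam, Finset.mem_image, Finset.mem_univ, true_and, Set.mem_ofPred_eq,
      gridCell, not_exists, not_and, not_le, exists_exists_eq_and, norm_lt_norm_iff_sq, h1, h2,
      hinj.ne_iff, ← sq_lt_sq]
    constructor
    · intro h
      refine ⟨fun b hb => ?_, fun b hb => ?_⟩
      · have := h (b, a.2) fun h0 => hb (congrArg Prod.fst h0)
        simpa using this
      · have := h (a.1, b) fun h0 => hb (congrArg Prod.snd h0)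
        simpa using this
    · rintro ⟨h1, h2⟩ b hb
      by_cases hb1 : b.1 = a.1
      · have hb2 : b.2 ≠ a.2 := fun h0 => hb (Prod.ext hb1 h0)
        have := h2 _ hb2
        rw [hb1]
        simpa using this
      · have h3 := h1 _ hb1
        by_cases hb2 : b.2 = a.2
        · rw [hb2]
          simpa using h3
        · exact add_lt_add h3 (h2 _ hb2)
  have h6 : c / √((v / 2 : ℝ≥0) : ℝ) = √(3 / (((L : ℝ) ^ 2 - 1) * v)) := by
    rw [hc, ← Real.sqrt_div (by positivity)]
    congr 1
    push_cast
    field_simp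
  have hcard : (squareQAM L).card = L * L := by
    rw [hqam, Finset.card_image_of_injective _ hinj, Finset.card_univ, Fintype.card_prod,
      Fintype.card_fin]
  have hsum : ∀ a : Fin L × Fin L, (complexGaussian v).real (errorSet (squareQAM L) (pt a)) =
      1 - (gaussianReal 0 (v / 2)).real (gridCell L c a.1) *
        (gaussianReal 0 (v / 2)).real (gridCell L c a.2) := fun a => by
    have hm : MeasurableSet {w : ℂ | w.re ∈ gridCell L c a.1 ∧ w.im ∈ gridCell L c a.2} :=
      (Complex.measurable_re (measurableSet_gridCell hc0 a.1)).inter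
        (Complex.measurable_im (measurableSet_gridCell hc0 a.2))
    rw [herr, probReal_compl_eq_one_sub hm, complexGaussian_rect v (measurableSet_gridCell hc0 _)
      (measurableSet_gridCell hc0 _)]
  have h7 : ∑ s ∈ squareQAM L, (complexGaussian v).real (errorSet (squareQAM L) s) =
      (L : ℝ) * L - ((L : ℝ) - 2 * (L - 1) * Q (√(3 / (((L : ℝ) ^ 2 - 1) * v)))) *
        ((L : ℝ) - 2 * (L - 1) * Q (√(3 / (((L : ℝ) ^ 2 - 1) * v)))) := by
    rw [← h6, ← sum_gaussianReal_gridCell (by omega : 1 ≤ L) hc0 (by positivity : v / 2 ≠ 0),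
      Finset.sum_mul_sum, ← Fintype.sum_prod_type']
    conv_lhs => enter [1]; rw [hqam]
    rw [Finset.sum_image fun a _ b _ h => hinj h, Finset.sum_congr rfl fun a _ => hsum a,
      Finset.sum_sub_distrib]
    simp
  rw [errProb, hcard, h7]
  push_cast
  field_simp
  ring

/-! ### Phase shift keying -/

lemma mem_psk_iff {M : ℕ} (hM : M ≠ 0) (t : ℂ) : t ∈ psk M ↔ t ^ M = 1 := by
  have hM' : (M : ℂ) ≠ 0 := by exact_mod_cast hM
  simp only [psk, Finset.mem_image, Finset.mem_univ, true_and]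
  constructor
  · rintro ⟨m, rfl⟩
    rw [← Complex.exp_nat_mul, Complex.exp_eq_one_iff]
    refine ⟨(m : ℕ), ?_⟩
    field_simp
    push_cast
    ring
  · intro h
    have ht : t ≠ 0 := by
      rintro rfl
      simp [hM] at h
    have : NeZero M := ⟨hM⟩
    obtain ⟨i, hi, h2⟩ := (Complex.mem_rootsOfUnity M (Units.mk0 t ht)).1
      ((mem_rootsOfUnity' M _).2 (by simpa using h))
    refine ⟨⟨i, hi⟩, ?_⟩
    rw [Units.val_mk0] at h2
    rw [← h2]
    congr 1
    simp only
    ring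

lemma errorSet_psk_rotate {M : ℕ} (hM : M ≠ 0) {s : ℂ} (hs : s ∈ psk M) :
    errorSet (psk M) s = (fun w => conj s * w) ⁻¹' errorSet (psk M) 1 := by
  have hs1 := (mem_psk_iff hM s).1 hs
  have hsn : ‖s‖ = 1 := Complex.norm_eq_one_of_pow_eq_one hs1 hM
  have hss : s * conj s = 1 := by simp [Complex.mul_conj', hsn]
  have hss' : conj s * s = 1 := by rw [mul_comm, hss]
  have hcs : (conj s) ^ M = 1 := by rw [← map_pow, hs1, map_one]
  have hnorm : ∀ z : ℂ, ‖conj s * z‖ = ‖z‖ := fun z => by simp [hsn]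
  ext w
  simp only [errorSet, Set.mem_preimage, Set.mem_ofPred_eq, mem_psk_iff hM]
  constructor
  · rintro ⟨t, ht, hts, h⟩
    refine ⟨conj s * t, by rw [mul_pow, hcs, ht, one_mul], fun h0 => hts ?_, ?_⟩
    · rw [← one_mul t, ← hss, mul_assoc, h0, mul_one]
    · rw [← hss', ← mul_add, ← mul_sub, hnorm, hnorm]
      exact h
  · rintro ⟨t, ht, hts, h⟩
    refine ⟨s * t, by rw [mul_pow, hs1, ht, one_mul], fun h0 => hts ?_, ?_⟩
    · rw [← one_mul t, ← hss', mul_assoc, h0]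
    · rw [← hnorm, ← hnorm w, mul_sub, mul_add, ← mul_assoc, hss', one_mul]
      exact h

/-- By rotational symmetry, all symbols have the same error probability. -/
lemma complexGaussian_errorSet_psk {M : ℕ} (hM : M ≠ 0) {s : ℂ} (hs : s ∈ psk M) (v : ℝ≥0) :
    (complexGaussian v).real (errorSet (psk M) s) =
      (complexGaussian v).real (errorSet (psk M) 1) := by
  have hs1 := (mem_psk_iff hM s).1 hs
  have hsn : ‖conj s‖₊ = 1 := by
    ext
    simpa using Complex.norm_eq_one_of_pow_eq_one hs1 hM
  rw [errorSet_psk_rotate hM hs, ← map_measureReal_apply (measurable_const_mul _)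
    (measurableSet_errorSet _ _), complexGaussian_map_mul, hsn]
  simp

lemma sin_mul_pi_div_pos {M m : ℕ} (hm : 1 ≤ m) (hmM : m < M) :
    0 < Real.sin (m * (Real.pi / M)) := by
  have hM : (0 : ℝ) < M := by exact_mod_cast (by omega : 0 < M)
  have hm' : (0 : ℝ) < m := by exact_mod_cast hm
  have hmM' : (m : ℝ) < M := by exact_mod_cast hmM
  apply Real.sin_pos_of_pos_of_lt_pi (by positivity)
  rw [← mul_div_assoc, div_lt_iff₀ hM, mul_comm]
  exact mul_lt_mul_of_pos_left hmM' Real.pi_pos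

/-- The symbol `1` is received closer to another point of the constellation if and only if the
noise crosses one of the perpendicular bisectors, which are lines through the origin. -/
lemma mem_errorSet_psk_one {M : ℕ} (w : ℂ) :
    w ∈ errorSet (psk M) 1 ↔ ∃ m : ℕ, 1 ≤ m ∧ m < M ∧
      (1 + w.re) * Real.sin (m * (Real.pi / M)) ≤ w.im * Real.cos (m * (Real.pi / M)) := by
  have hpt : ∀ m : ℕ, Complex.exp (2 * Real.pi * Complex.I * (m : ℕ) / (M : ℂ)) =
      ((1 - 2 * Real.sin (m * (Real.pi / M)) ^ 2 : ℝ) : ℂ) +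
        ((2 * Real.sin (m * (Real.pi / M)) * Real.cos (m * (Real.pi / M)) : ℝ) : ℂ) * Complex.I := by
    intro m
    rw [← Real.sin_two_mul, show 1 - 2 * Real.sin (m * (Real.pi / M)) ^ 2 =
      Real.cos (2 * (m * (Real.pi / M))) by rw [Real.cos_two_mul']; linarith [Real.sin_sq_add_cos_sq (m * (Real.pi / M))],
      Complex.ofReal_cos, Complex.ofReal_sin, ← Complex.exp_mul_I]
    congr 1
    push_cast
    ring
  have hiff : ∀ m : ℕ, 1 ≤ m → m < M →
      (‖1 + w - Complex.exp (2 * Real.pi * Complex.I * (m : ℕ) / (M : ℂ))‖ ≤ ‖w‖ ↔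
      (1 + w.re) * Real.sin (m * (Real.pi / M)) ≤ w.im * Real.cos (m * (Real.pi / M))) := by
    intro m hm hmM
    have hs := sin_mul_pi_div_pos hm hmM
    rw [← not_lt, ← not_lt, not_iff_not, norm_lt_norm_iff_sq, hpt]
    have hcs := Real.sin_sq_add_cos_sq (m * (Real.pi / M))
    generalize Real.sin (m * (Real.pi / M)) = a at *
    generalize Real.cos (m * (Real.pi / M)) = b at *
    simp only [Complex.sub_re, Complex.add_re, Complex.one_re, Complex.ofReal_re, Complex.mul_I_re,
      Complex.ofReal_im, Complex.sub_im, Complex.add_im, Complex.one_im, Complex.mul_I_im]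
    have e : (1 + w.re - (1 - 2 * a ^ 2 + -0)) ^ 2 + (0 + w.im - (0 + 2 * a * b)) ^ 2 =
        w.re ^ 2 + w.im ^ 2 + 4 * a * ((1 + w.re) * a - w.im * b) := by
      linear_combination 4 * a ^ 2 * hcs
    rw [e, lt_add_iff_pos_right, mul_pos_iff_of_pos_left (by positivity), sub_pos]
  simp only [errorSet, Set.mem_ofPred_eq, psk, Finset.mem_image, Finset.mem_univ, true_and,
    exists_exists_eq_and]
  constructor
  · rintro ⟨m, hm1, h⟩
    have hm0 : 1 ≤ (m : ℕ) := by
      by_contra h0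
      have : (m : ℕ) = 0 := by omega
      simp [this] at hm1
    exact ⟨m, hm0, m.2, (hiff m hm0 m.2).1 h⟩
  · rintro ⟨m, hm, hmM, h⟩
    refine ⟨⟨m, hmM⟩, fun h0 => ?_, (hiff m hm hmM).2 h⟩
    have h1 := congrArg Complex.re h0
    have hs := sin_mul_pi_div_pos hm hmM
    rw [hpt] at h1
    simp only [Complex.add_re, Complex.ofReal_re, Complex.mul_I_re, Complex.ofReal_im,
      Complex.one_re] at h1
    nlinarith

lemma conj_mem_errorSet_psk_one {M : ℕ} (hM : M ≠ 0) {w : ℂ} (hw : w ∈ errorSet (psk M) 1) :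
    conj w ∈ errorSet (psk M) 1 := by
  rw [mem_errorSet_psk_one] at hw ⊢
  obtain ⟨m, hm, hmM, h⟩ := hw
  refine ⟨M - m, by omega, by omega, ?_⟩
  have hM' : (M : ℝ) ≠ 0 := by exact_mod_cast hM
  have e : ((M - m : ℕ) : ℝ) * (Real.pi / M) = Real.pi - m * (Real.pi / M) := by
    rw [Nat.cast_sub hmM.le]
    field_simp
  rw [e, Real.sin_pi_sub, Real.cos_pi_sub]
  simpa using h

/-- In the upper half-plane, only the bisector with the next point matters. -/
lemma mem_errorSet_psk_one_of_im_pos {M : ℕ} (hM : 2 ≤ M) {w : ℂ} (hw : 0 < w.im) :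
    w ∈ errorSet (psk M) 1 ↔
      (1 + w.re) * Real.sin (Real.pi / M) ≤ w.im * Real.cos (Real.pi / M) := by
  have hα := sin_mul_pi_div_pos le_rfl (by omega : 1 < M)
  rw [Nat.cast_one, one_mul] at hα
  rw [mem_errorSet_psk_one]
  constructor
  · rintro ⟨m, hm, hmM, h⟩
    have hs := sin_mul_pi_div_pos hm hmM
    have hd : 0 ≤ Real.sin (m * (Real.pi / M) - Real.pi / M) := by
      rcases hm.eq_or_lt with rfl | hm2
      · simp
      · have := sin_mul_pi_div_pos (m := m - 1) (by omega) (by omega : m - 1 < M)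
        rw [Nat.cast_sub hm, sub_mul, Nat.cast_one, one_mul] at this
        exact this.le
    rw [Real.sin_sub] at hd
    -- Multiply by `sin (π / M)` and compare the slopes through `0 ≤ sin (m π / M - π / M)`.
    have h1 := mul_le_mul_of_nonneg_right h hα.le
    have h2 := mul_nonneg hw.le hd
    refine le_of_mul_le_mul_left ?_ hs
    nlinarith
  · intro h
    exact ⟨1, le_rfl, by omega, by simpa using h⟩

/-- By symmetry under conjugation, the error probability is twice the one in the upper half-plane. -/
lemma complexGaussian_errorSet_psk_one {M : ℕ} (hM : 2 ≤ M) {v : ℝ≥0} (hv : v ≠ 0) :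
    (complexGaussian v).real (errorSet (psk M) 1) = 2 * (complexGaussian v).real
      {w | 0 < w.im ∧ (1 + w.re) * Real.sin (Real.pi / M) ≤ w.im * Real.cos (Real.pi / M)} := by
  have hE := measurableSet_errorSet (psk M) 1
  have hp : MeasurableSet {w : ℂ | 0 < w.im} := measurableSet_lt measurable_const Complex.measurable_im
  have hA : {w : ℂ | 0 < w.im ∧ (1 + w.re) * Real.sin (Real.pi / M) ≤
      w.im * Real.cos (Real.pi / M)} = errorSet (psk M) 1 ∩ {w | 0 < w.im} := by
    ext w
    simp only [Set.mem_inter_iff, Set.mem_ofPred_eq]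
    rw [and_comm]
    exact and_congr_left fun h => (mem_errorSet_psk_one_of_im_pos hM h).symm
  have hconj : (complexGaussian v).real (errorSet (psk M) 1 ∩ {w | w.im < 0}) =
      (complexGaussian v).real (errorSet (psk M) 1 ∩ {w | 0 < w.im}) := by
    conv_rhs => rw [← complexGaussian_map_conj, map_measureReal_apply (by fun_prop) (hE.inter hp)]
    congr 1
    ext w
    simp only [Set.mem_inter_iff, Set.mem_preimage, Set.mem_ofPred_eq, Complex.conj_im,
      Left.neg_pos_iff]
    exact and_congr_left fun _ => ⟨conj_mem_errorSet_psk_one (by omega), fun h => by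
      simpa using conj_mem_errorSet_psk_one (by omega) h⟩
  have hnull : (complexGaussian v).real {w | w.im = 0} = 0 := by
    have h := complexGaussian_rect v MeasurableSet.univ (measurableSet_singleton (0 : ℝ))
    have := nullSingletonClass_gaussianReal (μ := 0) (v := v / 2) (by positivity)
    simpa [measureReal_def] using h
  rw [hA, ← measureReal_inter_add_sdiff (s := errorSet (psk M) 1) hp, two_mul, add_right_inj, ← hconj]
  refine measureReal_congr ?_
  filter_upwards [measure_eq_zero_iff_ae_notMem.1
    ((measureReal_eq_zero_iff (measure_ne_top _ _)).1 hnull)] with w hw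
  have hw' : w.im ≠ 0 := hw
  apply propext
  change (w ∈ errorSet (psk M) 1 ∧ ¬ 0 < w.im) ↔ (w ∈ errorSet (psk M) 1 ∧ w.im < 0)
  rw [not_lt, le_iff_lt_or_eq, or_iff_left hw']

lemma lintegral_Ioi_radial_gaussian {v : ℝ} (hv : 0 < v) {ρ : ℝ} (hρ : 0 < ρ) :
    ∫⁻ r in Set.Ioi ρ, ENNReal.ofReal (r * ((Real.pi * v)⁻¹ * Real.exp (-(r ^ 2 / v)))) =
      ENNReal.ofReal ((2 * Real.pi)⁻¹ * Real.exp (-(ρ ^ 2 / v))) := by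
  have hd : ∀ r ∈ Set.Ici ρ, HasDerivAt
      (fun r => -((2 * Real.pi)⁻¹ * Real.exp (-(r ^ 2 / v))))
      (r * ((Real.pi * v)⁻¹ * Real.exp (-(r ^ 2 / v)))) r := fun r _ => by
    have h1 : HasDerivAt (fun r : ℝ => -(r ^ 2 / v)) (-(2 * r / v)) r := by
      simpa using ((hasDerivAt_pow 2 r).div_const v).fun_neg
    convert! (h1.exp.const_mul ((2 * Real.pi)⁻¹)).neg using 1
    field_simp
  have hnn : ∀ r ∈ Set.Ioi ρ, 0 ≤ r * ((Real.pi * v)⁻¹ * Real.exp (-(r ^ 2 / v))) := fun r hr => by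
    have : 0 < r := hρ.trans hr
    positivity
  have hlim : Tendsto (fun r => -((2 * Real.pi)⁻¹ * Real.exp (-(r ^ 2 / v)))) atTop (𝓝 0) := by
    have h1 : Tendsto (fun r : ℝ => r ^ 2 / v) atTop atTop :=
      (tendsto_pow_atTop two_ne_zero).atTop_div_const hv
    have := ((Real.tendsto_exp_neg_atTop_nhds_zero.comp h1).const_mul ((2 * Real.pi)⁻¹)).neg
    simpa using this
  rw [← ofReal_integral_eq_lintegral_ofReal
    (integrableOn_Ioi_deriv_of_nonneg' hd hnn hlim)
    ((ae_restrict_iff' measurableSet_Ioi).2 (.of_forall hnn)),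
    integral_Ioi_of_hasDerivAt_of_nonneg' hd hnn hlim]
  simp

lemma complexGaussian_apply_polar {v : ℝ≥0} (hv : v ≠ 0) {A : Set ℂ} (hA : MeasurableSet A) :
    complexGaussian v A = ∫⁻ θ in Set.Ioo (-Real.pi) Real.pi, ∫⁻ r in Set.Ioi (0 : ℝ),
      {q : ℝ × ℝ | (⟨q.1 * Real.cos q.2, q.1 * Real.sin q.2⟩ : ℂ) ∈ A}.indicator
        (fun q => ENNReal.ofReal (q.1 * ((Real.pi * v)⁻¹ * Real.exp (-(q.1 ^ 2 / v))))) (r, θ) := by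
  have hv0 : (0 : ℝ) < v := by positivity
  have hpdf : ∀ x y : ℝ, gaussianPDF 0 (v / 2) x * gaussianPDF 0 (v / 2) y =
      ENNReal.ofReal ((Real.pi * v)⁻¹ * Real.exp (-((x ^ 2 + y ^ 2) / v))) := fun x y => by
    rw [gaussianPDF, gaussianPDF, ← ENNReal.ofReal_mul (gaussianPDFReal_nonneg _ _ _)]
    congr 1
    simp only [gaussianPDFReal, NNReal.coe_div, NNReal.coe_ofNat, sub_zero]
    rw [mul_mul_mul_comm, ← Real.exp_add, ← mul_inv, Real.mul_self_sqrt (by positivity)]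
    rw [show 2 * Real.pi * ((v : ℝ) / 2) = Real.pi * v by ring]
    congr 2
    field_simp
    ring
  have hm2 : MeasurableSet ((fun p : ℝ × ℝ => (⟨p.1, p.2⟩ : ℂ)) ⁻¹' A) := measurable_complex_mk hA
  have hg : Measurable fun p : ℝ × ℝ => gaussianPDF 0 (v / 2) p.1 * gaussianPDF 0 (v / 2) p.2 :=
    ((measurable_gaussianPDF _ _).comp measurable_fst).mul
      ((measurable_gaussianPDF _ _).comp measurable_snd)
  have h1 : complexGaussian v A = ∫⁻ p : ℝ × ℝ, ((fun p : ℝ × ℝ => (⟨p.1, p.2⟩ : ℂ)) ⁻¹' A).indicator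
      (fun p => gaussianPDF 0 (v / 2) p.1 * gaussianPDF 0 (v / 2) p.2) p := by
    rw [complexGaussian, Measure.map_apply measurable_complex_mk hA,
      gaussianReal_of_var_ne_zero 0 (by positivity : v / 2 ≠ 0),
      prod_withDensity (measurable_gaussianPDF _ _) (measurable_gaussianPDF _ _),
      withDensity_apply _ hm2, lintegral_indicator hm2, Measure.volume_eq_prod]
  have hmq : Measurable fun q : ℝ × ℝ => (⟨q.1 * Real.cos q.2, q.1 * Real.sin q.2⟩ : ℂ) :=
    measurable_complex_mk.comp (f := fun q : ℝ × ℝ => (q.1 * Real.cos q.2, q.1 * Real.sin q.2))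
      (by fun_prop)
  have hms : MeasurableSet
      {q : ℝ × ℝ | (⟨q.1 * Real.cos q.2, q.1 * Real.sin q.2⟩ : ℂ) ∈ A} := hmq hA
  rw [h1, ← lintegral_comp_polarCoord_symm, polarCoord_target, Measure.volume_eq_prod,
    ← Measure.prod_restrict, ← lintegral_prod_symm']
  · refine lintegral_congr_ae ?_
    rw [Measure.prod_restrict, EventuallyEq, ae_restrict_iff' (measurableSet_Ioi.prod measurableSet_Ioo)]
    refine .of_forall fun q hq => ?_
    have hq1 : (0 : ℝ) < q.1 := hq.1
    rw [polarCoord_symm_apply]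
    by_cases h : (⟨q.1 * Real.cos q.2, q.1 * Real.sin q.2⟩ : ℂ) ∈ A
    · rw [Set.indicator_of_mem (show (q.1 * Real.cos q.2, q.1 * Real.sin q.2) ∈
          (fun p : ℝ × ℝ => (⟨p.1, p.2⟩ : ℂ)) ⁻¹' A from h),
        Set.indicator_of_mem (show q ∈ {q : ℝ × ℝ |
          (⟨q.1 * Real.cos q.2, q.1 * Real.sin q.2⟩ : ℂ) ∈ A} from h), hpdf, smul_eq_mul,
        ← ENNReal.ofReal_mul hq1.le]
      have : (q.1 * Real.cos q.2) ^ 2 + (q.1 * Real.sin q.2) ^ 2 = q.1 ^ 2 := by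
        linear_combination q.1 ^ 2 * Real.sin_sq_add_cos_sq q.2
      simp only [this]
    · rw [Set.indicator_of_notMem (show (q.1 * Real.cos q.2, q.1 * Real.sin q.2) ∉
          (fun p : ℝ × ℝ => (⟨p.1, p.2⟩ : ℂ)) ⁻¹' A from h),
        Set.indicator_of_notMem (show q ∉ {q : ℝ × ℝ |
          (⟨q.1 * Real.cos q.2, q.1 * Real.sin q.2⟩ : ℂ) ∈ A} from h), smul_zero]
  · exact Measurable.indicator (by fun_prop) hms

/-- Craig's formula: the probability that the noise crosses the upper boundary of the decision
region of the symbol `1`, computed in polar coordinates centred at that symbol. -/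
lemma complexGaussian_upper_bisector {α : ℝ} (hα : 0 < α) (hαπ : α < Real.pi) {v : ℝ≥0}
    (hv : v ≠ 0) :
    (complexGaussian v).real {w | 0 < w.im ∧ (1 + w.re) * Real.sin α ≤ w.im * Real.cos α} =
      (2 * Real.pi)⁻¹ * ∫ θ in (0 : ℝ)..(Real.pi - α),
        Real.exp (-(Real.sin α ^ 2 / (v * Real.sin θ ^ 2))) := by
  have hv0 : (0 : ℝ) < v := by positivity
  have hsα : 0 < Real.sin α := Real.sin_pos_of_pos_of_lt_pi hα hαπ
  set A : Set ℂ := {w | 0 < w.im ∧ (1 + w.re) * Real.sin α ≤ w.im * Real.cos α} with hA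
  have hAm : MeasurableSet A :=
    (measurableSet_lt measurable_const Complex.measurable_im).inter (measurableSet_le
      (f := fun w : ℂ => (1 + w.re) * Real.sin α) (g := fun w : ℂ => w.im * Real.cos α)
      (by fun_prop) (by fun_prop))
  have hmem : ∀ r θ : ℝ, 0 < r → θ ∈ Set.Ioo (-Real.pi) Real.pi →
      ((⟨r * Real.cos θ, r * Real.sin θ⟩ : ℂ) ∈ A ↔
        θ ∈ Set.Ioo α Real.pi ∧ Real.sin α / Real.sin (θ - α) ≤ r) := by
    intro r θ hr hθ
    have h1 : (⟨r * Real.cos θ, r * Real.sin θ⟩ : ℂ) ∈ A ↔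
        0 < Real.sin θ ∧ Real.sin α ≤ r * Real.sin (θ - α) := by
      rw [hA, Set.mem_ofPred_eq, Real.sin_sub]
      refine and_congr (mul_pos_iff_of_pos_left hr) ?_
      constructor <;> intro h <;> nlinarith
    rw [h1]
    constructor
    · rintro ⟨h2, h3⟩
      have hθ0 : 0 < θ := by
        by_contra! h0
        exact h2.not_ge (Real.sin_nonpos_of_nonpos_of_neg_pi_le h0 hθ.1.le)
      have hθα : α < θ := by
        by_contra! h0
        have := Real.sin_nonpos_of_nonpos_of_neg_pi_le (x := θ - α) (by linarith) (by linarith)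
        nlinarith
      have hs := Real.sin_pos_of_pos_of_lt_pi (x := θ - α) (by linarith) (by linarith [hθ.2])
      exact ⟨⟨hθα, hθ.2⟩, (div_le_iff₀ hs).2 h3⟩
    · rintro ⟨⟨h2, h3⟩, h4⟩
      have hs := Real.sin_pos_of_pos_of_lt_pi (x := θ - α) (by linarith) (by linarith)
      exact ⟨Real.sin_pos_of_pos_of_lt_pi (by linarith) h3, (div_le_iff₀ hs).1 h4⟩
  have hinner : ∀ θ ∈ Set.Ioo (-Real.pi) Real.pi, ∫⁻ r in Set.Ioi (0 : ℝ),
      {q : ℝ × ℝ | (⟨q.1 * Real.cos q.2, q.1 * Real.sin q.2⟩ : ℂ) ∈ A}.indicator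
        (fun q => ENNReal.ofReal (q.1 * ((Real.pi * v)⁻¹ * Real.exp (-(q.1 ^ 2 / v))))) (r, θ) =
      (Set.Ioo α Real.pi).indicator (fun θ => ENNReal.ofReal ((2 * Real.pi)⁻¹ *
        Real.exp (-(Real.sin α ^ 2 / (v * Real.sin (θ - α) ^ 2))))) θ := by
    intro θ hθ
    by_cases hθα : θ ∈ Set.Ioo α Real.pi
    · have hs := Real.sin_pos_of_pos_of_lt_pi (x := θ - α) (by linarith [hθα.1])
        (by linarith [hθα.2])
      have hρ : 0 < Real.sin α / Real.sin (θ - α) := by positivity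
      rw [Set.indicator_of_mem hθα]
      have e : Real.sin α ^ 2 / (v * Real.sin (θ - α) ^ 2) =
          (Real.sin α / Real.sin (θ - α)) ^ 2 / v := by
        field_simp
      rw [e, ← lintegral_Ioi_radial_gaussian hv0 hρ, restrict_Ioi_eq_restrict_Ici (a := Real.sin α / Real.sin (θ - α)),
        ← lintegral_indicator measurableSet_Ici, ← lintegral_indicator measurableSet_Ioi]
      refine lintegral_congr fun r => ?_
      by_cases hr : r ∈ Set.Ioi (0 : ℝ)
      · rw [Set.indicator_of_mem hr]
        by_cases hr2 : r ∈ Set.Ici (Real.sin α / Real.sin (θ - α))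
        · rw [Set.indicator_of_mem hr2, Set.indicator_of_mem]
          exact (hmem r θ hr hθ).2 ⟨hθα, hr2⟩
        · rw [Set.indicator_of_notMem hr2, Set.indicator_of_notMem]
          exact fun h => hr2 ((hmem r θ hr hθ).1 h).2
      · rw [Set.indicator_of_notMem hr, Set.indicator_of_notMem]
        exact fun h => hr (hρ.trans_le h)
    · rw [Set.indicator_of_notMem hθα, ← lintegral_indicator measurableSet_Ioi]
      refine (lintegral_congr fun r => ?_).trans lintegral_zero
      by_cases hr : r ∈ Set.Ioi (0 : ℝ)
      · rw [Set.indicator_of_mem hr, Set.indicator_of_notMem]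
        exact fun h => hθα ((hmem r θ hr hθ).1 h).1
      · rw [Set.indicator_of_notMem hr]
  have hIoo : Set.Ioo (-Real.pi) Real.pi ∩ Set.Ioo α Real.pi = Set.Ioo α Real.pi :=
    Set.inter_eq_right.2 (Set.Ioo_subset_Ioo_left (by linarith))
  rw [measureReal_def, complexGaussian_apply_polar hv hAm,
    setLIntegral_congr_fun measurableSet_Ioo hinner,
    setLIntegral_indicator measurableSet_Ioo, Set.inter_comm, hIoo,
    ← ofReal_integral_eq_lintegral_ofReal, ENNReal.toReal_ofReal, integral_const_mul,
    ← integral_Ioc_eq_integral_Ioo, ← intervalIntegral.integral_of_le hαπ.le]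
  · congr 1
    rw [intervalIntegral.integral_comp_sub_right
      (fun θ => Real.exp (-(Real.sin α ^ 2 / (v * Real.sin θ ^ 2)))) α, sub_self]
  · exact integral_nonneg fun θ => by positivity
  · refine Measure.integrableOn_of_bounded (M := (2 * Real.pi)⁻¹) (by simp) ?_ ?_
    · exact Measurable.aestronglyMeasurable (by fun_prop)
    · refine .of_forall fun θ => ?_
      rw [Real.norm_of_nonneg (by positivity)]
      refine mul_le_of_le_one_right (by positivity) (Real.exp_le_one_iff.2 ?_)
      rw [neg_nonpos]
      positivity
  · exact .of_forall fun θ => by positivity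

lemma errProb_psk {M : ℕ} (hM : 2 ≤ M) {v : ℝ≥0} (hv : v ≠ 0) :
    errProb (psk M) v = 1 / Real.pi * ∫ θ in (0 : ℝ)..(((M : ℝ) - 1) * Real.pi / M),
      Real.exp (-(Real.sin (Real.pi / M) ^ 2 / (v * Real.sin θ ^ 2))) := by
  have hM0 : M ≠ 0 := by omega
  have hM' : (2 : ℝ) ≤ M := by exact_mod_cast hM
  have h1 : (1 : ℂ) ∈ psk M := (mem_psk_iff hM0 1).2 (one_pow M)
  have hcard : ((psk M).card : ℝ) ≠ 0 := by
    exact_mod_cast (Finset.card_pos.2 ⟨1, h1⟩).ne'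
  rw [errProb, Finset.sum_congr rfl fun s hs => complexGaussian_errorSet_psk hM0 hs v,
    Finset.sum_const, nsmul_eq_mul, inv_mul_cancel_left₀ hcard,
    complexGaussian_errorSet_psk_one hM hv, complexGaussian_upper_bisector (by positivity)
      (div_lt_self Real.pi_pos (by linarith)) hv]
  have e : ((M : ℝ) - 1) * Real.pi / M = Real.pi - Real.pi / M := by
    field_simp
  rw [e, ← mul_assoc]
  congr 1
  field_simp

/-! ### Reduction of the symbol error probability to a scalar channel -/

lemma pi_complexGaussian_map_dotProduct {n : ℕ} (b : Fin n → ℂ) (c v : ℝ≥0)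
    (hb : b ⬝ᵥ star b = ((c : ℝ) : ℂ)) :
    (Measure.pi fun _ : Fin n => complexGaussian v).map (fun ξ => b ⬝ᵥ ξ) =
      complexGaussian (c * v) := by
  let B : Matrix (Fin 1) (Fin n) ℂ := Matrix.of fun _ => b
  have hB : B * Bᴴ = ((c : ℝ) : ℂ) • (1 : Matrix (Fin 1) (Fin 1) ℂ) := by
    ext i j
    rw [Subsingleton.elim i j, Matrix.smul_apply, Matrix.one_apply_eq, smul_eq_mul, mul_one, ← hb]
    simp [B, Matrix.mul_apply, dotProduct]
  have h := congrArg (fun μ => μ.map (Function.eval (0 : Fin 1)))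
    (pi_complexGaussian_map_mulVec B c v hB)
  have hm : Measurable fun w : Fin n → ℂ => B *ᵥ w :=
    (Matrix.mulVecLin B).continuous_of_finiteDimensional.measurable
  rw [Measure.map_map (measurable_pi_apply _) hm,
    (measurePreserving_eval (fun _ : Fin 1 => complexGaussian (c * v)) 0).map_eq] at h
  exact h

lemma measurableSet_errorSet_prod (C : Finset ℂ) :
    MeasurableSet {p : ℂ × ℂ | p.2 ∈ errorSet C p.1} := by
  have : {p : ℂ × ℂ | p.2 ∈ errorSet C p.1} =
      ⋃ t ∈ C, {p | t ≠ p.1 ∧ ‖p.1 + p.2 - t‖ ≤ ‖p.2‖} := by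
    ext p
    simp only [errorSet, Set.mem_iUnion, exists_prop]
    rfl
  rw [this]
  refine C.measurableSet_biUnion fun t _ => MeasurableSet.inter ?_ ?_
  · exact (measurableSet_eq_fun measurable_const measurable_fst).compl
  · exact measurableSet_le (f := fun p : ℂ × ℂ => ‖p.1 + p.2 - t‖) (g := fun p : ℂ × ℂ => ‖p.2‖)
      (by fun_prop) (by fun_prop)

/-- The pairs (symbol, noise) for which the received point is equidistant from the symbol and
another point of the constellation. -/
def tieSet (C : Finset ℂ) : Set (ℂ × ℂ) := {p | ∃ t ∈ C, t ≠ p.1 ∧ ‖p.1 + p.2 - t‖ = ‖p.2‖}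

lemma measurableSet_tieSet (C : Finset ℂ) : MeasurableSet (tieSet C) := by
  have : tieSet C = ⋃ t ∈ C, {p : ℂ × ℂ | t ≠ p.1 ∧ ‖p.1 + p.2 - t‖ = ‖p.2‖} := by
    ext p
    simp only [tieSet, Set.mem_iUnion, exists_prop]
    rfl
  rw [this]
  refine C.measurableSet_biUnion fun t _ => MeasurableSet.inter ?_ ?_
  · exact (measurableSet_eq_fun measurable_const measurable_fst).compl
  · exact measurableSet_eq_fun (f := fun p : ℂ × ℂ => ‖p.1 + p.2 - t‖)
      (g := fun p : ℂ × ℂ => ‖p.2‖) (by fun_prop) (by fun_prop)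

lemma prod_complexGaussian_tieSet (C : Finset ℂ) (ν : Measure ℂ) [SFinite ν] {v : ℝ≥0}
    (hv : v ≠ 0) : (ν.prod (complexGaussian v)) (tieSet C) = 0 := by
  rw [Measure.measure_prod_null (measurableSet_tieSet C)]
  refine .of_forall fun z => ?_
  have : Prod.mk z ⁻¹' tieSet C = ⋃ t ∈ C, {w | t ≠ z ∧ ‖z + w - t‖ = ‖w‖} := by
    ext p
    simp only [tieSet, Set.mem_iUnion, exists_prop]
    rfl
  simp only [this, Pi.zero_apply]
  refine (measure_biUnion_null_iff C.countable_toSet).2 ?_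
  intro t _
  by_cases htz : t = z
  · simp [htz]
  · exact measure_mono_null (fun w hw => hw.2) (complexGaussian_tie hv (Ne.symm htz))

lemma lintegral_uniformOn_finset {C : Finset ℂ} (f : ℂ → ENNReal) :
    ∫⁻ z, f z ∂(uniformOn (C : Set ℂ)) = (C.card : ENNReal)⁻¹ * ∑ z ∈ C, f z := by
  rw [uniformOn, ProbabilityTheory.cond, lintegral_smul_measure, Measure.count_apply_finset,
    lintegral_finset]
  simp

lemma uniformOn_prod_complexGaussian_errorSet {C : Finset ℂ} (hC : C.Nonempty) (v : ℝ≥0) :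
    ((uniformOn (C : Set ℂ)).prod (complexGaussian v)) {p | p.2 ∈ errorSet C p.1} =
      ENNReal.ofReal (errProb C v) := by
  have : IsProbabilityMeasure (uniformOn (C : Set ℂ)) :=
    isProbabilityMeasure_uniformOn C.finite_toSet hC
  rw [Measure.prod_apply (measurableSet_errorSet_prod C), lintegral_uniformOn_finset, errProb,
    ENNReal.ofReal_mul (by positivity), ENNReal.ofReal_inv_of_pos (by exact_mod_cast hC.card_pos),
    ENNReal.ofReal_natCast, ENNReal.ofReal_sum_of_nonneg fun _ _ => measureReal_nonneg]
  congr 1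
  refine Finset.sum_congr rfl fun z _ => ?_
  rw [ofReal_measureReal]
  rfl

lemma measurable_errProb (C : Finset ℂ) : Measurable (errProb C) := by
  refine Measurable.const_mul (Finset.measurable_sum _ fun s _ => ?_) _
  simp_rw [measureReal_def, fun v => complexGaussian_apply_eq_scaled v (measurableSet_errorSet C s)]
  refine Measurable.ennreal_toReal ?_
  have hm : Measurable fun p : ℝ≥0 × ℂ => ((NNReal.sqrt p.1 : ℝ) : ℂ) * p.2 :=
    (Complex.measurable_ofReal.comp (measurable_coe_nnreal_real.comp
      (NNReal.continuous_sqrt.measurable.comp measurable_fst))).mul measurable_snd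
  exact measurable_measure_prodMk_left (hm (measurableSet_errorSet C s))

section Detection

variable {Nr Nt : ℕ}

/-- The variance of the `k`-th component of the zero-forcing output, for unit noise variance. -/
def zfNoiseVar (F : Matrix (Fin Nt) (Fin Nt) ℂ) (k : Fin Nt) (H : Fin Nr → Fin Nt → ℂ) : ℝ :=
  (((Matrix.of H * F)ᴴ * (Matrix.of H * F))⁻¹ k k).re

lemma pinv_mul_conjTranspose (A : Matrix (Fin Nr) (Fin Nt) ℂ) (hA : (Aᴴ * A).det ≠ 0) :
    pinv A * (pinv A)ᴴ = (Aᴴ * A)⁻¹ := by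
  have hu : IsUnit (Aᴴ * A).det := by simpa using hA
  have hh : ((Aᴴ * A)⁻¹)ᴴ = (Aᴴ * A)⁻¹ := (Matrix.isHermitian_conjTranspose_mul_self A).inv
  rw [pinv, Matrix.conjTranspose_mul, Matrix.conjTranspose_conjTranspose, hh, Matrix.mul_assoc,
    ← Matrix.mul_assoc Aᴴ, Matrix.mul_nonsing_inv _ hu, Matrix.mul_one]

lemma zfOutput_apply {F : Matrix (Fin Nt) (Fin Nt) ℂ} {H : Matrix (Fin Nr) (Fin Nt) ℂ}
    (hA : ((H * F)ᴴ * (H * F)).det ≠ 0) (s : Fin Nt → ℂ) (ξ : Fin Nr → ℂ) (k : Fin Nt) :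
    zfOutput F H s ξ k = s k + pinv (H * F) k ⬝ᵥ ξ := by
  have hu : IsUnit ((H * F)ᴴ * (H * F)).det := by simpa using hA
  rw [zfOutput, Matrix.mulVec_add, Matrix.mulVec_mulVec, pinv, Matrix.mul_assoc,
    Matrix.nonsing_inv_mul _ hu, Matrix.one_mulVec]
  rfl

lemma pinv_row_dotProduct_star {F : Matrix (Fin Nt) (Fin Nt) ℂ} {H : Fin Nr → Fin Nt → ℂ}
    (hA : ((Matrix.of H * F)ᴴ * (Matrix.of H * F)).det ≠ 0) (k : Fin Nt) :
    pinv (Matrix.of H * F) k ⬝ᵥ star (pinv (Matrix.of H * F) k) = (zfNoiseVar F k H : ℂ) := by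
  set b := pinv (Matrix.of H * F) k
  have h : b ⬝ᵥ star b = ((Matrix.of H * F)ᴴ * (Matrix.of H * F))⁻¹ k k := by
    rw [← pinv_mul_conjTranspose _ hA, Matrix.mul_apply]
    rfl
  have hreal : b ⬝ᵥ star b = ((∑ i, ‖b i‖ ^ 2 : ℝ) : ℂ) := by
    simp [dotProduct, Complex.mul_conj']
  rw [zfNoiseVar, ← h, hreal, Complex.ofReal_re]

lemma zfNoiseVar_pos {F : Matrix (Fin Nt) (Fin Nt) ℂ} {H : Fin Nr → Fin Nt → ℂ}
    (hA : ((Matrix.of H * F)ᴴ * (Matrix.of H * F)).det ≠ 0) (k : Fin Nt) :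
    0 < zfNoiseVar F k H := by
  have h := pinv_row_dotProduct_star hA k
  set b := pinv (Matrix.of H * F) k with hb
  have hreal : b ⬝ᵥ star b = ((∑ i, ‖b i‖ ^ 2 : ℝ) : ℂ) := by
    simp [dotProduct, Complex.mul_conj']
  rw [hreal, Complex.ofReal_inj] at h
  rw [← h]
  refine lt_of_le_of_ne (Finset.sum_nonneg fun _ _ => by positivity) fun h0 => ?_
  have hb0 : ∀ i, b i = 0 := fun i => by
    have := (Finset.sum_eq_zero_iff_of_nonneg fun _ _ => by positivity).1 h0.symm i
      (Finset.mem_univ i)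
    simpa using this
  have hu : IsUnit ((Matrix.of H * F)ᴴ * (Matrix.of H * F)).det := by simpa using hA
  have h1 : (pinv (Matrix.of H * F) * (Matrix.of H * F)) k k = 1 := by
    rw [pinv, Matrix.mul_assoc, Matrix.nonsing_inv_mul _ hu, Matrix.one_apply_eq]
  rw [Matrix.mul_apply, Finset.sum_eq_zero fun j _ => by
    rw [show pinv (Matrix.of H * F) k j = 0 from hb0 j, zero_mul]] at h1
  exact zero_ne_one h1

lemma measurable_pinv_apply (F : Matrix (Fin Nt) (Fin Nt) ℂ) (k : Fin Nt) (i : Fin Nr) :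
    Measurable fun H : Fin Nr → Fin Nt → ℂ => pinv (Matrix.of H * F) k i := by
  have hA : ∀ i j, Measurable fun H : Fin Nr → Fin Nt → ℂ => (Matrix.of H * F) i j := fun i j => by
    simp only [Matrix.mul_apply, Matrix.of_apply]
    fun_prop
  simp only [pinv]
  simp_rw [Matrix.mul_apply (M := _⁻¹)]
  refine Finset.measurable_sum _ fun j _ => (measurable_inv_gram hA k j).mul ?_
  simp only [Matrix.conjTranspose_apply]
  exact Complex.continuous_conj.measurable.comp (hA i j)

lemma measurable_zfNoiseVar (F : Matrix (Fin Nt) (Fin Nt) ℂ) (k : Fin Nt) :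
    Measurable fun H : Fin Nr → Fin Nt → ℂ => zfNoiseVar F k H :=
  Complex.measurable_re.comp (measurable_inv_gram (fun i j => by
    simp only [Matrix.mul_apply, Matrix.of_apply]
    fun_prop) k k)

/-- For a channel of full column rank, a symbol and its noise after equalization are independent,
and the noise is complex Gaussian. -/
lemma map_symbol_noise {C : Finset ℂ} (hC : C.Nonempty) {η : ℝ}
    {F : Matrix (Fin Nt) (Fin Nt) ℂ} {H : Fin Nr → Fin Nt → ℂ}
    (hA : ((Matrix.of H * F)ᴴ * (Matrix.of H * F)).det ≠ 0) (k : Fin Nt) :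
    ((symbolsLaw Nt C).prod (noiseLaw Nr η)).map
        (fun y => (y.1 k, pinv (Matrix.of H * F) k ⬝ᵥ y.2)) =
      (uniformOn (C : Set ℂ)).prod
        (complexGaussian ((zfNoiseVar F k H).toNNReal * (1 / η).toNNReal)) := by
  have : IsProbabilityMeasure (uniformOn (C : Set ℂ)) :=
    isProbabilityMeasure_uniformOn C.finite_toSet hC
  have h1 : MeasurePreserving (Function.eval k) (symbolsLaw Nt C) (uniformOn (C : Set ℂ)) :=
    measurePreserving_eval _ k
  have h2 : MeasurePreserving (fun ξ => pinv (Matrix.of H * F) k ⬝ᵥ ξ) (noiseLaw Nr η)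
      (complexGaussian ((zfNoiseVar F k H).toNNReal * (1 / η).toNNReal)) := by
    refine ⟨by unfold dotProduct; fun_prop, pi_complexGaussian_map_dotProduct _ _ _ ?_⟩
    rw [pinv_row_dotProduct_star hA, Real.coe_toNNReal _ (zfNoiseVar_pos hA k).le]
  have : SFinite (noiseLaw Nr η) := by unfold noiseLaw; infer_instance
  have : SFinite (symbolsLaw Nt C) := by unfold symbolsLaw; infer_instance
  exact (h1.prod h2).map_eq

/-- Conditioning on the channel: the error probability of the `k`-th symbol is the mean of the error
probability of the scalar channel whose noise variance is that of the equalized noise. The decision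
rule need not be measurable, but it is determined outside of the null set of ties. -/
lemma systemLaw_error_eq {C : Finset ℂ} (hC : C.Nonempty) {η : ℝ} (hη : 0 < η) {δ : ℂ → ℂ}
    (hδ : IsHardDecision C δ) {S F : Matrix (Fin Nt) (Fin Nt) ℂ}
    (hA : ∀ᵐ H ∂channelLaw Nr Nt S, ((Matrix.of H * F)ᴴ * (Matrix.of H * F)).det ≠ 0)
    (k : Fin Nt) :
    (systemLaw Nr Nt S η C) {x | δ (zfOutput F (Matrix.of x.1) x.2.1 x.2.2 k) ≠ x.2.1 k} =
      ∫⁻ H, ENNReal.ofReal (errProb C ((zfNoiseVar F k H).toNNReal * (1 / η).toNNReal))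
        ∂channelLaw Nr Nt S := by
  have : IsProbabilityMeasure (uniformOn (C : Set ℂ)) :=
    isProbabilityMeasure_uniformOn C.finite_toSet hC
  have : IsProbabilityMeasure (noiseLaw Nr η) := by unfold noiseLaw; infer_instance
  have : IsProbabilityMeasure (symbolsLaw Nt C) := by unfold symbolsLaw; infer_instance
  have : SFinite (channelLaw Nr Nt S) := by unfold channelLaw; infer_instance
  let Φ : (Fin Nr → Fin Nt → ℂ) × (Fin Nt → ℂ) × (Fin Nr → ℂ) → ℂ × ℂ :=
    fun x => (x.2.1 k, pinv (Matrix.of x.1 * F) k ⬝ᵥ x.2.2)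
  have hΦ : Measurable Φ := by
    refine Measurable.prodMk (by fun_prop) ?_
    unfold dotProduct
    exact Finset.measurable_sum _ fun i _ =>
      ((measurable_pinv_apply F k i).comp measurable_fst).mul (by fun_prop)
  have hΦH : ∀ H, Measurable fun y : (Fin Nt → ℂ) × (Fin Nr → ℂ) =>
      (y.1 k, pinv (Matrix.of H * F) k ⬝ᵥ y.2) := fun H => hΦ.comp measurable_prodMk_left
  have hAx : ∀ᵐ x ∂systemLaw Nr Nt S η C,
      ((Matrix.of x.1 * F)ᴴ * (Matrix.of x.1 * F)).det ≠ 0 :=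
    Measure.quasiMeasurePreserving_fst.ae hA
  have htie : ∀ᵐ x ∂systemLaw Nr Nt S η C, Φ x ∉ tieSet C := by
    refine measure_eq_zero_iff_ae_notMem.1 (?_ : systemLaw Nr Nt S η C (Φ ⁻¹' tieSet C) = 0)
    rw [systemLaw, Measure.measure_prod_null (hΦ (measurableSet_tieSet C))]
    filter_upwards [hA] with H hH
    have h := prod_complexGaussian_tieSet C (uniformOn (C : Set ℂ))
      (v := (zfNoiseVar F k H).toNNReal * (1 / η).toNNReal)
      (mul_ne_zero (by simpa using zfNoiseVar_pos hH k) (by simpa using hη))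
    rw [← map_symbol_noise hC hH k] at h
    exact (Measure.map_apply (hΦH H) (measurableSet_tieSet C)).symm.trans h
  have hsC : ∀ᵐ x ∂systemLaw Nr Nt S η C, x.2.1 k ∈ C := by
    have h0 : ∀ᵐ z ∂uniformOn (C : Set ℂ), z ∈ C := ae_cond_mem C.measurableSet
    have h1 : ∀ᵐ s ∂symbolsLaw Nt C, s k ∈ C :=
      (measurePreserving_eval (fun _ : Fin Nt => uniformOn (C : Set ℂ)) k).quasiMeasurePreserving.ae h0
    have h2 : ∀ᵐ y ∂(symbolsLaw Nt C).prod (noiseLaw Nr η), y.1 k ∈ C :=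
      Measure.quasiMeasurePreserving_fst.ae h1
    exact Measure.quasiMeasurePreserving_snd.ae h2
  have hset : {x | δ (zfOutput F (Matrix.of x.1) x.2.1 x.2.2 k) ≠ x.2.1 k} =ᵐ[systemLaw Nr Nt S η C]
      Φ ⁻¹' {p | p.2 ∈ errorSet C p.1} := by
    filter_upwards [hAx, htie, hsC] with x hx hxt hxs
    apply propext
    change δ (zfOutput F (Matrix.of x.1) x.2.1 x.2.2 k) ≠ x.2.1 k ↔
      ∃ t ∈ C, t ≠ (Φ x).1 ∧ ‖(Φ x).1 + (Φ x).2 - t‖ ≤ ‖(Φ x).2‖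
    rw [zfOutput_apply hx]
    change δ ((Φ x).1 + (Φ x).2) ≠ (Φ x).1 ↔ _
    have hC1 : (Φ x).1 + (Φ x).2 - (Φ x).1 = (Φ x).2 := by ring
    obtain ⟨hmem, hmin⟩ := hδ ((Φ x).1 + (Φ x).2)
    constructor
    · intro hne
      refine ⟨_, hmem, hne, ?_⟩
      have := hmin _ hxs
      change _ ≤ ‖(Φ x).1 + (Φ x).2 - (Φ x).1‖ ^ 2 at this
      rw [hC1] at this
      exact (sq_le_sq₀ (norm_nonneg _) (norm_nonneg _)).1 this
    · rintro ⟨t, ht, hts, hle⟩ heq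
      have h1 := hmin t ht
      rw [heq, hC1] at h1
      have h2 := (sq_le_sq₀ (norm_nonneg _) (norm_nonneg _)).1 h1
      exact hxt ⟨t, ht, hts, le_antisymm hle h2⟩
  rw [measure_congr hset, systemLaw,
    Measure.prod_apply (hΦ (measurableSet_errorSet_prod C))]
  refine lintegral_congr_ae ?_
  filter_upwards [hA] with H hH
  rw [← uniformOn_prod_complexGaussian_errorSet hC, ← map_symbol_noise hC hH k]
  exact (Measure.map_apply (hΦH H) (measurableSet_errorSet_prod C)).symm

end Detection

/-! ### The precoded channel -/

lemma dftMatrix_conjTranspose_mul_self {N : ℕ} (hN : N ≠ 0) :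
    (dftMatrix N)ᴴ * dftMatrix N = 1 := by
  have hN' : (N : ℂ) ≠ 0 := by exact_mod_cast hN
  have hNpos : (0 : ℝ) < N := by exact_mod_cast Nat.pos_of_ne_zero hN
  have hs : ((1 / √(N : ℝ) : ℝ) : ℂ) * ((1 / √(N : ℝ) : ℝ) : ℂ) = (N : ℂ)⁻¹ := by
    rw [← Complex.ofReal_mul, div_mul_div_comm, one_mul, Real.mul_self_sqrt hNpos.le]
    simp
  ext a b
  set ζ : ℂ := Complex.exp (2 * Real.pi * Complex.I * ((a : ℕ) - (b : ℕ)) / N) with hζ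
  have hterm : ∀ m : Fin N, (dftMatrix N)ᴴ a m * dftMatrix N m b = (N : ℂ)⁻¹ * ζ ^ (m : ℕ) := by
    intro m
    simp only [dftMatrix, Matrix.conjTranspose_apply, Matrix.of_apply, star_mul',
      RCLike.star_def, Complex.conj_ofReal]
    rw [mul_mul_mul_comm, hs, ← Complex.exp_conj, ← Complex.exp_add, hζ, ← Complex.exp_nat_mul]
    congr 2
    simp only [map_neg, map_div₀, map_mul, Complex.conj_ofReal, Complex.conj_I, map_natCast,
      map_ofNat]
    ring
  rw [Matrix.mul_apply, Finset.sum_congr rfl fun m _ => hterm m, ← Finset.mul_sum,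
    Fin.sum_univ_eq_sum_range (fun m => ζ ^ m) N, Matrix.one_apply]
  split_ifs with hab
  · have : ζ = 1 := by simp [hζ, hab]
    simp [this, hN']
  · have hζN : ζ ^ N = 1 := by
      rw [hζ, ← Complex.exp_nat_mul, Complex.exp_eq_one_iff]
      refine ⟨(a : ℤ) - (b : ℤ), ?_⟩
      push_cast
      field_simp
    have hζ1 : ζ ≠ 1 := by
      intro h
      rw [hζ, Complex.exp_eq_one_iff] at h
      obtain ⟨n, hn⟩ := h
      have hpi : (2 * Real.pi * Complex.I : ℂ) ≠ 0 := Complex.two_pi_I_ne_zero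
      have h1 : ((a : ℕ) : ℂ) - (b : ℕ) = n * N := by
        rw [div_eq_iff hN'] at hn
        apply mul_left_cancel₀ hpi
        rw [hn]
        ring
      have h2 : ((a : ℕ) : ℤ) - (b : ℕ) = n * N := by exact_mod_cast h1
      have ha := a.2
      have hb := b.2
      have hne : (a : ℕ) ≠ b := fun h => hab (Fin.ext h)
      rcases lt_trichotomy n 0 with hn0 | hn0 | hn0
      · nlinarith
      · rw [hn0] at h2
        omega
      · nlinarith
    rw [geom_sum_eq hζ1, hζN]
    simp

/-- The optimal precoder equalizes the noise: all diagonal entries of `(Fᴴ S F)⁻¹` are equal,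
because `(Fᴴ S F)⁻¹` is diagonalized by the DFT matrix, all of whose entries have modulus
`1 / √N`. -/
lemma inv_precoder_gram {N : ℕ} (hN : N ≠ 0) {S F W : Matrix (Fin N) (Fin N) ℂ} {ev : Fin N → ℝ}
    (hW : Wᴴ * W = 1) (hev : ∀ k, 0 < ev k)
    (hS : S = W * Matrix.diagonal (fun k => ((ev k : ℝ) : ℂ)) * Wᴴ)
    (hF : F = ((1 / √(∑ k, ev k ^ (-(1 / 2) : ℝ)) : ℝ) : ℂ) •
      (W * Matrix.diagonal (fun k => ((ev k ^ (-(1 / 4) : ℝ) : ℝ) : ℂ)) * dftMatrix N)) :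
    (Fᴴ * S * F).det ≠ 0 ∧
      ∀ k, (Fᴴ * S * F)⁻¹ k k = (((∑ k, (√(ev k))⁻¹) ^ 2 / N : ℝ) : ℂ) := by
  have hV := dftMatrix_conjTranspose_mul_self hN
  have hV' : dftMatrix N * (dftMatrix N)ᴴ = 1 := mul_eq_one_comm.1 hV
  have hNpos : (0 : ℝ) < N := by exact_mod_cast Nat.pos_of_ne_zero hN
  have hhalf : ∀ k, ev k ^ (-(1 / 2) : ℝ) = (√(ev k))⁻¹ := fun k => by
    rw [Real.rpow_neg (hev k).le, Real.sqrt_eq_rpow]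
  have hquart : ∀ k, ev k ^ (-(1 / 4) : ℝ) * ev k ^ (-(1 / 4) : ℝ) = (√(ev k))⁻¹ := fun k => by
    rw [← hhalf, ← Real.rpow_add (hev k)]
    norm_num
  set T := ∑ k, (√(ev k))⁻¹ with hT
  have hTpos : 0 < T := by
    have : Nonempty (Fin N) := ⟨⟨0, Nat.pos_of_ne_zero hN⟩⟩
    exact Finset.sum_pos (fun k _ => inv_pos.2 (Real.sqrt_pos.2 (hev k))) Finset.univ_nonempty
  simp_rw [hhalf, ← hT] at hF
  set V := dftMatrix N with hVdef
  have hgram : Fᴴ * S * F = ((T⁻¹ : ℝ) : ℂ) •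
      (Vᴴ * Matrix.diagonal (fun k => ((√(ev k) : ℝ) : ℂ)) * V) := by
    have hκ : ((1 / √T : ℝ) : ℂ) * ((1 / √T : ℝ) : ℂ) = ((T⁻¹ : ℝ) : ℂ) := by
      rw [← Complex.ofReal_mul, div_mul_div_comm, one_mul, Real.mul_self_sqrt hTpos.le, one_div]
    set D4 := Matrix.diagonal (fun k => ((ev k ^ (-(1 / 4) : ℝ) : ℝ) : ℂ)) with hD4
    set D := Matrix.diagonal (fun k => ((ev k : ℝ) : ℂ)) with hD
    have hD4h : D4ᴴ = D4 := by
      rw [hD4, Matrix.diagonal_conjTranspose]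
      congr 1
      ext k
      simp
    have hDDD : D4 * D * D4 = Matrix.diagonal (fun k => ((√(ev k) : ℝ) : ℂ)) := by
      rw [hD4, hD, Matrix.diagonal_mul_diagonal, Matrix.diagonal_mul_diagonal]
      congr 1
      ext k
      rw [← Complex.ofReal_mul, ← Complex.ofReal_mul, mul_right_comm, hquart]
      congr 1
      rw [inv_mul_eq_div, Real.div_sqrt]
    rw [hF, hS, Matrix.conjTranspose_smul, Matrix.smul_mul, Matrix.smul_mul, Matrix.mul_smul,
      smul_smul, ← hDDD]
    have hst : star ((1 / √T : ℝ) : ℂ) = ((1 / √T : ℝ) : ℂ) := Complex.conj_ofReal _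
    rw [hst, hκ, Matrix.conjTranspose_mul, Matrix.conjTranspose_mul, hD4h]
    congr 1
    calc Vᴴ * (D4 * Wᴴ) * (W * D * Wᴴ) * (W * D4 * V)
        = Vᴴ * D4 * (Wᴴ * W) * D * (Wᴴ * W) * D4 * V := by simp only [Matrix.mul_assoc]
      _ = Vᴴ * (D4 * D * D4) * V := by rw [hW]; simp only [Matrix.mul_one, Matrix.mul_assoc]
  have hinv : Fᴴ * S * F * (((T : ℝ) : ℂ) •
      (Vᴴ * Matrix.diagonal (fun k => (((√(ev k))⁻¹ : ℝ) : ℂ)) * V)) = 1 := by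
    rw [hgram, Matrix.smul_mul, Matrix.mul_smul, smul_smul, ← Complex.ofReal_mul,
      inv_mul_cancel₀ hTpos.ne', Complex.ofReal_one, one_smul]
    have hdd : Matrix.diagonal (fun k => ((√(ev k) : ℝ) : ℂ)) *
        Matrix.diagonal (fun k => (((√(ev k))⁻¹ : ℝ) : ℂ)) = 1 := by
      rw [Matrix.diagonal_mul_diagonal, ← Matrix.diagonal_one]
      congr 1
      ext k
      rw [← Complex.ofReal_mul, mul_inv_cancel₀ (Real.sqrt_pos.2 (hev k)).ne', Complex.ofReal_one]
    calc _ = Vᴴ * Matrix.diagonal (fun k => ((√(ev k) : ℝ) : ℂ)) * (V * Vᴴ) *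
          Matrix.diagonal (fun k => (((√(ev k))⁻¹ : ℝ) : ℂ)) * V := by simp only [Matrix.mul_assoc]
      _ = Vᴴ * (Matrix.diagonal (fun k => ((√(ev k) : ℝ) : ℂ)) *
          Matrix.diagonal (fun k => (((√(ev k))⁻¹ : ℝ) : ℂ))) * V := by
            rw [hV']; simp only [Matrix.mul_one, Matrix.mul_assoc]
      _ = 1 := by rw [hdd, Matrix.mul_one, hV]
  refine ⟨fun h0 => ?_, fun k => ?_⟩
  · have := congrArg Matrix.det hinv
    rw [Matrix.det_mul, h0, zero_mul, Matrix.det_one] at this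
    exact zero_ne_one this
  · rw [Matrix.inv_eq_right_inv hinv, Matrix.smul_apply, Matrix.mul_apply]
    have hterm : ∀ j, (Vᴴ * Matrix.diagonal (fun k => (((√(ev k))⁻¹ : ℝ) : ℂ))) k j * V j k =
        (((√(ev j))⁻¹ / N : ℝ) : ℂ) := fun j => by
      rw [Matrix.mul_diagonal, Matrix.conjTranspose_apply, mul_right_comm]
      have : star (V j k) * V j k = ((1 / N : ℝ) : ℂ) := by
        rw [RCLike.star_def, Complex.conj_mul', ← Complex.ofReal_pow]
        congr 1
        rw [hVdef, dftMatrix, Matrix.of_apply, norm_mul, Complex.norm_real,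
          Real.norm_of_nonneg (by positivity), Complex.norm_exp]
        have hre : (-(2 * Real.pi * Complex.I * ((j : ℕ) : ℂ) * ((k : ℕ) : ℂ) / (N : ℂ)) : ℂ).re = 0 := by
          rw [show (-(2 * Real.pi * Complex.I * ((j : ℕ) : ℂ) * ((k : ℕ) : ℂ) / (N : ℂ)) : ℂ) =
            ((-(2 * Real.pi * (j : ℕ) * (k : ℕ) / N) : ℝ) : ℂ) * Complex.I by push_cast; ring]
          simp
        rw [hre, Real.exp_zero, mul_one, div_pow, Real.sq_sqrt hNpos.le, one_pow]
      rw [this, ← Complex.ofReal_mul]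
      congr 1
      ring
    rw [Finset.sum_congr rfl fun j _ => hterm j, ← Complex.ofReal_sum, smul_eq_mul,
      ← Complex.ofReal_mul, ← Finset.sum_div, ← hT]
    congr 1
    ring

open scoped MatrixOrder ComplexOrder in
/-- The Gram matrix of the factor `M = S^{1/2} F` in `H F = G M`, for `H = G S^{1/2}`. -/
lemma sqrt_mul_precoder_gram {N : ℕ} {S F : Matrix (Fin N) (Fin N) ℂ} (hS : S.PosSemidef) :
    (CFC.sqrt S * F)ᴴ * (CFC.sqrt S * F) = Fᴴ * S * F := by
  have h0 : 0 ≤ S := Matrix.nonneg_iff_posSemidef.2 hS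
  have hh : (CFC.sqrt S)ᴴ = CFC.sqrt S :=
    (Matrix.nonneg_iff_posSemidef.1 (CFC.sqrt_nonneg S)).isHermitian
  rw [Matrix.conjTranspose_mul, hh, Matrix.mul_assoc, ← Matrix.mul_assoc (CFC.sqrt S),
    CFC.sqrt_mul_sqrt_self S h0, Matrix.mul_assoc]

open scoped MatrixOrder in
lemma measurable_mul_sqrt (Nr : ℕ) {N : ℕ} (S : Matrix (Fin N) (Fin N) ℂ) :
    Measurable fun (G : Fin Nr → Fin N → ℂ) i j => (Matrix.of G * CFC.sqrt S) i j := by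
  refine measurable_pi_iff.2 fun i => measurable_pi_iff.2 fun j => ?_
  simp only [Matrix.mul_apply, Matrix.of_apply]
  fun_prop

lemma ae_det_gram_ne_zero {Nr N : ℕ} (hN : N ≤ Nr) :
    ∀ᵐ G ∂(Measure.pi fun _ : Fin Nr => Measure.pi fun _ : Fin N => complexGaussian 1),
      ((Matrix.of G)ᴴ * Matrix.of G).det ≠ 0 := by
  have h := ae_linearIndependent_gaussianColumns hN
  have hswap : gaussianColumns N Nr =
    (Measure.pi fun _ : Fin Nr => Measure.pi fun _ : Fin N => complexGaussian 1).map
      fun G j i => G i j := (pi_pi_map_swap _).symm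
  rw [hswap] at h
  have hm : Measurable fun (G : Fin Nr → Fin N → ℂ) j i => G i j := by fun_prop
  filter_upwards [ae_of_ae_map hm.aemeasurable h] with G hG
  exact (linearIndependent_iff_det_gram _).1 hG

open scoped MatrixOrder ComplexOrder in
/-- The error probability of the `k`-th symbol is that of a scalar channel with random noise
variance `c / (η ∑ ‖zᵢ‖²)`. It depends on the symbol only through the `k`-th diagonal entry `c` of
`(Fᴴ S F)⁻¹`. -/
lemma systemLaw_error_eq_integral {Nr m : ℕ} (hm : m + 1 ≤ Nr)
    {S F : Matrix (Fin (m + 1)) (Fin (m + 1)) ℂ} (hS : S.PosSemidef)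
    (hdet : (Fᴴ * S * F).det ≠ 0) {c : ℝ} (hc : 0 < c) (k : Fin (m + 1))
    (hk : (Fᴴ * S * F)⁻¹ k k = (c : ℂ)) {C : Finset ℂ} (hC : C.Nonempty) {η : ℝ} (hη : 0 < η)
    {δ : ℂ → ℂ} (hδ : IsHardDecision C δ) :
    (systemLaw Nr (m + 1) S η C).real
        {x | δ (zfOutput F (Matrix.of x.1) x.2.1 x.2.2 k) ≠ x.2.1 k} =
      ∫ z, errProb C ((c * (∑ i, ‖z i‖ ^ 2)⁻¹).toNNReal * (1 / η).toNNReal)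
        ∂stdComplexGaussian (Nr - m) := by
  obtain ⟨M, hM⟩ : ∃ M, M = CFC.sqrt S * F := ⟨_, rfl⟩
  have hMM : Mᴴ * M = Fᴴ * S * F := hM ▸ sqrt_mul_precoder_gram hS
  have hMdet : M.det ≠ 0 := fun h0 => hdet (by rw [← hMM, Matrix.det_mul, h0, mul_zero])
  set Γ := Measure.pi fun _ : Fin Nr => Measure.pi fun _ : Fin (m + 1) => complexGaussian 1
  have hprod : ∀ G : Fin Nr → Fin (m + 1) → ℂ,
      (Matrix.of (fun i j => (Matrix.of G * CFC.sqrt S) i j) * F)ᴴ *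
        (Matrix.of (fun i j => (Matrix.of G * CFC.sqrt S) i j) * F) =
      Mᴴ * ((Matrix.of G)ᴴ * Matrix.of G) * M := fun G => by
    change (Matrix.of G * CFC.sqrt S * F)ᴴ * (Matrix.of G * CFC.sqrt S * F) = _
    rw [Matrix.mul_assoc _ _ F, ← hM, Matrix.conjTranspose_mul]
    simp only [Matrix.mul_assoc]
  have hmap : channelLaw Nr (m + 1) S = Γ.map
    (fun G i j => (Matrix.of G * CFC.sqrt S) i j) := rfl
  have hmR := measurable_mul_sqrt Nr S
  have hA : ∀ᵐ H ∂channelLaw Nr (m + 1) S,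
      ((Matrix.of H * F)ᴴ * (Matrix.of H * F)).det ≠ 0 := by
    have hcont : Continuous fun H : Fin Nr → Fin (m + 1) → ℂ =>
        ((Matrix.of H * F)ᴴ * (Matrix.of H * F)).det := by
      have : Continuous fun A : Fin Nr → Fin (m + 1) → ℂ => Matrix.of A := continuous_id
      have h2 := this.matrix_mul (continuous_const (y := F))
      exact (h2.matrix_conjTranspose.matrix_mul h2).matrix_det
    rw [hmap]
    refine (ae_map_iff (p := fun H : Fin Nr → Fin (m + 1) → ℂ =>
      ((Matrix.of H * F)ᴴ * (Matrix.of H * F)).det ≠ 0) hmR.aemeasurable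
      (hcont.measurable (measurableSet_singleton (0 : ℂ)).compl)).2 ?_
    filter_upwards [ae_det_gram_ne_zero hm] with G hG
    rw [hprod, Matrix.det_mul, Matrix.det_mul, Matrix.det_conjTranspose]
    exact mul_ne_zero (mul_ne_zero (star_ne_zero.2 hMdet) hG) hMdet
  -- The `k`-th diagonal entry of `(Mᴴ GᴴG M)⁻¹` is the quadratic form of `(GᴴG)⁻¹` at `a`.
  set a : Fin (m + 1) → ℂ := (M⁻¹)ᴴ *ᵥ Pi.single k 1 with ha
  have hquad : ∀ P : Matrix (Fin (m + 1)) (Fin (m + 1)) ℂ,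
      star a ⬝ᵥ (P *ᵥ a) = (M⁻¹ * P * (M⁻¹)ᴴ) k k := fun P => by
    rw [ha, Matrix.star_mulVec, ← Matrix.dotProduct_mulVec, Matrix.mulVec_mulVec,
      Matrix.mulVec_mulVec, Matrix.conjTranspose_conjTranspose, Matrix.mul_assoc]
    simp
  have haa : star a ⬝ᵥ a = (c : ℂ) := by
    have := hquad 1
    rw [Matrix.one_mulVec, Matrix.mul_one] at this
    rw [this, ← hk, ← hMM, Matrix.mul_inv_rev, Matrix.conjTranspose_nonsing_inv]
  have hvar : ∀ G : Fin Nr → Fin (m + 1) → ℂ,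
      zfNoiseVar F k (fun i j => (Matrix.of G * CFC.sqrt S) i j) =
        (star a ⬝ᵥ (((Matrix.of G)ᴴ * Matrix.of G)⁻¹ *ᵥ a)).re := fun G => by
    rw [zfNoiseVar, hprod, hquad, Matrix.mul_inv_rev, Matrix.mul_inv_rev,
      Matrix.conjTranspose_nonsing_inv, Matrix.mul_assoc]
  have hme : Measurable fun x : ℝ => ENNReal.ofReal
      (errProb C (x.toNNReal * (1 / η).toNNReal)) :=
    ((measurable_errProb C).comp (measurable_real_toNNReal.mul_const _)).ennreal_ofReal
  have hmq : Measurable fun G : Fin Nr → Fin (m + 1) → ℂ =>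
      (star a ⬝ᵥ (((Matrix.of G)ᴴ * Matrix.of G)⁻¹ *ᵥ a)).re := by
    simp_rw [← hvar]
    exact (measurable_zfNoiseVar F k).comp hmR
  have hmz : Measurable fun z : Fin (Nr - m) → ℂ => c * (∑ i, ‖z i‖ ^ 2)⁻¹ :=
    (measurable_inv_sum_sq _).const_mul c
  rw [measureReal_def, systemLaw_error_eq hC hη hδ hA, hmap]
  have hpush : ∫⁻ H, ENNReal.ofReal (errProb C ((zfNoiseVar F k H).toNNReal * (1 / η).toNNReal))
      ∂Γ.map (fun G i j => (Matrix.of G * CFC.sqrt S) i j) =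
      ∫⁻ G, ENNReal.ofReal (errProb C
        (((star a ⬝ᵥ (((Matrix.of G)ᴴ * Matrix.of G)⁻¹ *ᵥ a)).re).toNNReal *
          (1 / η).toNNReal)) ∂Γ :=
    (lintegral_map (hme.comp (measurable_zfNoiseVar F k)) hmR).trans
      (lintegral_congr fun G => by simp only [Function.comp_def, hvar])
  refine (congrArg ENNReal.toReal hpush).trans ?_
  rw [← lintegral_map (μ := Γ) hme hmq, map_inv_gram_quadratic hm a hc haa,
    lintegral_map hme hmz, integral_eq_lintegral_of_nonneg_ae
      (.of_forall fun z => errProb_nonneg _ _)]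
  exact ((measurable_errProb C).comp
    ((measurable_real_toNNReal.comp hmz).mul_const _)).aestronglyMeasurable

/-! ### Concentration of the sum of squared moduli -/

lemma complexGaussian_map_re (v : ℝ≥0) :
    MeasurePreserving Complex.re (complexGaussian v) (gaussianReal 0 (v / 2)) := by
  refine ⟨Complex.measurable_re, ?_⟩
  rw [complexGaussian, Measure.map_map Complex.measurable_re measurable_complex_mk]
  exact measurePreserving_fst.map_eq

lemma complexGaussian_map_im (v : ℝ≥0) :
    MeasurePreserving Complex.im (complexGaussian v) (gaussianReal 0 (v / 2)) := by
  refine ⟨Complex.measurable_im, ?_⟩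
  rw [complexGaussian, Measure.map_map Complex.measurable_im measurable_complex_mk]
  exact measurePreserving_snd.map_eq

lemma memLp_sq_gaussianReal (v : ℝ≥0) : MemLp (fun x : ℝ => x ^ 2) 2 (gaussianReal 0 v) := by
  have h4 : MemLp (id : ℝ → ℝ) 4 (gaussianReal 0 v) := memLp_id_gaussianReal' 4 (by simp)
  have : ENNReal.HolderTriple 4 4 2 := ⟨by
    rw [← two_mul, show (4 : ENNReal) = 2 * 2 by norm_num,
      ENNReal.mul_inv (by simp) (by simp), ← mul_assoc,
      ENNReal.mul_inv_cancel (by simp) (by simp), one_mul]⟩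
  simpa [sq] using h4.mul' h4

lemma integral_sq_gaussianReal (v : ℝ≥0) : ∫ x, x ^ 2 ∂gaussianReal 0 v = v := by
  have h := variance_eq_sub (memLp_id_gaussianReal' (μ := 0) (v := v) 2 (by simp))
  rw [variance_id_gaussianReal] at h
  simpa using h.symm

lemma norm_sq_eq_re_add_im (z : ℂ) : ‖z‖ ^ 2 = z.re ^ 2 + z.im ^ 2 := by
  rw [← Complex.normSq_eq_norm_sq, Complex.normSq_apply, sq, sq]

lemma memLp_norm_sq_complexGaussian (v : ℝ≥0) :
    MemLp (fun z : ℂ => ‖z‖ ^ 2) 2 (complexGaussian v) := by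
  simp_rw [norm_sq_eq_re_add_im]
  exact ((memLp_sq_gaussianReal _).comp_measurePreserving (complexGaussian_map_re v)).add
    ((memLp_sq_gaussianReal _).comp_measurePreserving (complexGaussian_map_im v))

lemma integral_norm_sq_complexGaussian (v : ℝ≥0) : ∫ z, ‖z‖ ^ 2 ∂complexGaussian v = v := by
  have hre := (memLp_sq_gaussianReal _).comp_measurePreserving (complexGaussian_map_re v)
  have him := (memLp_sq_gaussianReal _).comp_measurePreserving (complexGaussian_map_im v)
  have e1 : ∫ z : ℂ, z.re ^ 2 ∂complexGaussian v = (v / 2 : ℝ≥0) := by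
    rw [← integral_sq_gaussianReal, ← (complexGaussian_map_re v).map_eq,
      integral_map Complex.measurable_re.aemeasurable (by fun_prop)]
  have e2 : ∫ z : ℂ, z.im ^ 2 ∂complexGaussian v = (v / 2 : ℝ≥0) := by
    rw [← integral_sq_gaussianReal, ← (complexGaussian_map_im v).map_eq,
      integral_map Complex.measurable_im.aemeasurable (by fun_prop)]
  simp_rw [norm_sq_eq_re_add_im]
  refine (integral_add (hre.integrable (by norm_num)) (him.integrable (by norm_num))).trans ?_
  simp only [Function.comp_def]
  rw [e1, e2]
  push_cast
  ring

/-- Chebyshev's inequality for the empirical second moment of `d` standard complex Gaussians. -/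
lemma stdComplexGaussian_real_deviation_le {d : ℕ} (hd : 0 < d) {ρ : ℝ} (hρ : 0 < ρ) :
    (stdComplexGaussian d).real {z | ρ ≤ |(∑ i, ‖z i‖ ^ 2) / d - 1|} ≤
      Var[fun z : ℂ => ‖z‖ ^ 2; complexGaussian 1] / (d * ρ ^ 2) := by
  have hd' : (0 : ℝ) < d := by exact_mod_cast hd
  have hL : ∀ i : Fin d, MemLp (fun z : Fin d → ℂ => ‖z i‖ ^ 2) 2 (stdComplexGaussian d) :=
    fun i => (memLp_norm_sq_complexGaussian 1).comp_measurePreserving (measurePreserving_eval _ i)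
  set X : (Fin d → ℂ) → ℝ := ∑ i, fun z : Fin d → ℂ => ‖z i‖ ^ 2 with hX
  have hXa : ∀ z, X z = ∑ i, ‖z i‖ ^ 2 := fun z => by simp [hX]
  have hXL : MemLp X 2 (stdComplexGaussian d) := memLp_finsetSum' _ fun i _ => hL i
  have hmean : ∫ z, X z ∂stdComplexGaussian d = d := by
    simp_rw [hXa]
    rw [integral_finsetSum _ fun i _ => (hL i).integrable (by norm_num)]
    have : ∀ i : Fin d, ∫ z, ‖z i‖ ^ 2 ∂stdComplexGaussian d = 1 := fun i => by
      rw [integral_comp_eval (μ := fun _ : Fin d => complexGaussian 1) (f := fun w : ℂ => ‖w‖ ^ 2)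
        (by fun_prop), integral_norm_sq_complexGaussian]
      simp
    simp [this]
  have hvar : Var[X; stdComplexGaussian d] =
      d * Var[fun z : ℂ => ‖z‖ ^ 2; complexGaussian 1] := by
    rw [hX, variance_sum_pi (μ := fun _ : Fin d => complexGaussian 1)
      (X := fun _ (w : ℂ) => ‖w‖ ^ 2) fun _ => memLp_norm_sq_complexGaussian 1]
    simp
  have hcheb := meas_ge_le_variance_div_sq hXL (c := d * ρ) (by positivity)
  rw [hmean, hvar] at hcheb
  have hset : {z : Fin d → ℂ | ρ ≤ |(∑ i, ‖z i‖ ^ 2) / d - 1|} = {z | d * ρ ≤ |X z - d|} := by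
    ext z
    simp only [Set.mem_ofPred_eq, hXa]
    rw [show (∑ i, ‖z i‖ ^ 2) / (d : ℝ) - 1 = ((∑ i, ‖z i‖ ^ 2) - d) / d by field_simp,
      abs_div, abs_of_pos hd', le_div_iff₀ hd', mul_comm]
  rw [hset, measureReal_def]
  refine (ENNReal.toReal_mono ENNReal.ofReal_ne_top hcheb).trans (le_of_eq ?_)
  rw [ENNReal.toReal_ofReal (div_nonneg (mul_nonneg hd'.le (variance_nonneg _ _)) (sq_nonneg _))]
  field_simp

/-- The law of large numbers for the effective noise variance `x / ∑ ‖zᵢ‖²`: averages of bounded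
functions of it converge, at a point of continuity, if `x` grows like the number of terms. -/
lemma tendsto_integral_mul_inv_sum_sq {d : ℕ → ℕ} (hd : Tendsto d atTop atTop) {x : ℕ → ℝ}
    {v₀ : ℝ} (hx : Tendsto (fun n => x n / d n) atTop (𝓝 v₀)) {f : ℝ → ℝ} (hf : Measurable f)
    (hf0 : ∀ v, 0 ≤ f v) (hf1 : ∀ v, f v ≤ 1) (hfc : ContinuousAt f v₀) :
    Tendsto (fun n => ∫ z, f (x n * (∑ i, ‖z i‖ ^ 2)⁻¹) ∂stdComplexGaussian (d n))
      atTop (𝓝 (f v₀)) := by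
  rw [Metric.tendsto_atTop']
  intro ε hε
  have hcont : Tendsto (fun p : ℝ × ℝ => f (p.1 * p.2⁻¹)) (𝓝 (v₀, 1)) (𝓝 (f v₀)) := by
    have h1 : Tendsto (fun p : ℝ × ℝ => p.1 * p.2⁻¹) (𝓝 (v₀, 1)) (𝓝 v₀) := by
      have h2 : ContinuousAt (fun p : ℝ × ℝ => p.1 * p.2⁻¹) (v₀, 1) :=
        continuousAt_fst.mul (continuousAt_snd.inv₀ one_ne_zero)
      simpa [ContinuousAt] using h2
    exact hfc.tendsto.comp h1
  obtain ⟨ρ, hρ, hball⟩ := Metric.tendsto_nhds_nhds.1 hcont (ε / 2) (half_pos hε)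
  set κ := Var[fun z : ℂ => ‖z‖ ^ 2; complexGaussian 1]
  have hsmall : Tendsto (fun n => κ / ((d n : ℝ) * ρ ^ 2)) atTop (𝓝 0) :=
    tendsto_const_nhds.div_atTop
      ((tendsto_natCast_atTop_atTop.comp hd).atTop_mul_const (pow_pos hρ 2))
  have hev : ∀ᶠ n in atTop, dist (∫ z, f (x n * (∑ i, ‖z i‖ ^ 2)⁻¹) ∂stdComplexGaussian (d n))
      (f v₀) < ε := by
    filter_upwards [hsmall.eventually (gt_mem_nhds (half_pos hε)), hd.eventually_gt_atTop 0,
      hx.eventually (Metric.ball_mem_nhds _ hρ)] with n hn hdn hxn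
    have hd' : (0 : ℝ) < d n := by exact_mod_cast hdn
    set B := {z : Fin (d n) → ℂ | ρ ≤ |(∑ i, ‖z i‖ ^ 2) / d n - 1|}
    have hB : MeasurableSet B := measurableSet_le measurable_const (by fun_prop)
    have hmeas : Measurable fun z : Fin (d n) → ℂ => f (x n * (∑ i, ‖z i‖ ^ 2)⁻¹) :=
      hf.comp ((measurable_inv_sum_sq _).const_mul _)
    have hbound : ∀ z, |f (x n * (∑ i, ‖z i‖ ^ 2)⁻¹) - f v₀| ≤ ε / 2 + B.indicator 1 z := by
      intro z
      by_cases hz : z ∈ B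
      · rw [Set.indicator_of_mem hz, Pi.one_apply, abs_le]
        constructor <;> linarith [hf0 (x n * (∑ i, ‖z i‖ ^ 2)⁻¹), hf1 (x n * (∑ i, ‖z i‖ ^ 2)⁻¹),
          hf0 v₀, hf1 v₀]
      · rw [Set.indicator_of_notMem hz, add_zero]
        have hz' : |(∑ i, ‖z i‖ ^ 2) / d n - 1| < ρ := not_le.1 hz
        have h := @hball (x n / d n, (∑ i, ‖z i‖ ^ 2) / d n)
          (by rw [Prod.dist_eq]; exact max_lt hxn hz')
        have e : x n / d n * ((∑ i, ‖z i‖ ^ 2) / d n)⁻¹ = x n * (∑ i, ‖z i‖ ^ 2)⁻¹ := by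
          rw [inv_div, div_mul_div_comm, mul_comm (d n : ℝ), mul_div_mul_right _ _ hd'.ne',
            div_eq_mul_inv]
        rw [Real.dist_eq] at h
        simp only [e] at h
        exact h.le
    have hint : Integrable (fun z : Fin (d n) → ℂ => f (x n * (∑ i, ‖z i‖ ^ 2)⁻¹))
        (stdComplexGaussian (d n)) :=
      Integrable.of_bound hmeas.aestronglyMeasurable 1 (.of_forall fun z => by
        rw [Real.norm_of_nonneg (hf0 _)]; exact hf1 _)
    have hintB : Integrable (B.indicator (1 : (Fin (d n) → ℂ) → ℝ)) (stdComplexGaussian (d n)) :=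
      (integrable_const (1 : ℝ)).indicator hB
    have hdiff : ∫ z, f (x n * (∑ i, ‖z i‖ ^ 2)⁻¹) ∂stdComplexGaussian (d n) - f v₀ =
        ∫ z, (f (x n * (∑ i, ‖z i‖ ^ 2)⁻¹) - f v₀) ∂stdComplexGaussian (d n) := by
      rw [integral_sub hint (integrable_const _)]
      simp
    rw [Real.dist_eq, hdiff]
    calc _ ≤ ∫ z, |f (x n * (∑ i, ‖z i‖ ^ 2)⁻¹) - f v₀| ∂stdComplexGaussian (d n) :=
          abs_integral_le_integral_abs
      _ ≤ ∫ z, (ε / 2 + B.indicator 1 z) ∂stdComplexGaussian (d n) :=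
          integral_mono (hint.sub (integrable_const _)).abs ((integrable_const _).add hintB) hbound
      _ = ε / 2 + (stdComplexGaussian (d n)).real B := by
          rw [integral_add (integrable_const _) hintB, integral_indicator_one hB]
          simp
      _ < ε := by
          have := stdComplexGaussian_real_deviation_le hdn hρ
          linarith
  obtain ⟨N, hN⟩ := eventually_atTop.1 hev
  exact ⟨N, fun n hn => hN n hn.le⟩

/-! ### The limit of the average symbol error probability -/

open scoped ComplexOrder in
lemma averageSEP_eq_integral {Nr N : ℕ} (hN : N ≠ 0) (hNr : N ≤ Nr)
    {S F W : Matrix (Fin N) (Fin N) ℂ} {ev : Fin N → ℝ} (hW : Wᴴ * W = 1) (hev : ∀ k, 0 < ev k)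
    (hS : S = W * Matrix.diagonal (fun k => ((ev k : ℝ) : ℂ)) * Wᴴ)
    (hF : F = ((1 / √(∑ k, ev k ^ (-(1 / 2) : ℝ)) : ℝ) : ℂ) •
      (W * Matrix.diagonal (fun k => ((ev k ^ (-(1 / 4) : ℝ) : ℝ) : ℂ)) * dftMatrix N))
    {C : Finset ℂ} (hC : C.Nonempty) {η : ℝ} (hη : 0 < η) {δ : ℂ → ℂ} (hδ : IsHardDecision C δ) :
    averageSEP Nr N S η C δ F =
      ∫ z, errProb C (((∑ k, (√(ev k))⁻¹) ^ 2 / N * (∑ i, ‖z i‖ ^ 2)⁻¹).toNNReal *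
        (1 / η).toNNReal) ∂stdComplexGaussian (Nr + 1 - N) := by
  obtain ⟨m, rfl⟩ : ∃ m, N = m + 1 := Nat.exists_eq_succ_of_ne_zero hN
  obtain ⟨hdet, hdiag⟩ := inv_precoder_gram hN hW hev hS hF
  have hpsd : S.PosSemidef := by
    rw [hS]
    refine Matrix.PosSemidef.mul_mul_conjTranspose_same (Matrix.PosSemidef.diagonal fun k => ?_) W
    exact Complex.zero_le_real.2 (hev k).le
  have hc : 0 < (∑ k, (√(ev k))⁻¹) ^ 2 / ((m + 1 : ℕ) : ℝ) := by
    have : 0 < ∑ k, (√(ev k))⁻¹ :=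
      Finset.sum_pos (fun k _ => inv_pos.2 (Real.sqrt_pos.2 (hev k))) Finset.univ_nonempty
    positivity
  rw [averageSEP, Finset.sum_congr rfl fun k _ =>
    systemLaw_error_eq_integral (m := m) hNr hpsd hdet hc k (hdiag k) hC hη hδ, Finset.sum_const,
    Finset.card_univ, Fintype.card_fin, nsmul_eq_mul, ← mul_assoc,
    one_div_mul_cancel (by positivity), one_mul, Nat.add_sub_add_right]

/-- The average symbol error probability converges to that of a Gaussian channel with noise
variance `Λ² / ((β - 1) η)`. -/
theorem tendsto_averageSEP {σ : ℤ → ℂ} (h_sq : Summable fun k : ℤ => ‖σ k‖ ^ 2)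
    (h_inf : 0 < symbolEssInf σ) {η : ℝ} (hη : 0 < η) {β : ℝ} (hβ : 1 < β) {Nt Nr : ℕ → ℕ}
    (hNt : Tendsto Nt atTop atTop) (hNr : ∀ n, (Nr n : ℝ) = β * (Nt n : ℝ))
    {F : ∀ n, Matrix (Fin (Nt n)) (Fin (Nt n)) ℂ}
    (hF : ∀ n, IsOptimalPrecoder (toeplitz σ (Nt n)) (F n))
    {C : Finset ℂ} (hC : C.Nonempty) {δ : ℂ → ℂ} (hδ : IsHardDecision C δ) :
    Tendsto (fun n => averageSEP (Nr n) (Nt n) (toeplitz σ (Nt n)) η C δ (F n)) atTop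
      (𝓝 (errProb C (Lam σ ^ 2 / ((β - 1) * η)).toNNReal)) := by
  choose W hWu ev hmono hS hF using hF
  have hW : ∀ n, (W n)ᴴ * W n = 1 := fun n => (Matrix.mem_unitaryGroup_iff').1 (hWu n)
  obtain ⟨m, hm0, hm⟩ := exists_pos_le_circSymbol h_inf
  have hev : ∀ n k, 0 < ev n k := fun n k =>
    hm0.trans_le (le_eigenvalue_of_le_circSymbol h_sq hm (hW n) (hS n) k)
  have hτ := tendsto_trace_inv_sqrt_toeplitz h_sq h_inf hNt hW hS
  have hβ' : 0 < β - 1 := sub_pos.2 hβ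
  have hle : ∀ n, Nt n ≤ Nr n := fun n => by
    have : (Nt n : ℝ) ≤ Nr n := by
      rw [hNr]
      nlinarith [(Nt n).cast_nonneg (α := ℝ)]
    exact_mod_cast this
  have hdcast : ∀ n, ((Nr n + 1 - Nt n : ℕ) : ℝ) = (β - 1) * Nt n + 1 := fun n => by
    rw [Nat.cast_sub (by have := hle n; omega)]
    push_cast
    rw [hNr]
    ring
  have hNtR : Tendsto (fun n => (Nt n : ℝ)) atTop atTop := tendsto_natCast_atTop_atTop.comp hNt
  have hd : Tendsto (fun n => Nr n + 1 - Nt n) atTop atTop := by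
    refine tendsto_natCast_atTop_iff (R := ℝ) |>.1 ?_
    simp_rw [hdcast]
    exact tendsto_atTop_add_const_right _ _ (hNtR.const_mul_atTop hβ')
  have hx : Tendsto (fun n => (∑ k, (√(ev n k))⁻¹) ^ 2 / (Nt n : ℝ) / (Nr n + 1 - Nt n : ℕ)) atTop
      (𝓝 (Lam σ ^ 2 / (β - 1))) := by
    have h1 : Tendsto (fun n => ((Nt n : ℝ)⁻¹ * ∑ k, (√(ev n k))⁻¹) ^ 2 /
        ((β - 1) + (Nt n : ℝ)⁻¹)) atTop (𝓝 (Lam σ ^ 2 / (β - 1 + 0))) :=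
      (hτ.pow 2).div (tendsto_const_nhds.add (tendsto_inv_atTop_zero.comp hNtR))
        (by rw [add_zero]; exact hβ'.ne')
    rw [add_zero] at h1
    refine h1.congr' ?_
    filter_upwards [hNt.eventually_gt_atTop 0] with n hn
    have hn' : (0 : ℝ) < Nt n := by exact_mod_cast hn
    rw [hdcast]
    field_simp
  have hΛ := Lam_pos h_inf
  have hv0 : (0 : ℝ) < Lam σ ^ 2 / (β - 1) := by positivity
  have hη' : (1 / η).toNNReal ≠ 0 := by
    rw [Ne, Real.toNNReal_eq_zero, not_le]
    positivity
  have hv0' : (Lam σ ^ 2 / (β - 1)).toNNReal * (1 / η).toNNReal ≠ 0 := by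
    refine mul_ne_zero ?_ hη'
    rw [Ne, Real.toNNReal_eq_zero, not_le]
    exact hv0
  have hmain := tendsto_integral_mul_inv_sum_sq hd hx
    (f := fun v => errProb C (v.toNNReal * (1 / η).toNNReal))
    ((measurable_errProb C).comp (measurable_real_toNNReal.mul_const _))
    (fun v => errProb_nonneg _ _) (fun v => errProb_le_one _ _)
    (ContinuousAt.comp (f := fun v : ℝ => v.toNNReal * (1 / η).toNNReal)
      (continuousAt_errProb C hv0')
      (continuous_real_toNNReal.mul continuous_const).continuousAt)
  have e : (Lam σ ^ 2 / ((β - 1) * η)).toNNReal =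
      (Lam σ ^ 2 / (β - 1)).toNNReal * (1 / η).toNNReal := by
    rw [← Real.toNNReal_mul hv0.le]
    congr 1
    field_simp
  rw [e]
  refine hmain.congr' ?_
  filter_upwards [hNt.eventually_gt_atTop 0] with n hn
  exact (averageSEP_eq_integral hn.ne' (hle n) (hW n) (hev n) (hS n) (hF n) hC hη hδ).symm

end MassiveMIMO

end

theorem theorem2
    (σ : ℤ → ℂ) (h_herm : ∀ k, σ (-k) = conj (σ k))
    (h_sq : Summable fun k : ℤ => ‖σ k‖ ^ 2)
    (h_inf : 0 < MassiveMIMO.symbolEssInf σ)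
    (η : ℝ) (hη : 0 < η) (β : ℝ) (hβ : 1 < β)
    (Nt Nr : ℕ → ℕ) (hNt : Tendsto Nt atTop atTop)
    (hNr : ∀ n, (Nr n : ℝ) = β * (Nt n : ℝ))
    (F : ∀ n, Matrix (Fin (Nt n)) (Fin (Nt n)) ℂ)
    (hF : ∀ n, MassiveMIMO.IsOptimalPrecoder (MassiveMIMO.toeplitz σ (Nt n)) (F n)) :
    (∀ M : ℕ, 2 ≤ M → ∀ δ : ℂ → ℂ, MassiveMIMO.IsHardDecision (MassiveMIMO.pam M) δ →
      Tendsto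
        (fun n => MassiveMIMO.averageSEP (Nr n) (Nt n) (MassiveMIMO.toeplitz σ (Nt n)) η
          (MassiveMIMO.pam M) δ (F n))
        atTop
        (𝓝 (2 * ((M : ℝ) - 1) / M *
          MassiveMIMO.Q (√(6 * η * (β - 1) / (((M : ℝ) ^ 2 - 1) * MassiveMIMO.Lam σ ^ 2)))))) ∧
    (∀ M : ℕ, 2 ≤ M → ∀ δ : ℂ → ℂ, MassiveMIMO.IsHardDecision (MassiveMIMO.psk M) δ →
      Tendsto
        (fun n => MassiveMIMO.averageSEP (Nr n) (Nt n) (MassiveMIMO.toeplitz σ (Nt n)) η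
          (MassiveMIMO.psk M) δ (F n))
        atTop
        (𝓝 (1 / Real.pi * ∫ θ in (0 : ℝ)..(((M : ℝ) - 1) * Real.pi / M),
          Real.exp (-(η * (β - 1) * Real.sin (Real.pi / M) ^ 2 /
            (MassiveMIMO.Lam σ ^ 2 * Real.sin θ ^ 2)))))) ∧
    (∀ M L : ℕ, 2 ≤ L → M = L ^ 2 → ∀ δ : ℂ → ℂ,
      MassiveMIMO.IsHardDecision (MassiveMIMO.squareQAM L) δ →
      Tendsto
        (fun n => MassiveMIMO.averageSEP (Nr n) (Nt n) (MassiveMIMO.toeplitz σ (Nt n)) η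
          (MassiveMIMO.squareQAM L) δ (F n))
        atTop
        (𝓝 (4 * (√(M : ℝ) - 1) / √(M : ℝ) *
            MassiveMIMO.Q (√(3 * η * (β - 1) / (((M : ℝ) - 1) * MassiveMIMO.Lam σ ^ 2))) -
          4 * (√(M : ℝ) - 1) ^ 2 / M *
            MassiveMIMO.Q (√(3 * η * (β - 1) / (((M : ℝ) - 1) * MassiveMIMO.Lam σ ^ 2))) ^ 2))) := by
  
  have hΛ := MassiveMIMO.Lam_pos h_inf
  have hβ' : 0 < β - 1 := sub_pos.2 hβ
  have hv : 0 < MassiveMIMO.Lam σ ^ 2 / ((β - 1) * η) := by positivity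
  have hvn : (MassiveMIMO.Lam σ ^ 2 / ((β - 1) * η)).toNNReal ≠ 0 := by
    rw [Ne, Real.toNNReal_eq_zero, not_le]
    exact hv
  have hcoe : (((MassiveMIMO.Lam σ ^ 2 / ((β - 1) * η)).toNNReal : ℝ≥0) : ℝ) =
      MassiveMIMO.Lam σ ^ 2 / ((β - 1) * η) := Real.coe_toNNReal _ hv.le
  have key : ∀ (C : Finset ℂ), C.Nonempty → ∀ δ : ℂ → ℂ, MassiveMIMO.IsHardDecision C δ → _ :=
    fun C hC δ hδ => MassiveMIMO.tendsto_averageSEP h_sq h_inf hη hβ hNt hNr hF hC hδ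
  refine ⟨fun M hM δ hδ => ?_, fun M hM δ hδ => ?_, fun M L hL hML δ hδ => ?_⟩
  · have : NeZero M := ⟨by omega⟩
    have h := key (MassiveMIMO.pam M) (Finset.univ_nonempty.image _) δ hδ
    rw [MassiveMIMO.errProb_pam hM hvn, hcoe] at h
    have harg : 6 * η * (β - 1) / (((M : ℝ) ^ 2 - 1) * MassiveMIMO.Lam σ ^ 2) =
        6 / (((M : ℝ) ^ 2 - 1) * (MassiveMIMO.Lam σ ^ 2 / ((β - 1) * η))) := by
      field_simp
    rw [harg]
    exact h
  · have : NeZero M := ⟨by omega⟩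
    have h := key (MassiveMIMO.psk M) (Finset.univ_nonempty.image _) δ hδ
    rw [MassiveMIMO.errProb_psk hM hvn, hcoe] at h
    have harg : ∀ θ : ℝ, η * (β - 1) * Real.sin (Real.pi / M) ^ 2 /
        (MassiveMIMO.Lam σ ^ 2 * Real.sin θ ^ 2) = Real.sin (Real.pi / M) ^ 2 /
        (MassiveMIMO.Lam σ ^ 2 / ((β - 1) * η) * Real.sin θ ^ 2) := fun θ => by
      field_simp
    simp_rw [harg]
    exact h
  · have : NeZero L := ⟨by omega⟩
    have h := key (MassiveMIMO.squareQAM L) (Finset.univ_nonempty.image _) δ hδ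
    rw [MassiveMIMO.errProb_squareQAM hL hvn, hcoe] at h
    have hsq : √(M : ℝ) = L := by
      rw [hML, Nat.cast_pow, Real.sqrt_sq (Nat.cast_nonneg L)]
    have hMR : (M : ℝ) = (L : ℝ) ^ 2 := by rw [hML, Nat.cast_pow]
    have harg : 3 * η * (β - 1) / (((M : ℝ) - 1) * MassiveMIMO.Lam σ ^ 2) =
        3 / (((L : ℝ) ^ 2 - 1) * (MassiveMIMO.Lam σ ^ 2 / ((β - 1) * η))) := by
      rw [hMR]
      field_simp
    rw [harg, hsq, hMR]
    exact h
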